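/- Let $P$ be a closed polyhedron in $\mathbb{R}^3$ whose boundary is a connected, embedded, closed surface, given as a triangle mesh with $n$ vertices; its facets are the polygons (possibly with holes) obtained by merging edge-adjacent coplanar triangles, and two distinct facets are neighbours if they share an edge. A fixture of spreading degree two of $P$ consists of a facet $f_p$ (the palm) and a finite set of fingers, that is, of pairs $(f_b,f_t)$ of facets (body and fingertip) such that $f_b$ is a neighbour of $f_p$, $f_t$ is a neighbour of $f_b$, and $f_t\neq f_p$, where distinct fingers have distinct bodies. For a facet $f$ let $h(f)$ be the open hemisphere of the unit vectors that form an acute angle with the outer normal of $f$. The fixture is a (valid) snapping fixture if the hemispheres $h(f)$ of all its facets (palm, bodies and fingertips) cover the unit sphere $\mathbb{S}^2$, while those of the palm and the bodies alone do not. There is an algorithm (a program for the real RAM with unit cost per elementary operation) with the following property: for every $g$ there is a constant $C_g$ such that on every polyhedron $P$ with $n$ vertices and of genus at most $g$ the algorithm halts after at most $C_g\,n^3$ steps; it reports correctly whether $P$ has a snapping fixture of spreading degree two, and, if so, it returns one with the minimal number of fingers. -/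

import Mathlib

noncomputable section

namespace Snapping

/-! ## Polyhedra

The boundary of the workpiece is given as a triangle mesh.  The facets of the workpiece are obtained
by merging neighbouring coplanar triangles, so a facet is any polygon, possibly with holes. -/

/-- Raw data of a triangle mesh in space: vertex positions, and the vertices of every triangle in
cyclic order. -/
structure Mesh where
  numV : ℕ
  numT : ℕ
  pos : Fin numV → Fin 3 → ℝ
  tri : Fin numT → Fin 3 → Fin numV

namespace Mesh

/-- The tail of the `i`-th directed edge of the triangle `t`. -/
def src (M : Mesh) (t : Fin M.numT) (i : Fin 3) : Fin M.numV := M.tri t i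

/-- The head of the `i`-th directed edge of the triangle `t` (`i + 1` is taken modulo 3). -/
def dst (M : Mesh) (t : Fin M.numT) (i : Fin 3) : Fin M.numV := M.tri t (i + 1)

/-- The vertex set of a triangle. -/
def verts (M : Mesh) (t : Fin M.numT) : Set (Fin M.numV) := Set.range (M.tri t)

/-- The closed solid triangle in space. -/
def solid (M : Mesh) (t : Fin M.numT) : Set (Fin 3 → ℝ) := convexHull ℝ (M.pos '' M.verts t)

/-- The (unnormalized) normal of a triangle given by its cyclic order. -/
def normal (M : Mesh) (t : Fin M.numT) : Fin 3 → ℝ :=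
  crossProduct (M.pos (M.tri t 1) - M.pos (M.tri t 0)) (M.pos (M.tri t 2) - M.pos (M.tri t 0))

/-- Two triangles share an edge, which they traverse in opposite directions. -/
def Adj (M : Mesh) (t t' : Fin M.numT) : Prop :=
  ∃ i j, M.src t i = M.dst t' j ∧ M.dst t i = M.src t' j

/-- Two triangles share an edge incident to the vertex `v`. -/
def AdjAt (M : Mesh) (v : Fin M.numV) (t t' : Fin M.numT) : Prop :=
  ∃ i j, M.src t i = M.dst t' j ∧ M.dst t i = M.src t' j ∧ (M.src t i = v ∨ M.dst t i = v)

/-- The undirected edges. -/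
def edges (M : Mesh) : Finset (Sym2 (Fin M.numV)) :=
  Finset.univ.image fun h : Fin M.numT × Fin 3 => s(M.src h.1 h.2, M.dst h.1 h.2)

/-- The Euler characteristic of the surface. -/
def eulerChar (M : Mesh) : ℤ := (M.numV : ℤ) - (M.edges.card : ℤ) + (M.numT : ℤ)

/-- The genus of a connected closed orientable surface, from `χ = 2 - 2 g`. -/
def genus (M : Mesh) : ℤ := (2 - M.eulerChar) / 2

/-- Six times the signed volume enclosed by an oriented closed mesh. -/
def signedVolume (M : Mesh) : ℝ :=
  ∑ t, M.pos (M.tri t 0) ⬝ᵥ crossProduct (M.pos (M.tri t 1)) (M.pos (M.tri t 2))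

end Mesh

/-- A (closed, bounded) polyhedron in space: its boundary is an embedded, connected, closed
triangulated surface, oriented so that the normals of the triangles are outer normals. -/
structure Polyhedron extends Mesh where
  /-- Distinct vertices are distinct points. -/
  pos_injective : Function.Injective pos
  /-- Triangles are not degenerate. -/
  nondegenerate : ∀ t, AffineIndependent ℝ fun i => pos (tri t i)
  /-- Every vertex is a vertex of the surface. -/
  vertex_used : ∀ v, ∃ t, v ∈ toMesh.verts t
  /-- The surface is closed and coherently oriented: every directed edge has exactly one twin. -/
  twin : ∀ t i, ∃! h : Fin numT × Fin 3,
    toMesh.src h.1 h.2 = toMesh.dst t i ∧ toMesh.dst h.1 h.2 = toMesh.src t i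
  /-- The surface is a manifold at every vertex: the triangles around it form a single cycle. -/
  star_connected : ∀ v t t', v ∈ toMesh.verts t → v ∈ toMesh.verts t' →
    Relation.ReflTransGen (toMesh.AdjAt v) t t'
  /-- The surface is connected. -/
  connected : ∀ t t', Relation.ReflTransGen toMesh.Adj t t'
  /-- The surface is embedded: two triangles meet exactly in their common vertex, common edge, or
  not at all. -/
  embedded : ∀ t t', t ≠ t' → toMesh.solid t ∩ toMesh.solid t' ⊆
    convexHull ℝ (pos '' (toMesh.verts t ∩ toMesh.verts t'))
  /-- The orientation is the outer one. -/
  outward : 0 < toMesh.signedVolume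

/-- Triangles belong to the same facet when they are linked by a chain of triangles in which
consecutive ones share an edge and are coplanar (with the same outer normal direction). -/
def Polyhedron.facetSetoid (P : Polyhedron) : Setoid (Fin P.numT) :=
  Relation.EqvGen.setoid fun t t' => P.Adj t t' ∧ SameRay ℝ (P.normal t) (P.normal t')

/-- The facets of a polyhedron: maximal connected coplanar parts of its boundary. -/
def Polyhedron.Facet (P : Polyhedron) : Type := Quotient P.facetSetoid

/-- The facet that contains a given triangle. -/
def Polyhedron.facetOf (P : Polyhedron) (t : Fin P.numT) : P.Facet := Quotient.mk P.facetSetoid t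

/-- Neighbouring facets: two different facets with a common edge. -/
def Polyhedron.Neighbor (P : Polyhedron) (f f' : P.Facet) : Prop :=
  f ≠ f' ∧ ∃ t t', P.facetOf t = f ∧ P.facetOf t' = f' ∧ P.Adj t t'

/-! ## Snapping fixtures -/

/-- The unit sphere of directions. -/
def unitSphere : Set (Fin 3 → ℝ) := {v | v ⬝ᵥ v = 1}

/-- The open unit hemisphere `h(f)` of the directions that are blocked at the facet `f`: those that
form an acute angle with the outer normal of `f`. -/
def Polyhedron.hemisphere (P : Polyhedron) (f : P.Facet) : Set (Fin 3 → ℝ) :=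
  {v | v ∈ unitSphere ∧ ∃ t, P.facetOf t = f ∧ 0 < v ⬝ᵥ P.normal t}

/-- A fixture of spreading degree two: a palm and a finite set of fingers, each finger being a pair
(base facet of the body, base facet of the fingertip). The parts of a fixture do not overlap, so
different fingers have different bodies. -/
structure Fixture (P : Polyhedron) where
  palm : P.Facet
  fingers : Finset (P.Facet × P.Facet)
  body_neighbor : ∀ F ∈ fingers, P.Neighbor palm F.1
  tip_neighbor : ∀ F ∈ fingers, P.Neighbor F.1 F.2
  tip_ne_palm : ∀ F ∈ fingers, F.2 ≠ palm
  bodies_distinct : ∀ F ∈ fingers, ∀ F' ∈ fingers, F.1 = F'.1 → F = F'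

namespace Fixture

/-- The base facets of the palm and of the bodies. -/
def palmBodies {P : Polyhedron} (G : Fixture P) : Set P.Facet :=
  {f | f = G.palm ∨ ∃ F ∈ G.fingers, f = F.1}

/-- The base facets of the palm, of the bodies and of the fingertips. -/
def allFacets {P : Polyhedron} (G : Fixture P) : Set P.Facet :=
  {f | f ∈ G.palmBodies ∨ ∃ F ∈ G.fingers, f = F.2}

/-- A snapping fixture is valid if all base facets together block every direction of translation,
whereas those of the palm and the bodies alone do not. -/
def Valid {P : Polyhedron} (G : Fixture P) : Prop :=
  unitSphere = (⋃ f ∈ G.allFacets, P.hemisphere f) ∧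
  unitSphere ≠ (⋃ f ∈ G.palmBodies, P.hemisphere f)

end Fixture

/-! ## Real RAM programs with unit cost

Structured programs over finitely many named arrays of natural numbers and of real numbers. -/

/-- Memory: the entry `j` of the array with name `A`. -/
structure Mem where
  nat : ℕ → ℕ → ℕ
  real : ℕ → ℕ → ℝ

/-- Expressions with values in the natural numbers (`sub` is truncated). -/
inductive NExp where
  | lit (k : ℕ)
  | get (A : ℕ) (i : NExp)
  | add (a b : NExp)
  | sub (a b : NExp)
  | mul (a b : NExp)

/-- Expressions with real values. -/
inductive RExp where
  | lit (k : ℤ)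
  | get (A : ℕ) (i : NExp)
  | add (a b : RExp)
  | sub (a b : RExp)
  | mul (a b : RExp)
  | div (a b : RExp)

/-- Tests. -/
inductive BExp where
  | nlt (a b : NExp)
  | neq (a b : NExp)
  | rlt (a b : RExp)
  | req (a b : RExp)
  | not (b : BExp)
  | and (b c : BExp)

/-- Programs: assignments to array entries, sequencing, branching, loops. -/
inductive Cmd where
  | skip
  | nset (A : ℕ) (i e : NExp)
  | rset (A : ℕ) (i : NExp) (e : RExp)
  | seq (c d : Cmd)
  | ite (b : BExp) (c d : Cmd)
  | while (b : BExp) (c : Cmd)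

/-- Value of a natural number expression. -/
def NExp.eval (s : Mem) : NExp → ℕ
  | .lit k => k
  | .get A i => s.nat A (i.eval s)
  | .add a b => a.eval s + b.eval s
  | .sub a b => a.eval s - b.eval s
  | .mul a b => a.eval s * b.eval s

/-- Number of elementary operations for evaluating an expression. -/
def NExp.cost : NExp → ℕ
  | .lit _ => 1
  | .get _ i => i.cost + 1
  | .add a b => a.cost + b.cost + 1
  | .sub a b => a.cost + b.cost + 1
  | .mul a b => a.cost + b.cost + 1

/-- Value of a real expression. -/
def RExp.eval (s : Mem) : RExp → ℝ
  | .lit k => (k : ℝ)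
  | .get A i => s.real A (i.eval s)
  | .add a b => a.eval s + b.eval s
  | .sub a b => a.eval s - b.eval s
  | .mul a b => a.eval s * b.eval s
  | .div a b => a.eval s / b.eval s

/-- Number of elementary operations for evaluating an expression. -/
def RExp.cost : RExp → ℕ
  | .lit _ => 1
  | .get _ i => i.cost + 1
  | .add a b => a.cost + b.cost + 1
  | .sub a b => a.cost + b.cost + 1
  | .mul a b => a.cost + b.cost + 1
  | .div a b => a.cost + b.cost + 1

/-- Truth of a test. -/
def BExp.Holds (s : Mem) : BExp → Prop
  | .nlt a b => a.eval s < b.eval s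
  | .neq a b => a.eval s = b.eval s
  | .rlt a b => a.eval s < b.eval s
  | .req a b => a.eval s = b.eval s
  | .not b => ¬ b.Holds s
  | .and b c => b.Holds s ∧ c.Holds s

/-- Number of elementary operations for evaluating a test. -/
def BExp.cost : BExp → ℕ
  | .nlt a b => a.cost + b.cost + 1
  | .neq a b => a.cost + b.cost + 1
  | .rlt a b => a.cost + b.cost + 1
  | .req a b => a.cost + b.cost + 1
  | .not b => b.cost + 1
  | .and b c => b.cost + c.cost + 1

/-- Assignment to one entry of an array of natural numbers. -/
def Mem.setNat (s : Mem) (A j x : ℕ) : Mem :=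
  { s with nat := Function.update s.nat A (Function.update (s.nat A) j x) }

/-- Assignment to one entry of an array of real numbers. -/
def Mem.setReal (s : Mem) (A j : ℕ) (x : ℝ) : Mem :=
  { s with real := Function.update s.real A (Function.update (s.real A) j x) }

/-- `Exec c s s' T`: the program `c`, started in the memory `s`, halts in the memory `s'` after
exactly `T` elementary steps. -/
inductive Exec : Cmd → Mem → Mem → ℕ → Prop where
  | skip (s : Mem) : Exec .skip s s 1
  | nset (s : Mem) (A : ℕ) (i e : NExp) :
      Exec (.nset A i e) s (s.setNat A (i.eval s) (e.eval s)) (i.cost + e.cost + 1)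
  | rset (s : Mem) (A : ℕ) (i : NExp) (e : RExp) :
      Exec (.rset A i e) s (s.setReal A (i.eval s) (e.eval s)) (i.cost + e.cost + 1)
  | seq {c d : Cmd} {s s' s'' : Mem} {T T' : ℕ} :
      Exec c s s' T → Exec d s' s'' T' → Exec (.seq c d) s s'' (T + T')
  | ite_true {b : BExp} {c d : Cmd} {s s' : Mem} {T : ℕ} :
      b.Holds s → Exec c s s' T → Exec (.ite b c d) s s' (b.cost + T + 1)
  | ite_false {b : BExp} {c d : Cmd} {s s' : Mem} {T : ℕ} :
      ¬ b.Holds s → Exec d s s' T → Exec (.ite b c d) s s' (b.cost + T + 1)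
  | while_false {b : BExp} {c : Cmd} {s : Mem} :
      ¬ b.Holds s → Exec (.while b c) s s (b.cost + 1)
  | while_true {b : BExp} {c : Cmd} {s s' s'' : Mem} {T T' : ℕ} :
      b.Holds s → Exec c s s' T → Exec (.while b c) s' s'' T' →
      Exec (.while b c) s s'' (b.cost + T + T' + 1)

/-! ## Input and output -/

/-- The `i`-th vertex of the triangle number `t` (zero beyond the last triangle). -/
def Polyhedron.cornerEntry (P : Polyhedron) (i : Fin 3) (t : ℕ) : ℕ :=
  if h : t < P.numT then (P.tri ⟨t, h⟩ i : ℕ) else 0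

/-- The `i`-th coordinate of the vertex number `v` (zero beyond the last vertex). -/
def Polyhedron.coordEntry (P : Polyhedron) (i : Fin 3) (v : ℕ) : ℝ :=
  if h : v < P.numV then P.pos ⟨v, h⟩ i else 0

/-- The initial memory: array `0` of natural numbers holds the numbers of vertices and triangles,
arrays `1, 2, 3` hold the vertices of the triangles, and the real arrays `0, 1, 2` hold the
coordinates of the vertices. Everything else is zero. -/
def Polyhedron.input (P : Polyhedron) : Mem where
  nat := fun A j => match A, j with
    | 0, 0 => P.numV
    | 0, 1 => P.numT
    | 1, t => P.cornerEntry 0 t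
    | 2, t => P.cornerEntry 1 t
    | 3, t => P.cornerEntry 2 t
    | _, _ => 0
  real := fun A v => match A with
    | 0 => P.coordEntry 0 v
    | 1 => P.coordEntry 1 v
    | 2 => P.coordEntry 2 v
    | _ => 0

/-- The number `x` designates the facet `f`: it is the number of one of the triangles of `f`. -/
def Polyhedron.Names (P : Polyhedron) (x : ℕ) (f : P.Facet) : Prop :=
  ∃ h : x < P.numT, P.facetOf ⟨x, h⟩ = f

/-- The number of fingers reported in the final memory; zero stands for the answer "null". -/
def Mem.outCount (s : Mem) : ℕ := s.nat 4 0

/-- The final memory `s` lists the fixture `G`: the palm, and the bodies and the fingertips of the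
fingers, each finger once. -/
def Fixture.ListedIn {P : Polyhedron} (G : Fixture P) (s : Mem) : Prop :=
  s.outCount = G.fingers.card ∧ P.Names (s.nat 4 1) G.palm ∧
  ∀ F : P.Facet × P.Facet, F ∈ G.fingers ↔
    ∃ i < s.outCount, P.Names (s.nat 5 i) F.1 ∧ P.Names (s.nat 6 i) F.2

/-- The final memory answers the problem for `P`: either it says "null" and `P` has no valid fixture,
or it lists a valid fixture with the minimal number of fingers. -/
def Polyhedron.Answered (P : Polyhedron) (s : Mem) : Prop :=
  (s.outCount = 0 ∧ ∀ G : Fixture P, ¬ G.Valid) ∨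
  (0 < s.outCount ∧ ∃ G : Fixture P, G.Valid ∧ G.ListedIn s ∧
    ∀ G' : Fixture P, G'.Valid → G.fingers.card ≤ G'.fingers.card)

end Snapping

end

/-! A family of facets covers the sphere exactly when no nonzero `w` has nonpositive product with
all its normals. Validity is thus a statement about polar cones in space. For boundedly many facets
it is decidable in constant time, because a nontrivial polar cone of vectors that are not all
parallel contains a cross product of two of them (`exists_cross_of_polar`, `holds_coverExp`).

In a minimal valid fixture no finger can be dropped: without it the palm and the remaining bodies
still leave a direction free, so it is the covering that must fail. Every finger `i` therefore has a
direction `v i` that it alone blocks (`Irredundant`). Moreover no body is parallel to the palm,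
since the surface is embedded (`cross_normal_ne_zero`). Linear relations between the `v i` can be
made nonnegative, and a nonnegative relation forces orthogonality. It follows that two of any four
`v i` are opposite (`exists_opposite`). Hence five fingers are never needed (`no_five`), and with
four fingers two of them and the palm positively span a plane while the other two lie on its two
sides (`exists_structure`).

The algorithm tries `K = 1, 2, 3, 4` fingers, so the first fixture found is minimal. Fingers are
numbered by the directed edges, of which there are `3 * numT`; for bounded genus this is linear in
the number of vertices by Euler's formula. For `K ≤ 2` the palm and the fingers are enumerated. For
`K = 3` that would cost a fourth power. But three distinct facets have at most `4 * g + 8` common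
neighbours (`card_common_neighbors_le`): the incidences form a complete bipartite graph on the
surface whose faces have at least four edges, and a homological form of Euler's formula bounds it.
So the three fingers are enumerated, and the palm is taken from a precomputed list of common
neighbours of the bodies. The tables for these lists have an index range beyond `n ^ 3`, but memory
is initially zero and only cubically many entries are touched. For `K = 4` the palm and the two
fingers spanning the plane are enumerated. Each of the other two can be replaced by one of seven
fingers per side, found by linear scans that depend only on the palm and one of the spanning fingers
(`Sided.exists_of_scans`): four with extremal slope, and three with bodies parallel to the axis of
the plane.

For the running time, programs are built from counting loops, long ones (at most `3 * numT` rounds)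
and short ones (at most `4 * g + 8` rounds). Long loops are nested at most three deep, which gives
the cubic bound (`Prog.cost_le`). -/

namespace Snapping

/-! ## Programs with bounded loops -/

/-- Programs whose loops are counting loops. A loop is marked as long or short; the two kinds
of loops have different bounds on their length. -/
inductive Prog where
  | skip
  | nset (A : ℕ) (i e : NExp)
  | seq (p q : Prog)
  | ite (b : BExp) (p q : Prog)
  | loop (long : Bool) (i : ℕ) (e : NExp) (p : Prog)

/-- The scalar variable stored at the beginning of the array `A`. -/
abbrev var (A : ℕ) : NExp := .get A (.lit 0)

namespace Prog

def toCmd : Prog → Cmd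
  | skip => .skip
  | nset A i e => .nset A i e
  | seq p q => .seq p.toCmd q.toCmd
  | ite b p q => .ite b p.toCmd q.toCmd
  | loop _ i e p => .seq (.nset i (.lit 0) (.lit 0)) (.while (.nlt (var i) e)
      (.seq p.toCmd (.nset i (.lit 0) (.add (var i) (.lit 1)))))

/-- The length of a long loop is at most `N`, that of a short loop at most `C`. -/
def bound (N C : ℕ) (long : Bool) : ℕ := if long then N else C

/-- A bound for the running time. -/
def cost (N C : ℕ) : Prog → ℕ
  | skip => 1
  | nset _ i e => i.cost + e.cost + 1
  | seq p q => p.cost N C + q.cost N C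
  | ite b p q => b.cost + (p.cost N C + q.cost N C) + 1
  -- Initialising the counter costs 3. A round costs its body, `e.cost + 3` for the test, 6 for the
  -- increment and 1 for the `while` rule; the failing last test costs `e.cost + 4`.
  | loop l _ e p => 3 + bound N C l * (e.cost + p.cost N C + 10) + (e.cost + 4)

/-- The nesting depth of the long loops. -/
def depth : Prog → ℕ
  | skip => 0
  | nset _ _ _ => 0
  | seq p q => max p.depth q.depth
  | ite _ p q => max p.depth q.depth
  | loop l _ _ p => (if l then 1 else 0) + p.depth

/-- A long loop contributes one factor `N`, a short one only a constant, and `1 ≤ N` lets additive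
constants be absorbed into the leading power. The factor `p.cost 1 C` depends on the program and on
`C` alone, which is what makes the final constant depend on the genus only. -/
theorem cost_le (N C : ℕ) (hN : 1 ≤ N) (p : Prog) : p.cost N C ≤ p.cost 1 C * N ^ p.depth := by
  have hp : ∀ d, 1 ≤ N ^ d := fun d => Nat.one_le_pow _ _ hN
  induction p with
  | skip => simp [cost, depth]
  | nset A i e => simp [cost, depth]
  | seq p q hp' hq =>
    simp only [cost, depth, add_mul]
    exact add_le_add (hp'.trans (Nat.mul_le_mul_left _ (Nat.pow_le_pow_right hN (le_max_left _ _))))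
      (hq.trans (Nat.mul_le_mul_left _ (Nat.pow_le_pow_right hN (le_max_right _ _))))
  | ite b p q hp' hq =>
    simp only [cost, depth, add_mul]
    have h1 := hp'.trans (Nat.mul_le_mul_left _ (Nat.pow_le_pow_right hN (le_max_left p.depth q.depth)))
    have h2 := hq.trans (Nat.mul_le_mul_left _ (Nat.pow_le_pow_right hN (le_max_right p.depth q.depth)))
    have h3 := hp (max p.depth q.depth)
    have h4 := Nat.mul_le_mul_left b.cost h3
    omega
  | loop l i e p ih =>
    have hd := hp p.depth
    cases l
    · simp only [cost, depth, bound, Bool.false_eq_true, if_false, zero_add]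
      have h1 : C * (e.cost + p.cost N C + 10) ≤ C * (e.cost + p.cost 1 C + 10) * N ^ p.depth := by
        rw [mul_assoc]
        apply Nat.mul_le_mul_left
        nlinarith
      nlinarith
    · simp only [cost, depth, bound, if_true, pow_add, pow_one, one_mul]
      have h1 : N * (e.cost + p.cost N C + 10) ≤
          (e.cost + p.cost 1 C + 10) * (N * N ^ p.depth) := by
        calc N * (e.cost + p.cost N C + 10) ≤ N * ((e.cost + p.cost 1 C + 10) * N ^ p.depth) := by
              apply Nat.mul_le_mul_left
              nlinarith
          _ = _ := by ring
      have h2 : 1 ≤ N * N ^ p.depth := Nat.one_le_iff_ne_zero.2 (by positivity)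
      nlinarith

/-- The program may write to the array `A`. -/
def writes : Prog → ℕ → Bool
  | skip, _ => false
  | nset B _ _, A => A == B
  | seq p q, A => p.writes A || q.writes A
  | ite _ p q, A => p.writes A || q.writes A
  | loop _ i _ p, A => A == i || p.writes A

/-- `s'` arises from `s` by changing only arrays to which `p` writes. -/
structure Frame (p : Prog) (s s' : Mem) : Prop where
  nat : ∀ A, p.writes A = false → s'.nat A = s.nat A
  real : s'.real = s.real

theorem Frame.refl (p : Prog) (s : Mem) : p.Frame s s := ⟨fun _ _ => rfl, rfl⟩

theorem Frame.trans {p : Prog} {s s' s'' : Mem} (h : p.Frame s s') (h' : p.Frame s' s'') :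
    p.Frame s s'' :=
  ⟨fun A hA => (h'.nat A hA).trans (h.nat A hA), h'.real.trans h.real⟩

theorem Frame.mono {p q : Prog} {s s' : Mem} (h : p.Frame s s')
    (hpq : ∀ A, q.writes A = false → p.writes A = false) : q.Frame s s' :=
  ⟨fun A hA => h.nat A (hpq A hA), h.real⟩

end Prog

@[simp] theorem Mem.setNat_nat_same (s : Mem) (A j x : ℕ) :
    (s.setNat A j x).nat A = Function.update (s.nat A) j x := by simp [Mem.setNat]

theorem Mem.setNat_nat_of_ne (s : Mem) {A B : ℕ} (j x : ℕ) (h : B ≠ A) :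
    (s.setNat A j x).nat B = s.nat B := by simp [Mem.setNat, h]

namespace Prog

/-- The program `p` halts when started in `s`, within the time bound, in a memory with property `Q`,
having changed only arrays to which it writes. -/
def Runs (N C : ℕ) (p : Prog) (s : Mem) (Q : Mem → Prop) : Prop :=
  ∃ s' t, Exec p.toCmd s s' t ∧ t ≤ p.cost N C ∧ p.Frame s s' ∧ Q s'

variable {N C : ℕ} {s : Mem} {Q Q' : Mem → Prop}

theorem Runs.mono {p : Prog} (h : p.Runs N C s Q) (hQ : ∀ s', p.Frame s s' → Q s' → Q' s') :
    p.Runs N C s Q' := by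
  obtain ⟨s', t, h1, h2, h3, h4⟩ := h
  exact ⟨s', t, h1, h2, h3, hQ s' h3 h4⟩

theorem Runs.skip (h : Q s) : Prog.skip.Runs N C s Q :=
  ⟨s, 1, .skip s, le_rfl, .refl _ _, h⟩

theorem Runs.nset {A : ℕ} {i e : NExp} (h : Q (s.setNat A (i.eval s) (e.eval s))) :
    (Prog.nset A i e).Runs N C s Q :=
  ⟨_, _, .nset s A i e, le_rfl,
    ⟨fun B hB => s.setNat_nat_of_ne _ _ (by simpa [writes] using hB), rfl⟩, h⟩

theorem Runs.seq {p q : Prog} (h : p.Runs N C s fun s' => q.Runs N C s' Q) :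
    (Prog.seq p q).Runs N C s Q := by
  obtain ⟨s', t, h1, h2, h3, s'', t', h1', h2', h3', h4⟩ := h
  refine ⟨s'', t + t', .seq h1 h1', add_le_add h2 h2', ?_, h4⟩
  refine (h3.mono fun A hA => ?_).trans (h3'.mono fun A hA => ?_)
  all_goals simp only [writes, Bool.or_eq_false_iff] at hA; tauto

theorem Runs.ite {b : BExp} {p q : Prog} (h : b.Holds s → p.Runs N C s Q)
    (h' : ¬ b.Holds s → q.Runs N C s Q) : (Prog.ite b p q).Runs N C s Q := by
  have hf : ∀ A, (Prog.ite b p q).writes A = false → p.writes A = false ∧ q.writes A = false := by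
    intro A hA
    simpa [writes] using hA
  by_cases hb : b.Holds s
  · obtain ⟨s', t, h1, h2, h3, h4⟩ := h hb
    exact ⟨s', _, .ite_true hb h1, by simp only [cost]; omega, h3.mono fun A hA => (hf A hA).1, h4⟩
  · obtain ⟨s', t, h1, h2, h3, h4⟩ := h' hb
    exact ⟨s', _, .ite_false hb h1, by simp only [cost]; omega, h3.mono fun A hA => (hf A hA).2, h4⟩

/-- The loop bound is evaluated anew in every round; it is constant because `e` has the value `n` in
every memory that differs from `s` only in arrays the loop writes to. The counter belongs to the
loop, so the body must leave it alone and the invariant must survive its updates. -/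
theorem Runs.loop {l : Bool} {i : ℕ} {e : NExp} {p : Prog} {n : ℕ} (I : ℕ → Mem → Prop)
    (hn : n ≤ bound N C l) (hi : p.writes i = false)
    (he : ∀ s', (Prog.loop l i e p).Frame s s' → e.eval s' = n)
    (hI : ∀ k s' x, I k s' → I k (s'.setNat i 0 x))
    (h0 : I 0 s)
    (step : ∀ k < n, ∀ s', (Prog.loop l i e p).Frame s s' → s'.nat i 0 = k → I k s' →
      p.Runs N C s' (I (k + 1)))
    (hQ : ∀ s', (Prog.loop l i e p).Frame s s' → I n s' → Q s') :
    (Prog.loop l i e p).Runs N C s Q := by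
  have hset : ∀ s' x, (Prog.loop l i e p).Frame s' (s'.setNat i 0 x) := fun s' x =>
    ⟨fun B hB => s'.setNat_nat_of_ne _ _ (by
      simp only [writes, Bool.or_eq_false_iff, beq_eq_false_iff_ne] at hB; exact hB.1), rfl⟩
  have key : ∀ d k s', k + d = n → (Prog.loop l i e p).Frame s s' → s'.nat i 0 = k → I k s' →
      ∃ s'' t, Exec (.while (.nlt (var i) e)
        (.seq p.toCmd (.nset i (.lit 0) (.add (var i) (.lit 1))))) s' s'' t ∧
        t ≤ d * (e.cost + p.cost N C + 10) + (e.cost + 4) ∧ (Prog.loop l i e p).Frame s s'' ∧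
        I n s'' := by
    intro d
    induction d with
    | zero =>
      intro k s' hk hF hs hIk
      refine ⟨s', _, .while_false ?_, ?_, hF, ?_⟩
      · simp [BExp.Holds, NExp.eval, he s' hF, hs]; omega
      · simp [BExp.cost, NExp.cost]; omega
      · rwa [← (show k = n by omega)]
    | succ d ih =>
      intro k s' hk hF hs hIk
      obtain ⟨s1, t1, h1, h2, h3, h4⟩ := step k (by omega) s' hF hs hIk
      have hF1 : (Prog.loop l i e p).Frame s' s1 := h3.mono fun A hA => by
        simp only [writes, Bool.or_eq_false_iff] at hA; exact hA.2
      have hs1 : s1.nat i 0 = k := by rw [h3.nat i hi, hs]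
      obtain ⟨s2, t2, h5, h6, h7, h8⟩ := ih (k + 1) (s1.setNat i 0 (k + 1)) (by omega)
        ((hF.trans hF1).trans (hset _ _)) (by simp) (hI _ _ _ h4)
      refine ⟨s2, _, .while_true ?_ (.seq h1 (.nset s1 i _ _)) (by
        simpa [NExp.eval, hs1] using h5), ?_, h7, h8⟩
      · simp [BExp.Holds, NExp.eval, he s' hF, hs]; omega
      · simp only [BExp.cost, NExp.cost]; rw [Nat.succ_mul]; omega
  obtain ⟨s2, t2, h5, h6, h7, h8⟩ := key n 0 (s.setNat i 0 0) (by omega) (hset _ _) (by simp)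
    (hI _ _ _ h0)
  refine ⟨s2, _, .seq (.nset s i _ _) (by simpa [NExp.eval] using h5), ?_, h7, hQ _ h7 h8⟩
  simp only [cost, NExp.cost]
  have := Nat.mul_le_mul_right (e.cost + p.cost N C + 10) hn
  omega

/-- Sequence of a list of programs. -/
def seqs : List Prog → Prog
  | [] => skip
  | p :: L => seq p (seqs L)

theorem Runs.seqs_cons {p : Prog} {L : List Prog} (h : p.Runs N C s fun s' => (seqs L).Runs N C s' Q) :
    (seqs (p :: L)).Runs N C s Q := Runs.seq h

theorem Runs.seqs_nil (h : Q s) : (seqs []).Runs N C s Q := Runs.skip h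

end Prog

/-! ## Composite tests and vector expressions -/

namespace BExp

def tt : BExp := .nlt (.lit 0) (.lit 1)

def or (b c : BExp) : BExp := .not (.and (.not b) (.not c))

def all (L : List BExp) : BExp := L.foldr .and tt

def any (L : List BExp) : BExp := .not (all (L.map .not))

@[simp] theorem holds_nlt (s : Mem) (a b : NExp) : (nlt a b).Holds s ↔ a.eval s < b.eval s := Iff.rfl
@[simp] theorem holds_neq (s : Mem) (a b : NExp) : (neq a b).Holds s ↔ a.eval s = b.eval s := Iff.rfl
@[simp] theorem holds_rlt (s : Mem) (a b : RExp) : (rlt a b).Holds s ↔ a.eval s < b.eval s := Iff.rfl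
@[simp] theorem holds_req (s : Mem) (a b : RExp) : (req a b).Holds s ↔ a.eval s = b.eval s := Iff.rfl
@[simp] theorem holds_not (s : Mem) (b : BExp) : (not b).Holds s ↔ ¬ b.Holds s := Iff.rfl
@[simp] theorem holds_and (s : Mem) (b c : BExp) : (and b c).Holds s ↔ b.Holds s ∧ c.Holds s := Iff.rfl

@[simp] theorem holds_or (s : Mem) (b c : BExp) : (or b c).Holds s ↔ b.Holds s ∨ c.Holds s := by
  simp only [or, holds_not, holds_and]; tauto

@[simp] theorem holds_all (s : Mem) (L : List BExp) : (all L).Holds s ↔ ∀ b ∈ L, b.Holds s := by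
  induction L with
  | nil => simp [all, tt, NExp.eval]
  | cons b L ih => simpa [all] using fun _ => ih

@[simp] theorem holds_any (s : Mem) (L : List BExp) : (any L).Holds s ↔ ∃ b ∈ L, b.Holds s := by
  simp [any]

end BExp

/-- Expressions for vectors. -/
abbrev VExp := Fin 3 → RExp

namespace VExp

noncomputable def eval (s : Mem) (a : VExp) : Fin 3 → ℝ := fun i => (a i).eval s

def sub (a b : VExp) : VExp := fun i => .sub (a i) (b i)

def cross (a b : VExp) : VExp :=
  ![.sub (.mul (a 1) (b 2)) (.mul (a 2) (b 1)), .sub (.mul (a 2) (b 0)) (.mul (a 0) (b 2)),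
    .sub (.mul (a 0) (b 1)) (.mul (a 1) (b 0))]

def dot (a b : VExp) : RExp := .add (.add (.mul (a 0) (b 0)) (.mul (a 1) (b 1))) (.mul (a 2) (b 2))

def isZero (a : VExp) : BExp :=
  .and (.req (a 0) (.lit 0)) (.and (.req (a 1) (.lit 0)) (.req (a 2) (.lit 0)))

@[simp] theorem eval_sub (s : Mem) (a b : VExp) : (sub a b).eval s = a.eval s - b.eval s := by
  ext i; simp [eval, sub, RExp.eval]

@[simp] theorem eval_cross (s : Mem) (a b : VExp) :
    (cross a b).eval s = crossProduct (a.eval s) (b.eval s) := by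
  ext i; fin_cases i <;> simp [eval, cross, RExp.eval, cross_apply]

@[simp] theorem eval_dot (s : Mem) (a b : VExp) :
    (dot a b).eval s = (a.eval s) ⬝ᵥ (b.eval s) := by
  simp [eval, dot, RExp.eval, dotProduct, Fin.sum_univ_three]

@[simp] theorem holds_isZero (s : Mem) (a : VExp) : (isZero a).Holds s ↔ a.eval s = 0 := by
  simp only [isZero, BExp.holds_and, BExp.holds_req, RExp.eval, funext_iff, Fin.forall_fin_succ,
    eval, Int.cast_zero, Pi.zero_apply]
  simp

end VExp

end Snapping

/-! ### Cross products and extreme rays of polar cones in space. -/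

namespace Snapping

open Matrix

/-! ## Vectors in space -/

section Vectors

variable {a b w x y p : Fin 3 → ℝ}

theorem dot_pos_of_ne_zero (h : x ≠ 0) : 0 < x ⬝ᵥ x := by
  have := dotProduct_self_eq_zero (v := x)
  exact lt_of_le_of_ne (by simpa [dotProduct] using Finset.sum_nonneg fun i _ => mul_self_nonneg (x i))
    fun h' => h (this.1 h'.symm)

theorem exists_smul_of_cross_eq_zero (hx : x ≠ 0) (h : x ⨯₃ y = 0) : ∃ c : ℝ, y = c • x := by
  have h0 := (dot_pos_of_ne_zero hx).ne'
  refine ⟨(x ⬝ᵥ y) / (x ⬝ᵥ x), ?_⟩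
  simp only [cross_apply, funext_iff, Fin.forall_fin_succ, Pi.zero_apply] at h
  simp [sub_eq_zero] at h
  simp only [dotProduct, Fin.sum_univ_three] at h0 ⊢
  ext i
  simp only [Pi.smul_apply, smul_eq_mul]
  rw [div_mul_eq_mul_div, eq_div_iff h0]
  obtain ⟨h1, h2, h3⟩ := h
  fin_cases i <;> simp
  · linear_combination (x 2) * h2 - (x 1) * h3
  · linear_combination (x 0) * h3 - (x 2) * h1
  · linear_combination (x 1) * h1 - (x 0) * h2

/-- By the triple product expansion `(a × b) × w = (w · a) b - (w · b) a = 0`. -/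
theorem exists_smul_cross (hab : a ⨯₃ b ≠ 0) (ha : w ⬝ᵥ a = 0) (hb : w ⬝ᵥ b = 0) :
    ∃ c : ℝ, w = c • (a ⨯₃ b) := by
  refine exists_smul_of_cross_eq_zero hab ?_
  simp only [dotProduct, Fin.sum_univ_three] at ha hb
  ext i
  fin_cases i <;> simp [cross_apply]
  · linear_combination b 0 * ha - a 0 * hb
  · linear_combination b 1 * ha - a 1 * hb
  · linear_combination b 2 * ha - a 2 * hb

theorem cross_dot_self (a b : Fin 3 → ℝ) :
    (a ⨯₃ b) ⬝ᵥ (a ⨯₃ b) = (a ⬝ᵥ a) * (b ⬝ᵥ b) - (a ⬝ᵥ b) * (a ⬝ᵥ b) := by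
  rw [cross_dot_cross, dotProduct_comm b a]

theorem cross_ne_zero_of_dot (ha : a ≠ 0) (hb : b ≠ 0) (h : a ⬝ᵥ b = 0) : a ⨯₃ b ≠ 0 := by
  intro h0
  have := cross_dot_self a b
  rw [h0, h] at this
  simp at this
  tauto

theorem cross_ne_zero_symm (h : a ⨯₃ b ≠ 0) : b ⨯₃ a ≠ 0 := by
  rw [← cross_anticomm]; exact neg_ne_zero.2 h

theorem cross_ne_zero_of_dot_pos (ha : a ≠ 0) (h : a ⬝ᵥ x = 0) (hb : b ⬝ᵥ x ≠ 0) : a ⨯₃ b ≠ 0 := by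
  intro h0
  obtain ⟨c, rfl⟩ := exists_smul_of_cross_eq_zero ha h0
  simp [h] at hb

/-- The common orthogonal complement of two independent vectors is a line, so `a` and `b` would be
parallel. Most contradictions below end here, with the normals of the palm and of a body as `a`, `b`
or as `x`, `y`. -/
theorem not_both_orthogonal (hab : a ⨯₃ b ≠ 0) (hxy : x ⨯₃ y ≠ 0) (h1 : a ⬝ᵥ x = 0) (h2 : a ⬝ᵥ y = 0)
    (h3 : b ⬝ᵥ x = 0) (h4 : b ⬝ᵥ y = 0) : False := by
  obtain ⟨c, rfl⟩ := exists_smul_cross hxy h1 h2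
  obtain ⟨d, rfl⟩ := exists_smul_cross hxy h3 h4
  simp at hab

/-- Moving a vector in the polar cone of a finite family in a direction that violates a constraint,
until the first constraint becomes tight. -/
theorem exists_first_tight {ι : Type*} [Finite ι] (x : ι → Fin 3 → ℝ) {w q : Fin 3 → ℝ}
    (hw : ∀ i, w ⬝ᵥ x i ≤ 0) (hq : ∃ i, 0 < q ⬝ᵥ x i) :
    ∃ t : ℝ, 0 ≤ t ∧ (∀ i, (w + t • q) ⬝ᵥ x i ≤ 0) ∧ ∃ i, 0 < q ⬝ᵥ x i ∧ (w + t • q) ⬝ᵥ x i = 0 := by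
  classical
  have := Fintype.ofFinite ι
  obtain ⟨i0, hi0⟩ := hq
  obtain ⟨i, hi, hmin⟩ := Finset.exists_min_image (Finset.univ.filter fun i => 0 < q ⬝ᵥ x i)
    (fun i => -(w ⬝ᵥ x i) / (q ⬝ᵥ x i)) ⟨i0, by simpa using hi0⟩
  have hi' : 0 < q ⬝ᵥ x i := by simpa using hi
  have ht : 0 ≤ -(w ⬝ᵥ x i) / (q ⬝ᵥ x i) := div_nonneg (by linarith [hw i]) hi'.le
  refine ⟨_, ht, fun j => ?_, i, hi', ?_⟩
  · rw [add_dotProduct, smul_dotProduct, smul_eq_mul]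
    by_cases hj : 0 < q ⬝ᵥ x j
    · have := hmin j (by simpa using hj)
      rw [le_div_iff₀ hj] at this
      linarith
    · nlinarith [hw j]
  · rw [add_dotProduct, smul_dotProduct, smul_eq_mul, div_mul_cancel₀ _ hi'.ne']
    ring

/-- If a finite family of vectors that are not all parallel has a nonzero vector in its polar cone,
then there is one that is the cross product of two members of the family. -/
theorem exists_cross_of_polar {ι : Type*} [Finite ι] (x : ι → Fin 3 → ℝ)
    (h0 : ∃ i j, x i ⨯₃ x j ≠ 0) (hx : ∀ i, x i ≠ 0) {w : Fin 3 → ℝ} (hw0 : w ≠ 0)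
    (hw : ∀ i, w ⬝ᵥ x i ≤ 0) :
    ∃ i j, x i ⨯₃ x j ≠ 0 ∧ ∀ k, (x i ⨯₃ x j) ⬝ᵥ x k ≤ 0 := by
  -- Once `w` is tight at two nonparallel members it is a multiple of their cross product; the sign
  -- of the multiple decides the order of the factors.
  have fin : ∀ w : Fin 3 → ℝ, w ≠ 0 → (∀ i, w ⬝ᵥ x i ≤ 0) → ∀ i j, x i ⨯₃ x j ≠ 0 →
      w ⬝ᵥ x i = 0 → w ⬝ᵥ x j = 0 → ∃ i j, x i ⨯₃ x j ≠ 0 ∧ ∀ k, (x i ⨯₃ x j) ⬝ᵥ x k ≤ 0 := by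
    intro w hw0 hw i j hij hi hj
    obtain ⟨c, rfl⟩ := exists_smul_cross hij hi hj
    have hc : c ≠ 0 := by rintro rfl; simp at hw0
    rcases hc.lt_or_gt with hc | hc
    · refine ⟨j, i, cross_ne_zero_symm hij, fun k => ?_⟩
      have := hw k
      rw [← cross_anticomm, neg_dotProduct]
      rw [smul_dotProduct, smul_eq_mul] at this
      nlinarith
    · refine ⟨i, j, hij, fun k => ?_⟩
      have := hw k
      rw [smul_dotProduct, smul_eq_mul] at this
      by_contra hk
      nlinarith
  have npar : ∀ y : Fin 3 → ℝ, y ≠ 0 → ∃ k, y ⨯₃ x k ≠ 0 := by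
    intro y hy
    by_contra! h
    obtain ⟨i, j, hij⟩ := h0
    obtain ⟨c, hc⟩ := exists_smul_of_cross_eq_zero hy (h i)
    obtain ⟨d, hd⟩ := exists_smul_of_cross_eq_zero hy (h j)
    rw [hc, hd] at hij
    simp at hij
  -- With one tight constraint `x i`, move `w` along a direction orthogonal to both `w` and `x i`:
  -- the constraint stays tight, the vector stays nonzero, and a second, nonparallel constraint
  -- becomes tight. If no member obstructs either sense of that direction, the direction itself is
  -- orthogonal to all members and serves instead.
  have one : ∀ w : Fin 3 → ℝ, w ≠ 0 → (∀ i, w ⬝ᵥ x i ≤ 0) → ∀ i, w ⬝ᵥ x i = 0 →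
      ∃ i j, x i ⨯₃ x j ≠ 0 ∧ ∀ k, (x i ⨯₃ x j) ⬝ᵥ x k ≤ 0 := by
    intro w hw0 hw i hi
    have hq0 : w ⨯₃ x i ≠ 0 := cross_ne_zero_of_dot hw0 (hx i) hi
    have hqi : (w ⨯₃ x i) ⬝ᵥ x i = 0 := by rw [dotProduct_comm, dot_cross_self]
    have hqw : (w ⨯₃ x i) ⬝ᵥ w = 0 := by rw [dotProduct_comm, dot_self_cross]
    by_cases hall : ∀ k, (w ⨯₃ x i) ⬝ᵥ x k = 0
    · obtain ⟨k, hk⟩ := npar (x i) (hx i)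
      exact fin _ hq0 (fun k => (hall k).le) i k hk (hall i) (hall k)
    · push Not at hall
      obtain ⟨k, hk⟩ := hall
      obtain ⟨q, hqi', hqw', hqk⟩ : ∃ q : Fin 3 → ℝ, q ⬝ᵥ x i = 0 ∧ q ⬝ᵥ w = 0 ∧ 0 < q ⬝ᵥ x k := by
        rcases hk.lt_or_gt with hk | hk
        · exact ⟨-(w ⨯₃ x i), by rw [neg_dotProduct, hqi, neg_zero],
            by rw [neg_dotProduct, hqw, neg_zero], by rw [neg_dotProduct]; linarith⟩
        · exact ⟨_, hqi, hqw, hk⟩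
      obtain ⟨t, -, ht, j, hj, hj0⟩ := exists_first_tight x hw ⟨k, hqk⟩
      refine fin _ ?_ ht i j ?_ ?_ hj0
      · intro h
        have h2 : (w + t • q) ⬝ᵥ w = 0 := by rw [h]; simp
        rw [add_dotProduct, smul_dotProduct, hqw'] at h2
        have := dot_pos_of_ne_zero hw0
        simp at h2
        exact hw0 h2
      · intro h
        obtain ⟨c, hc⟩ := exists_smul_of_cross_eq_zero (hx i) h
        rw [hc, dotProduct_smul, hqi'] at hj
        simp at hj
      · rw [add_dotProduct, smul_dotProduct, hqi', hi]; simp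
  -- To get the first tight constraint, move along the part of `x k` orthogonal to `w`, scaled by `w
  -- · w`. Its product with `x k` is the squared length of `w × x k`, hence positive.
  obtain ⟨k, hk⟩ := npar w hw0
  have hqw : ((w ⬝ᵥ w) • x k - (x k ⬝ᵥ w) • w) ⬝ᵥ w = 0 := by
    simp only [sub_dotProduct, smul_dotProduct, smul_eq_mul]; ring
  have hqk : 0 < ((w ⬝ᵥ w) • x k - (x k ⬝ᵥ w) • w) ⬝ᵥ x k := by
    have h1 := cross_dot_self w (x k)
    have h2 := dot_pos_of_ne_zero hk
    simp only [sub_dotProduct, smul_dotProduct, smul_eq_mul]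
    rw [dotProduct_comm (x k) w]
    linarith
  obtain ⟨t, -, ht, j, hj, hj0⟩ := exists_first_tight x hw ⟨k, hqk⟩
  refine one _ ?_ ht j hj0
  intro h
  have h2 : (w + t • ((w ⬝ᵥ w) • x k - (x k ⬝ᵥ w) • w)) ⬝ᵥ w = 0 := by rw [h]; simp
  rw [add_dotProduct, smul_dotProduct, hqw] at h2
  simp at h2
  exact hw0 h2

theorem not_linearIndependent_of_orthogonal {v : Fin 3 → Fin 3 → ℝ} (hp : p ≠ 0)
    (h : ∀ i, v i ⬝ᵥ p = 0) : ¬ LinearIndependent ℝ v := by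
  intro hv
  have hs := hv.span_eq_top_of_card_eq_finrank (by simp)
  have : ∀ z ∈ Submodule.span ℝ (Set.range v), z ⬝ᵥ p = 0 := by
    intro z hz
    induction hz using Submodule.span_induction with
    | mem x hx => obtain ⟨i, rfl⟩ := hx; exact h i
    | zero => simp
    | add x y _ _ hx hy => rw [add_dotProduct, hx, hy, add_zero]
    | smul c x _ hx => rw [smul_dotProduct, hx, smul_zero]
  have hpp := this p (by rw [hs]; trivial)
  exact hp (dotProduct_self_eq_zero.1 hpp)

/-- If a vector in the polar cone of `p, b₁, …, b₄` is not tight at `p`, `b₃`, `b₄`, it can be moved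
until it is. -/
theorem exists_polar_tight {b₁ b₂ b₃ b₄ : Fin 3 → ℝ} (hpb : p ⨯₃ b₁ ≠ 0) (hw0 : w ≠ 0)
    (hp : w ⬝ᵥ p ≤ 0) (h1 : w ⬝ᵥ b₁ ≤ 0) (h2 : w ⬝ᵥ b₂ ≤ 0) (h3 : w ⬝ᵥ b₃ ≤ 0) (h4 : w ⬝ᵥ b₄ ≤ 0) :
    ∃ w' : Fin 3 → ℝ, w' ≠ 0 ∧ w' ⬝ᵥ p ≤ 0 ∧ w' ⬝ᵥ b₁ ≤ 0 ∧ w' ⬝ᵥ b₂ ≤ 0 ∧ w' ⬝ᵥ b₃ ≤ 0 ∧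
      w' ⬝ᵥ b₄ ≤ 0 ∧ (w' ⬝ᵥ p = 0 ∨ w' ⬝ᵥ b₃ = 0 ∨ w' ⬝ᵥ b₄ = 0) := by
  rcases hp.lt_or_eq with hp' | hp'
  swap
  · exact ⟨w, hw0, hp, h1, h2, h3, h4, .inl hp'⟩
  have hcp : (p ⨯₃ b₁) ⬝ᵥ p = 0 := by rw [dotProduct_comm, dot_self_cross]
  have hcb : (p ⨯₃ b₁) ⬝ᵥ b₁ = 0 := by rw [dotProduct_comm, dot_cross_self]
  -- Moving along `± p × b₁` keeps the products with `p` and `b₁`; the sign is chosen so that `b₂`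
  -- is not violated either. Only `b₃` and `b₄` can stop the motion.
  obtain ⟨q, hq0, hqp, hqb, hq2⟩ : ∃ q : Fin 3 → ℝ, q ≠ 0 ∧ q ⬝ᵥ p = 0 ∧ q ⬝ᵥ b₁ = 0 ∧ q ⬝ᵥ b₂ ≤ 0 := by
    rcases le_total ((p ⨯₃ b₁) ⬝ᵥ b₂) 0 with h | h
    · exact ⟨_, hpb, hcp, hcb, h⟩
    · exact ⟨-(p ⨯₃ b₁), neg_ne_zero.2 hpb, by rw [neg_dotProduct, hcp, neg_zero],
        by rw [neg_dotProduct, hcb, neg_zero], by rw [neg_dotProduct]; linarith⟩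
  by_cases hq : ∃ i, 0 < q ⬝ᵥ (![b₃, b₄] i)
  · obtain ⟨t, ht, hall, i, -, hi⟩ := exists_first_tight ![b₃, b₄] (w := w) (q := q)
      (by simp [Fin.forall_fin_two, h3, h4]) hq
    have e : ∀ y, (w + t • q) ⬝ᵥ y = w ⬝ᵥ y + t * (q ⬝ᵥ y) := fun y => by
      rw [add_dotProduct, smul_dotProduct, smul_eq_mul]
    refine ⟨w + t • q, ?_, ?_, ?_, ?_, hall 0, hall 1, ?_⟩
    · intro h
      have := e p
      rw [h, hqp] at this
      simp at this
      linarith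
    · rw [e, hqp]; linarith
    · rw [e, hqb]; linarith
    · rw [e]; nlinarith
    · fin_cases i
      · exact .inr (.inl hi)
      · exact .inr (.inr hi)
  -- Nothing stops the motion, so `q` itself lies in the polar cone, and it is tight at `p`.
  · simp only [not_exists, not_lt, Fin.forall_fin_two] at hq
    exact ⟨q, hq0, hqp.le, hqb.le, hq2, hq.1, hq.2, .inl hqp⟩

end Vectors

end Snapping

/-! ### A Helly-type bound of four fingers, and the shape of the extremal case. -/

namespace Snapping

open Matrix

/-! ## Irredundant covers

`X i` is the set of normals of the `i`-th finger and `p` that of the palm. The vector `v i` is a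
direction that is blocked by the `i`-th finger only. -/

structure Irredundant {ι : Type*} (X : ι → Set (Fin 3 → ℝ)) (p : Fin 3 → ℝ) (v : ι → Fin 3 → ℝ) :
    Prop where
  neg : ∀ i j, i ≠ j → ∀ x ∈ X j, v i ⬝ᵥ x ≤ 0
  neg_palm : ∀ i, v i ⬝ᵥ p ≤ 0
  pos : ∀ i, ∃ x ∈ X i, 0 < v i ⬝ᵥ x
  cover : ∀ z : Fin 3 → ℝ, z ⬝ᵥ p ≤ 0 → (∀ i, ∀ x ∈ X i, z ⬝ᵥ x ≤ 0) → z = 0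
  body : ∀ i, ∃ b ∈ X i, p ⨯₃ b ≠ 0

namespace Irredundant

variable {ι : Type*} {X : ι → Set (Fin 3 → ℝ)} {p : Fin 3 → ℝ} {v : ι → Fin 3 → ℝ}

theorem ne_zero (h : Irredundant X p v) (i : ι) : v i ≠ 0 := by
  obtain ⟨x, -, hx⟩ := h.pos i
  intro h0
  simp [h0] at hx

theorem palm_ne_zero (h : Irredundant X p v) (i : ι) : p ≠ 0 := by
  obtain ⟨b, -, hb⟩ := h.body i
  rintro rfl
  simp at hb

/-- A nonnegative multiple of `v i` is nonpositive on `X j`, whereas `v j` is positive somewhere on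
it; so parallel witnesses must be opposite. -/
theorem opposite_or_cross_ne_zero (h : Irredundant X p v) {i j : ι} (hij : i ≠ j) :
    (∃ c : ℝ, 0 < c ∧ v j = -c • v i) ∨ v i ⨯₃ v j ≠ 0 := by
  by_contra! hcon
  obtain ⟨c, hc⟩ := exists_smul_of_cross_eq_zero (h.ne_zero i) hcon.2
  obtain ⟨x, hxj, hx⟩ := h.pos j
  have := h.neg i j hij x hxj
  rw [hc, smul_dotProduct, smul_eq_mul] at hx
  have hneg : c < 0 := by by_contra hc'; nlinarith
  exact hcon.1 (-c) (by linarith) (by rw [hc, neg_neg])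

/-- Linearly dependent vectors satisfy a relation with nonnegative coefficients. -/
theorem exists_nonneg_relation (h : Irredundant X p v) {n : ℕ} {f : Fin n → ι}
    (hf : Function.Injective f) (hd : ¬ LinearIndependent ℝ (v ∘ f)) :
    ∃ a : Fin n → ℝ, (∀ i, 0 ≤ a i) ∧ (∃ i, a i ≠ 0) ∧ ∑ i, a i • v (f i) = 0 := by
  obtain ⟨g, hg, i0, hi0⟩ := Fintype.not_linearIndependent_iff.1 hd
  -- Split the relation into its positive and negative parts, two expressions for the same vector
  -- `z`. No index occurs in both, so for each finger one of the expressions avoids it and shows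
  -- that the finger does not block `z`. Hence `z = 0` by `cover`, and the part that contains `i0`
  -- is the desired relation.
  have hsum : ∑ i, max (g i) 0 • v (f i) = ∑ i, max (-g i) 0 • v (f i) := by
    rw [← sub_eq_zero, ← Finset.sum_sub_distrib, ← hg]
    refine Finset.sum_congr rfl fun i _ => ?_
    rw [← sub_smul]
    congr 1
    rcases le_total (g i) 0 with h | h
    · rw [max_eq_right h, max_eq_left (by linarith)]; ring
    · rw [max_eq_left h, max_eq_right (by linarith)]; ring
  have hle : ∀ (c : Fin n → ℝ) (y : Fin 3 → ℝ), (∀ i, 0 ≤ c i) →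
      (∀ i, c i ≠ 0 → v (f i) ⬝ᵥ y ≤ 0) → (∑ i, c i • v (f i)) ⬝ᵥ y ≤ 0 := by
    intro c y hc hy
    rw [sum_dotProduct]
    refine Finset.sum_nonpos fun i _ => ?_
    rw [smul_dotProduct, smul_eq_mul]
    by_cases h0 : c i = 0
    · simp [h0]
    · exact mul_nonpos_of_nonneg_of_nonpos (hc i) (hy i h0)
  have hz : ∑ i, max (g i) 0 • v (f i) = 0 := by
    refine h.cover _ (hle _ _ (fun i => le_max_right _ _) fun i _ => h.neg_palm _) fun k x hx => ?_
    by_cases hk : ∃ i, f i = k ∧ 0 < g i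
    · obtain ⟨i, rfl, hi⟩ := hk
      rw [hsum]
      refine hle _ _ (fun i => le_max_right _ _) fun j hj => h.neg _ _ (fun e => ?_) x hx
      rw [hf e, max_eq_right (by linarith)] at hj
      exact hj rfl
    · push Not at hk
      refine hle _ _ (fun i => le_max_right _ _) fun j hj => h.neg _ _ (fun e => ?_) x hx
      exact hj (max_eq_right (hk j e))
  by_cases hpos : 0 < g i0
  · exact ⟨_, fun i => le_max_right _ _, ⟨i0, by rw [max_eq_left hpos.le]; exact hi0⟩, hz⟩
  · refine ⟨_, fun i => le_max_right _ _, ⟨i0, ?_⟩, hsum ▸ hz⟩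
    rw [max_eq_left (by linarith)]
    exact neg_ne_zero.2 hi0

/-- A vanishing sum of nonpositive terms has only zero terms. -/
theorem relation_orthogonal {n : ℕ} {f : Fin n → ι} {a : Fin n → ℝ}
    (ha : ∀ i, 0 ≤ a i) (hs : ∑ i, a i • v (f i) = 0) {y : Fin 3 → ℝ}
    (hy : ∀ i, a i ≠ 0 → v (f i) ⬝ᵥ y ≤ 0) (i : Fin n) (hi : a i ≠ 0) : v (f i) ⬝ᵥ y = 0 := by
  have h1 : ∑ i, a i * (v (f i) ⬝ᵥ y) = 0 := by
    have : (∑ i, a i • v (f i)) ⬝ᵥ y = 0 := by rw [hs]; simp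
    simpa [sum_dotProduct] using this
  have h2 : ∀ i ∈ Finset.univ, a i * (v (f i) ⬝ᵥ y) ≤ 0 := by
    intro j _
    by_cases h0 : a j = 0
    · simp [h0]
    · exact mul_nonpos_of_nonneg_of_nonpos (ha j) (hy j h0)
  have := (Finset.sum_eq_zero_iff_of_nonpos h2).1 h1 i (Finset.mem_univ _)
  exact (mul_eq_zero.1 this).resolve_left hi

/-- Two of four vectors are opposite. -/
theorem exists_opposite (h : Irredundant X p v) {f : Fin 4 → ι} (hf : Function.Injective f) :
    ∃ i j, i ≠ j ∧ ∃ c : ℝ, 0 < c ∧ v (f j) = -c • v (f i) := by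
  by_contra! hcon
  have hcr : ∀ i j, i ≠ j → v (f i) ⨯₃ v (f j) ≠ 0 := fun i j hij =>
    (h.opposite_or_cross_ne_zero (hf.ne hij)).resolve_left
      fun ⟨c, hc, e⟩ => hcon i j hij c hc e
  -- A nonnegative relation that omits some index `k` is impossible: its vectors are orthogonal to
  -- the palm and to the body of `k`, hence all on one line, while it involves at least two
  -- nonparallel ones.
  have key : ∀ (n : ℕ) (g : Fin n → Fin 4) (a : Fin n → ℝ), Function.Injective g →
      (∀ i, 0 ≤ a i) → (∃ i, a i ≠ 0) → ∑ i, a i • v (f (g i)) = 0 →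
      ∀ k, (∀ i, g i = k → a i = 0) → False := by
    intro n g a hg ha hne hs k hk
    obtain ⟨i, hi⟩ := hne
    obtain ⟨j, hji, hj⟩ : ∃ j, j ≠ i ∧ a j ≠ 0 := by
      by_contra! hc
      rw [Finset.sum_eq_single i (fun j _ hj => by rw [hc j hj, zero_smul]) (by simp)] at hs
      exact (smul_ne_zero hi (h.ne_zero _)) hs
    obtain ⟨b, hb, hpb⟩ := h.body (f k)
    have ho : ∀ y, (∀ i, a i ≠ 0 → v (f (g i)) ⬝ᵥ y ≤ 0) → ∀ i, a i ≠ 0 → v (f (g i)) ⬝ᵥ y = 0 :=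
      fun y hy => relation_orthogonal (f := f ∘ g) ha hs hy
    have hop := ho p fun i _ => h.neg_palm _
    have hob := ho b fun i hi => h.neg _ _ (fun e => hi (hk i (hf e))) b hb
    exact not_both_orthogonal (hcr _ _ (hg.ne hji)) hpb (hop j hj) (hob j hj) (hop i hi) (hob i hi)
  obtain ⟨a, ha, hne, hs⟩ := h.exists_nonneg_relation hf
    (fun hl => by have := hl.fintype_card_le_finrank; simp at this)
  by_cases hz : ∃ k, a k = 0
  · obtain ⟨k, hk⟩ := hz
    exact key 4 id a Function.injective_id ha hne hs k (by rintro i rfl; exact hk)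
  -- If all four coefficients are nonzero, all four vectors are orthogonal to the palm. Then the
  -- first three lie in a plane and already satisfy a relation, which omits the fourth.
  · push Not at hz
    have hp : ∀ i, v (f i) ⬝ᵥ p = 0 := fun i =>
      relation_orthogonal ha hs (fun i _ => h.neg_palm _) i (hz i)
    obtain ⟨a', ha', hne', hs'⟩ := h.exists_nonneg_relation
      (f := f ∘ Fin.castSucc) (hf.comp (Fin.castSucc_injective 3))
      (not_linearIndependent_of_orthogonal (h.palm_ne_zero (f 0)) fun i => hp _)
    exact key 3 Fin.castSucc a' (Fin.castSucc_injective 3) ha' hne' hs' (Fin.last 3)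
      fun i hi => absurd hi (Fin.castSucc_lt_last i).ne

/-- Both `v i` and a negative multiple of it are nonpositive on `X k`. -/
theorem orthogonal_of_opposite (h : Irredundant X p v) {i j k : ι} {c : ℝ} (hc : 0 < c)
    (hv : v j = -c • v i) (hki : k ≠ i) (hkj : k ≠ j) {x : Fin 3 → ℝ} (hx : x ∈ X k) :
    v i ⬝ᵥ x = 0 := by
  have h1 := h.neg i k hki.symm x hx
  have h2 := h.neg j k hkj.symm x hx
  rw [hv, smul_dotProduct, smul_eq_mul] at h2
  nlinarith

theorem palm_of_opposite (h : Irredundant X p v) {i j : ι} {c : ℝ} (hc : 0 < c)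
    (hv : v j = -c • v i) : v i ⬝ᵥ p = 0 := by
  have h1 := h.neg_palm i
  have h2 := h.neg_palm j
  rw [hv, smul_dotProduct, smul_eq_mul] at h2
  nlinarith

theorem cross_ne_zero_of_orthogonal (h : Irredundant X p v) {u : Fin 3 → ℝ} (hu : u ≠ 0) {k : ι}
    (hk : ∀ x ∈ X k, u ⬝ᵥ x = 0) : u ⨯₃ v k ≠ 0 := by
  obtain ⟨x, hx, hxk⟩ := h.pos k
  exact cross_ne_zero_of_dot_pos hu (hk x hx) hxk.ne'

/-- At most four fingers can be needed. -/
theorem no_five (h : Irredundant X p v) (g : Fin 5 → ι) (hg : Function.Injective g) : False := by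
  obtain ⟨a, b, hab, c, hc, hv⟩ := h.exists_opposite (f := g ∘ Fin.castSucc)
    (hg.comp (Fin.castSucc_injective 4))
  obtain ⟨k, l, m, hinj, hne⟩ : ∃ k l m : Fin 5,
      Function.Injective ![a.castSucc, k, l, m] ∧
      ∀ x ∈ [k, l, m], x ≠ a.castSucc ∧ x ≠ b.castSucc := by
    clear hv; revert a b; decide
  set i := g a.castSucc
  set j := g b.castSucc
  -- The three fingers outside the opposite pair have their normals orthogonal to `v i`, so their
  -- witnesses are not parallel to `v i`. A second opposite pair, chosen among these three and `i`,
  -- therefore lies within the three.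
  have ho : ∀ x ∈ [k, l, m], ∀ y ∈ X (g x), v i ⬝ᵥ y = 0 := fun x hx y hy =>
    h.orthogonal_of_opposite hc hv (hg.ne (hne x hx).1) (hg.ne (hne x hx).2) hy
  have hcross : ∀ x ∈ [k, l, m], v i ⨯₃ v (g x) ≠ 0 := fun x hx =>
    h.cross_ne_zero_of_orthogonal (h.ne_zero i) (ho x hx)
  obtain ⟨a', b', hab', c', hc', hv'⟩ := h.exists_opposite (f := g ∘ ![a.castSucc, k, l, m])
    (hg.comp hinj)
  have hmem : ∀ x : Fin 4, x ≠ 0 → ![a.castSucc, k, l, m] x ∈ [k, l, m] := by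
    intro x hx; fin_cases x <;> simp at hx ⊢
  simp only [Function.comp_apply] at hv'
  by_cases ha' : a' = 0
  · subst ha'
    apply hcross _ (hmem b' hab'.symm)
    rw [hv']
    simp [i]
  by_cases hb' : b' = 0
  · subst hb'
    apply hcross _ (hmem a' ha')
    simp only [cons_val_zero] at hv'
    simp only [i]
    rw [hv']
    simp
  -- The finger `e` left over has all normals orthogonal to a witness from each opposite pair, and
  -- so has the palm. These two witnesses are not parallel, so the body of `e` would be parallel to
  -- the palm.
  obtain ⟨e, he0, hea, heb⟩ : ∃ e : Fin 4, e ≠ 0 ∧ e ≠ a' ∧ e ≠ b' :=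
    (by decide : ∀ a b : Fin 4, a ≠ 0 → b ≠ 0 → ∃ e : Fin 4, e ≠ 0 ∧ e ≠ a ∧ e ≠ b) a' b' ha' hb'
  have ho' : ∀ y ∈ X (g (![a.castSucc, k, l, m] e)), v (g (![a.castSucc, k, l, m] a')) ⬝ᵥ y = 0 :=
    fun y hy => h.orthogonal_of_opposite hc' hv' (hg.ne (hinj.ne hea)) (hg.ne (hinj.ne heb)) hy
  obtain ⟨y, hy, hpy⟩ := h.body (g (![a.castSucc, k, l, m] e))
  exact not_both_orthogonal (hcross _ (hmem a' ha')) hpy (h.palm_of_opposite hc hv)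
    (ho _ (hmem e he0) y hy) (h.palm_of_opposite hc' hv') (ho' y hy)

/-- The palm and two fingers span, as a cone, the plane orthogonal to `u`. -/
def SpansPlane (X : ι → Set (Fin 3 → ℝ)) (p : Fin 3 → ℝ) (k l : ι) (u : Fin 3 → ℝ) : Prop :=
  ∀ z : Fin 3 → ℝ, z ⬝ᵥ p ≤ 0 → (∀ x ∈ X k, z ⬝ᵥ x ≤ 0) → (∀ x ∈ X l, z ⬝ᵥ x ≤ 0) →
    ∃ s : ℝ, z = s • u

theorem exists_pos_neg (h : Irredundant X p v) {i j : ι} (hij : i ≠ j) {c : ℝ} (hc : 0 < c)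
    (hv : v j = -c • v i) : (∀ x ∈ X i, 0 ≤ v i ⬝ᵥ x) ∧ (∃ x ∈ X i, 0 < v i ⬝ᵥ x) ∧
      (∀ x ∈ X j, v i ⬝ᵥ x ≤ 0) ∧ ∃ x ∈ X j, v i ⬝ᵥ x < 0 := by
  refine ⟨fun x hx => ?_, h.pos i, h.neg i j hij, ?_⟩
  · have := h.neg j i hij.symm x hx
    rw [hv, smul_dotProduct, smul_eq_mul] at this
    nlinarith
  · obtain ⟨x, hx, hp⟩ := h.pos j
    rw [hv, smul_dotProduct, smul_eq_mul] at hp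
    exact ⟨x, hx, by nlinarith⟩

/-- Write `z = α v k + β v l + γ v i`; the last term vanishes on the palm, on `X k` and on `X l`. If
`α, β ≥ 0`, then `α v k + β v l` is blocked by nothing and is zero. Mixed signs contradict a normal
that only `v k` or only `v l` sees, or make a body parallel to the palm. If both are negative, all
three basis vectors are orthogonal to the palm. -/
theorem spansPlane_of_linearIndependent (h : Irredundant X p v) {i j k l : ι} (hik : i ≠ k)
    (hil : i ≠ l) (hjk : j ≠ k) (hjl : j ≠ l) (hkl : k ≠ l) (hex : ∀ m, m = i ∨ m = j ∨ m = k ∨ m = l)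
    {c : ℝ} (hc : 0 < c) (hv : v j = -c • v i) (hli : LinearIndependent ℝ ![v k, v l, v i]) :
    SpansPlane X p k l (v i) := by
  intro z hzp hzk hzl
  have hs := hli.span_eq_top_of_card_eq_finrank (by simp)
  have hz : z ∈ Submodule.span ℝ (Set.range ![v k, v l, v i]) := by rw [hs]; trivial
  have hr : Set.range ![v k, v l, v i] = {v k, v l, v i} := by
    ext y; simp; tauto
  rw [hr, Submodule.mem_span_triple] at hz
  obtain ⟨α, β, γ, rfl⟩ := hz
  have e : ∀ x, (α • v k + β • v l + γ • v i) ⬝ᵥ x =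
      α * (v k ⬝ᵥ x) + β * (v l ⬝ᵥ x) + γ * (v i ⬝ᵥ x) := fun x => by
    simp [add_dotProduct]
  have oxk : ∀ x ∈ X k, v i ⬝ᵥ x = 0 := fun x => h.orthogonal_of_opposite hc hv hik.symm hjk.symm
  have oxl : ∀ x ∈ X l, v i ⬝ᵥ x = 0 := fun x => h.orthogonal_of_opposite hc hv hil.symm hjl.symm
  have op := h.palm_of_opposite hc hv
  have e2 : ∀ x, (α • v k + β • v l) ⬝ᵥ x = α * (v k ⬝ᵥ x) + β * (v l ⬝ᵥ x) := fun x => by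
    simp [add_dotProduct]
  have crk := h.cross_ne_zero_of_orthogonal (h.ne_zero i) oxk
  have crl := h.cross_ne_zero_of_orthogonal (h.ne_zero i) oxl
  have hpk := h.neg_palm k
  have hpl := h.neg_palm l
  rw [e, op] at hzp
  obtain ⟨xk, hxk, hxkp⟩ := h.pos k
  obtain ⟨xl, hxl, hxlp⟩ := h.pos l
  have h1 := hzk xk hxk
  have h2 := hzl xl hxl
  have h3 := h.neg l k hkl.symm xk hxk
  have h4 := h.neg k l hkl xl hxl
  rw [e, oxk xk hxk] at h1
  rw [e, oxl xl hxl] at h2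
  rcases le_or_gt 0 α with hα | hα <;> rcases le_or_gt 0 β with hβ | hβ
  · have h0 : α • v k + β • v l = 0 := by
      refine h.cover _ (by rw [e2]; nlinarith) fun m x hx => ?_
      rw [e2]
      rcases hex m with rfl | rfl | rfl | rfl
      · nlinarith [h.neg _ _ hik.symm x hx, h.neg _ _ hil.symm x hx]
      · nlinarith [h.neg _ _ hjk.symm x hx, h.neg _ _ hjl.symm x hx]
      · have := hzk x hx
        rw [e, oxk x hx] at this; linarith
      · have := hzl x hx
        rw [e, oxl x hx] at this; linarith
    exact ⟨γ, by rw [h0, zero_add]⟩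
  · exfalso
    rcases hα.lt_or_eq with hα | rfl
    · nlinarith [mul_pos hα hxkp]
    · obtain ⟨b, hb, hpb⟩ := h.body k
      have h5 := hzk b hb
      rw [e, oxk b hb] at h5
      have h6 := h.neg l k hkl.symm b hb
      exact not_both_orthogonal crl hpb op (oxk b hb) (by nlinarith) (by nlinarith)
  · exfalso
    rcases hβ.lt_or_eq with hβ | rfl
    · nlinarith [mul_pos hβ hxlp]
    · obtain ⟨b, hb, hpb⟩ := h.body l
      have h5 := hzl b hb
      rw [e, oxl b hb] at h5
      have h6 := h.neg k l hkl b hb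
      exact not_both_orthogonal crk hpb op (oxl b hb) (by nlinarith) (by nlinarith)
  · exfalso
    refine not_linearIndependent_of_orthogonal (h.palm_ne_zero i) ?_ hli
    have h5 : v k ⬝ᵥ p = 0 := by nlinarith
    have h6 : v l ⬝ᵥ p = 0 := by nlinarith
    intro m; fin_cases m <;> simp [h5, h6, op]

/-- In a relation of `v k`, `v l`, `v i`, normals of `k` and `l`, on which `v i` vanishes, exclude
coefficients of opposite sign for `v k` and `v l`. Normals of `i` and `j`, on which `v i` has both
signs while `v k` and `v l` are nonpositive, then force the coefficient of `v i` to vanish. So `v k`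
and `v l` are parallel. -/
theorem opposite_of_dependent (h : Irredundant X p v) {i j k l : ι} (hij : i ≠ j) (hik : i ≠ k)
    (hil : i ≠ l) (hjk : j ≠ k) (hjl : j ≠ l) (hkl : k ≠ l) {c : ℝ} (hc : 0 < c)
    (hv : v j = -c • v i) (hli : ¬ LinearIndependent ℝ ![v k, v l, v i]) :
    ∃ c' : ℝ, 0 < c' ∧ v l = -c' • v k := by
  refine (h.opposite_or_cross_ne_zero hkl).resolve_right fun hcr => ?_
  obtain ⟨g, hg, hne⟩ := Fintype.not_linearIndependent_iff.1 hli
  simp only [Fin.sum_univ_three, cons_val] at hg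
  have oxk : ∀ x ∈ X k, v i ⬝ᵥ x = 0 := fun x => h.orthogonal_of_opposite hc hv hik.symm hjk.symm
  have oxl : ∀ x ∈ X l, v i ⬝ᵥ x = 0 := fun x => h.orthogonal_of_opposite hc hv hil.symm hjl.symm
  have e : ∀ x, g 0 * (v k ⬝ᵥ x) + g 1 * (v l ⬝ᵥ x) + g 2 * (v i ⬝ᵥ x) = 0 := fun x => by
    have : (g 0 • v k + g 1 • v l + g 2 • v i) ⬝ᵥ x = 0 := by rw [hg]; simp
    simpa [add_dotProduct] using this
  obtain ⟨xk, hxk, hxkp⟩ := h.pos k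
  obtain ⟨xl, hxl, hxlp⟩ := h.pos l
  obtain ⟨-, ⟨xi, hxi, hxip⟩, -, xj, hxj, hxjp⟩ := h.exists_pos_neg hij hc hv
  have h1 := e xk
  have h2 := e xl
  have h3 := h.neg l k hkl.symm xk hxk
  have h4 := h.neg k l hkl xl hxl
  have h5 := e xi
  have h6 := e xj
  have i1 := h.neg k i hik.symm xi hxi
  have i2 := h.neg l i hil.symm xi hxi
  have j1 := h.neg k j hjk.symm xj hxj
  have j2 := h.neg l j hjl.symm xj hxj
  rw [oxk xk hxk] at h1
  rw [oxl xl hxl] at h2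
  have hg2 : g 2 = 0 := by
    rcases lt_trichotomy (g 0) 0 with a | a | a <;> rcases lt_trichotomy (g 1) 0 with b | b | b
    · have : 0 ≤ g 2 * (v i ⬝ᵥ xi) → False ∨ True := fun _ => .inr trivial
      have q1 : g 2 * (v i ⬝ᵥ xi) ≤ 0 := by nlinarith
      have q2 : g 2 * (v i ⬝ᵥ xj) ≤ 0 := by nlinarith
      nlinarith
    · rw [b] at h1; nlinarith
    · nlinarith
    · rw [a] at h2; nlinarith
    · rw [a, b] at h5
      nlinarith
    · rw [a] at h2; nlinarith
    · nlinarith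
    · rw [b] at h1; nlinarith
    · have q1 : 0 ≤ g 2 * (v i ⬝ᵥ xi) := by nlinarith
      have q2 : 0 ≤ g 2 * (v i ⬝ᵥ xj) := by nlinarith
      nlinarith
  rw [hg2, zero_smul, add_zero] at hg
  have h01 : g 0 ≠ 0 ∨ g 1 ≠ 0 := by
    by_contra! hc0
    obtain ⟨m, hm⟩ := hne
    fin_cases m
    exacts [hm hc0.1, hm hc0.2, hm hg2]
  have c1 : g 1 • (v k ⨯₃ v l) = 0 := by
    have := congrArg (fun y => v k ⨯₃ y) hg
    simpa using this
  have c2 : g 0 • (v k ⨯₃ v l) = 0 := by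
    have := congrArg (fun y => y ⨯₃ v l) hg
    simpa using this
  rcases h01 with h0 | h0
  · exact hcr ((smul_eq_zero.1 c2).resolve_left h0)
  · exact hcr ((smul_eq_zero.1 c1).resolve_left h0)

/-- A direction that is blocked neither by the palm nor by two opposite fingers is an obtuse
one for the palm. -/
theorem dot_palm_neg (h : Irredundant X p v) {i j k l : ι} (hik : i ≠ k) (hil : i ≠ l)
    (hjk : j ≠ k) (hjl : j ≠ l) (hkl : k ≠ l) {c c' : ℝ} (hc : 0 < c) (hv : v j = -c • v i)
    (hc' : 0 < c') (hv' : v l = -c' • v k) {z : Fin 3 → ℝ} (hzp : z ⬝ᵥ p ≤ 0)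
    (hzk : ∀ x ∈ X k, z ⬝ᵥ x ≤ 0) (hzl : ∀ x ∈ X l, z ⬝ᵥ x ≤ 0) (hz : ¬ ∃ s : ℝ, z = s • v i) :
    z ⬝ᵥ p < 0 := by
  refine lt_of_le_of_ne hzp fun h0 => hz ?_
  have oxk : ∀ x ∈ X k, v i ⬝ᵥ x = 0 := fun x => h.orthogonal_of_opposite hc hv hik.symm hjk.symm
  have oxl : ∀ x ∈ X l, v i ⬝ᵥ x = 0 := fun x => h.orthogonal_of_opposite hc hv hil.symm hjl.symm
  have op := h.palm_of_opposite hc hv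
  have op' := h.palm_of_opposite hc' hv'
  have cr := h.cross_ne_zero_of_orthogonal (h.ne_zero i) oxk
  -- If `z` were orthogonal to the palm, it would lie in the plane spanned by `v i` and `v k`.
  -- Normals of `k` and `l`, on which `v i` vanishes and `v k` takes both signs, kill its component
  -- along `v k`.
  have hd : ¬ LinearIndependent ℝ ![v i, v k, z] :=
    not_linearIndependent_of_orthogonal (h.palm_ne_zero i) (by
      intro m; fin_cases m <;> simp [h0, op, op'])
  obtain ⟨g, hg, hne⟩ := Fintype.not_linearIndependent_iff.1 hd
  simp only [Fin.sum_univ_three, cons_val] at hg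
  have hg2 : g 2 ≠ 0 := by
    intro hg2
    rw [hg2, zero_smul, add_zero] at hg
    have c1 : g 1 • (v i ⨯₃ v k) = 0 := by
      have := congrArg (fun y => v i ⨯₃ y) hg
      simpa using this
    have c2 : g 0 • (v i ⨯₃ v k) = 0 := by
      have := congrArg (fun y => y ⨯₃ v k) hg
      simpa using this
    obtain ⟨m, hm⟩ := hne
    fin_cases m
    exacts [hm ((smul_eq_zero.1 c2).resolve_right cr), hm ((smul_eq_zero.1 c1).resolve_right cr),
      hm hg2]
  have hz' : z = (-(g 0 / g 2)) • v i + (-(g 1 / g 2)) • v k := by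
    have : z = (g 2)⁻¹ • (g 2 • z) := by rw [smul_smul, inv_mul_cancel₀ hg2, one_smul]
    rw [this, show g 2 • z = -(g 0 • v i + g 1 • v k) from eq_neg_of_add_eq_zero_right hg]
    simp only [smul_neg, smul_add, smul_smul, neg_smul, div_eq_inv_mul]
    abel
  obtain ⟨-, ⟨xk, hxk, hxkp⟩, -, xl, hxl, hxlp⟩ := h.exists_pos_neg hkl hc' hv'
  generalize -(g 0 / g 2) = α at hz'
  generalize -(g 1 / g 2) = β at hz'
  have e : ∀ x, z ⬝ᵥ x = α * (v i ⬝ᵥ x) + β * (v k ⬝ᵥ x) := fun x => by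
    rw [hz']; simp [add_dotProduct]
  have h1 := hzk xk hxk
  have h2 := hzl xl hxl
  rw [e, oxk xk hxk] at h1
  rw [e, oxl xl hxl] at h2
  have hβ : β = 0 := by nlinarith
  exact ⟨α, by rw [hz', hβ]; simp⟩

/-- If neither plane is spanned, there are two opposite pairs and unblocked directions `z`, `z'` off
the respective axes, both at an obtuse angle to the palm. A combination of `z` and `z'` that is
orthogonal to the palm is a combination of `v i` and `v k`. -/
theorem exists_planar (h : Irredundant X p v) {i j k l : ι} (hij : i ≠ j) (hik : i ≠ k) (hil : i ≠ l)
    (hjk : j ≠ k) (hjl : j ≠ l) (hkl : k ≠ l) (hex : ∀ m, m = i ∨ m = j ∨ m = k ∨ m = l)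
    {c : ℝ} (hc : 0 < c) (hv : v j = -c • v i) :
    SpansPlane X p k l (v i) ∨ (∃ c' : ℝ, 0 < c' ∧ v l = -c' • v k) ∧ SpansPlane X p i j (v k) := by
  by_cases hli : LinearIndependent ℝ ![v k, v l, v i]
  · exact .inl (h.spansPlane_of_linearIndependent hik hil hjk hjl hkl hex hc hv hli)
  obtain ⟨c', hc', hv'⟩ := h.opposite_of_dependent hij hik hil hjk hjl hkl hc hv hli
  by_contra! hcon
  obtain ⟨h1, h2⟩ := hcon
  have h2 := h2 ⟨c', hc', hv'⟩
  simp only [SpansPlane, not_forall] at h1 h2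
  obtain ⟨z, hzp, hzk, hzl, hz⟩ := h1
  obtain ⟨z', hzp', hzi', hzj', hz'⟩ := h2
  have hn := h.dot_palm_neg hik hil hjk hjl hkl hc hv hc' hv' hzp hzk hzl hz
  have hn' := h.dot_palm_neg hik.symm hjk.symm hil.symm hjl.symm hij hc' hv' hc hv hzp' hzi' hzj' hz'
  have oxk : ∀ x ∈ X k, v i ⬝ᵥ x = 0 := fun x => h.orthogonal_of_opposite hc hv hik.symm hjk.symm
  have oxl : ∀ x ∈ X l, v i ⬝ᵥ x = 0 := fun x => h.orthogonal_of_opposite hc hv hil.symm hjl.symm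
  have oxi : ∀ x ∈ X i, v k ⬝ᵥ x = 0 := fun x => h.orthogonal_of_opposite hc' hv' hik hil
  have oxj : ∀ x ∈ X j, v k ⬝ᵥ x = 0 := fun x => h.orthogonal_of_opposite hc' hv' hjk hjl
  have op := h.palm_of_opposite hc hv
  have op' := h.palm_of_opposite hc' hv'
  have cr := h.cross_ne_zero_of_orthogonal (h.ne_zero i) oxk
  have hd : ¬ LinearIndependent ℝ ![v i, v k, (-(z' ⬝ᵥ p)) • z - (-(z ⬝ᵥ p)) • z'] :=
    not_linearIndependent_of_orthogonal (h.palm_ne_zero i) (by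
      intro m; fin_cases m
      · exact op
      · exact op'
      · simp only [sub_dotProduct, smul_dotProduct, smul_eq_mul, Fin.reduceFinMk, cons_val]; ring)
  obtain ⟨g, hg, hne⟩ := Fintype.not_linearIndependent_iff.1 hd
  simp only [Fin.sum_univ_three, cons_val] at hg
  have hg2 : g 2 ≠ 0 := by
    intro hg2
    rw [hg2, zero_smul, add_zero] at hg
    have c1 : g 1 • (v i ⨯₃ v k) = 0 := by
      have := congrArg (fun y => v i ⨯₃ y) hg
      simpa using this
    have c2 : g 0 • (v i ⨯₃ v k) = 0 := by
      have := congrArg (fun y => y ⨯₃ v k) hg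
      simpa using this
    obtain ⟨m, hm⟩ := hne
    fin_cases m
    exacts [hm ((smul_eq_zero.1 c2).resolve_right cr), hm ((smul_eq_zero.1 c1).resolve_right cr),
      hm hg2]
  have e : ∀ x, g 0 / g 2 * (v i ⬝ᵥ x) + g 1 / g 2 * (v k ⬝ᵥ x) +
      (-(z' ⬝ᵥ p) * (z ⬝ᵥ x) - (-(z ⬝ᵥ p)) * (z' ⬝ᵥ x)) = 0 := fun x => by
    have : (g 0 • v i + g 1 • v k + g 2 • ((-(z' ⬝ᵥ p)) • z - (-(z ⬝ᵥ p)) • z')) ⬝ᵥ x = 0 := by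
      rw [hg]; simp
    simp only [add_dotProduct, sub_dotProduct, smul_dotProduct, smul_eq_mul] at this
    field_simp
    linarith
  -- Up to the relation `e`, this vector equals a positive multiple of `z'` plus a multiple of `v
  -- k`. The first form shows that `k` and `l` do not block it, the second that `i` and `j` do not.
  -- Yet its product with the palm is negative, so it is not zero.
  have h0 := h.cover ((-(z' ⬝ᵥ p)) • z + (g 0 / g 2) • v i) ?_ ?_
  · have : ((-(z' ⬝ᵥ p)) • z + (g 0 / g 2) • v i) ⬝ᵥ p = 0 := by rw [h0]; simp
    simp only [add_dotProduct, smul_dotProduct, smul_eq_mul, op] at this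
    nlinarith
  · simp only [add_dotProduct, smul_dotProduct, smul_eq_mul, op]
    nlinarith
  · intro m x hx
    simp only [add_dotProduct, smul_dotProduct, smul_eq_mul]
    have ex := e x
    rcases hex m with rfl | rfl | rfl | rfl
    · rw [oxi x hx] at ex
      nlinarith [hzi' x hx]
    · rw [oxj x hx] at ex
      nlinarith [hzj' x hx]
    · rw [oxk x hx]
      nlinarith [hzk x hx]
    · rw [oxl x hx]
      nlinarith [hzl x hx]

/-- The structure of irredundant covers by the palm and four fingers: two fingers and the palm lie in
a plane and span it, and the other two fingers lie on both sides of that plane. -/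
theorem exists_structure {X : Fin 4 → Set (Fin 3 → ℝ)} {v : Fin 4 → Fin 3 → ℝ}
    (h : Irredundant X p v) :
    ∃ i j k l : Fin 4, (i ≠ j ∧ i ≠ k ∧ i ≠ l ∧ j ≠ k ∧ j ≠ l ∧ k ≠ l) ∧ ∃ u : Fin 3 → ℝ, u ≠ 0 ∧ u ⬝ᵥ p = 0 ∧
      (∀ x ∈ X k, u ⬝ᵥ x = 0) ∧ (∀ x ∈ X l, u ⬝ᵥ x = 0) ∧ SpansPlane X p k l u ∧
      (∀ x ∈ X i, 0 ≤ u ⬝ᵥ x) ∧ (∃ x ∈ X i, 0 < u ⬝ᵥ x) ∧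
      (∀ x ∈ X j, u ⬝ᵥ x ≤ 0) ∧ ∃ x ∈ X j, u ⬝ᵥ x < 0 := by
  obtain ⟨i, j, hij, c, hc, hv⟩ := h.exists_opposite (f := id) Function.injective_id
  simp only [id] at hv
  obtain ⟨k, l, hik, hil, hjk, hjl, hkl, hex⟩ : ∃ k l : Fin 4, i ≠ k ∧ i ≠ l ∧ j ≠ k ∧ j ≠ l ∧ k ≠ l ∧
      ∀ m, m = i ∨ m = j ∨ m = k ∨ m = l := by
    clear hv; revert i j; decide
  have oxk : ∀ x ∈ X k, v i ⬝ᵥ x = 0 := fun x => h.orthogonal_of_opposite hc hv hik.symm hjk.symm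
  have oxl : ∀ x ∈ X l, v i ⬝ᵥ x = 0 := fun x => h.orthogonal_of_opposite hc hv hil.symm hjl.symm
  rcases h.exists_planar hij hik hil hjk hjl hkl hex hc hv with hs | ⟨⟨c', hc', hv'⟩, hs⟩
  · refine ⟨i, j, k, l, ⟨hij, hik, hil, hjk, hjl, hkl⟩, v i, h.ne_zero i, h.palm_of_opposite hc hv, oxk, oxl, hs,
      h.exists_pos_neg hij hc hv⟩
  · refine ⟨k, l, i, j, ⟨hkl, hik.symm, hjk.symm, hil.symm, hjl.symm, hij⟩, v k, h.ne_zero k, h.palm_of_opposite hc' hv',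
      fun x => h.orthogonal_of_opposite hc' hv' hik hil,
      fun x => h.orthogonal_of_opposite hc' hv' hjk hjl, hs, h.exists_pos_neg hkl hc' hv'⟩

end Irredundant

end Snapping

/-! ### Embeddedness makes the normals of neighbouring facets independent. -/

namespace Snapping

open Matrix

namespace Polyhedron

variable (P : Polyhedron)

/-! ## Normals of facets -/

theorem tri_injective (t : Fin P.numT) : Function.Injective (P.tri t) := fun _ _ h =>
  (P.nondegenerate t).injective (congrArg P.pos h)

theorem fin_three_add (i : Fin 3) : i + 1 + 1 = i + 2 ∧ i + 2 + 1 = i ∧ i + 1 + 2 = i ∧ i + 1 ≠ i ∧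
    i + 2 ≠ i ∧ i + 2 ≠ i + 1 ∧ ∀ k, k = i ∨ k = i + 1 ∨ k = i + 2 := by
  revert i; decide

theorem normal_eq (t : Fin P.numT) (i : Fin 3) : P.normal t =
    (P.pos (P.tri t (i + 1)) - P.pos (P.tri t i)) ⨯₃ (P.pos (P.tri t (i + 2)) - P.pos (P.tri t i)) := by
  unfold Mesh.normal
  fin_cases i <;> ext k <;> fin_cases k <;> simp [cross_apply] <;> ring

theorem normal_ne_zero (t : Fin P.numT) : P.normal t ≠ 0 := by
  intro h
  have h1 : P.pos (P.tri t 1) - P.pos (P.tri t 0) ≠ 0 := by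
    rw [sub_ne_zero]
    exact P.pos_injective.ne ((P.tri_injective t).ne (by decide))
  obtain ⟨c, hc⟩ := exists_smul_of_cross_eq_zero h1 h
  have h2 := P.nondegenerate t
  rw [show (fun i => P.pos (P.tri t i)) = ![P.pos (P.tri t 0), P.pos (P.tri t 1), P.pos (P.tri t 2)] by
    ext i; fin_cases i <;> rfl, affineIndependent_iff_not_collinear_set] at h2
  apply h2
  rw [collinear_iff_of_mem (p₀ := P.pos (P.tri t 0)) (by simp)]
  refine ⟨P.pos (P.tri t 1) - P.pos (P.tri t 0), fun y hy => ?_⟩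
  simp only [Set.mem_insert_iff, Set.mem_singleton_iff] at hy
  rcases hy with rfl | rfl | rfl
  · exact ⟨0, by simp⟩
  · exact ⟨1, by simp⟩
  · exact ⟨c, by rw [← hc]; simp⟩

theorem sameRay_normal {t t' : Fin P.numT} (h : P.facetOf t = P.facetOf t') :
    SameRay ℝ (P.normal t) (P.normal t') := by
  have h' : Relation.EqvGen (fun t t' => P.Adj t t' ∧ SameRay ℝ (P.normal t) (P.normal t')) t t' :=
    Quotient.exact h
  clear h
  induction h' with
  | rel _ _ h => exact h.2
  | refl _ => exact .refl _
  | symm _ _ _ ih => exact ih.symm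
  | trans _ _ _ _ _ ih1 ih2 =>
    exact ih1.trans ih2
      fun h0 => absurd h0 (P.normal_ne_zero _)

theorem mem_hemisphere {t : Fin P.numT} {v : Fin 3 → ℝ} :
    v ∈ P.hemisphere (P.facetOf t) ↔ v ∈ unitSphere ∧ 0 < v ⬝ᵥ P.normal t := by
  refine and_congr_right fun _ => ⟨?_, fun h => ⟨t, rfl, h⟩⟩
  rintro ⟨t', ht', h⟩
  obtain ⟨c, hc, h'⟩ := (P.sameRay_normal ht').exists_pos_left (P.normal_ne_zero _) (P.normal_ne_zero _)
  rw [← h', dotProduct_smul, smul_eq_mul]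
  exact mul_pos hc h

theorem eq_of_twin {t t' t'' : Fin P.numT} {i j k : Fin 3} (h1 : P.src t' j = P.dst t i)
    (h2 : P.dst t' j = P.src t i) (h3 : P.src t'' k = P.dst t i) (h4 : P.dst t'' k = P.src t i) :
    t' = t'' ∧ j = k := by
  have := (P.twin t i).unique (y₁ := (t', j)) (y₂ := (t'', k)) ⟨h1, h2⟩ ⟨h3, h4⟩
  simpa using this

theorem volume_term (t : Fin P.numT) (i : Fin 3) :
    P.pos (P.tri t 0) ⬝ᵥ (P.pos (P.tri t 1) ⨯₃ P.pos (P.tri t 2)) =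
    P.pos (P.tri t i) ⬝ᵥ (P.pos (P.tri t (i + 1)) ⨯₃ P.pos (P.tri t (i + 2))) := by
  fin_cases i
  · rfl
  · exact triple_product_permutation _ _ _
  · exact (triple_product_permutation _ _ _).symm

/-- Two triangles with a common edge have different third vertices. -/
theorem third_vertex_ne {t t' : Fin P.numT} {i j : Fin 3} (h1 : P.src t i = P.dst t' j)
    (h2 : P.dst t i = P.src t' j) (hne : t ≠ t') : P.tri t (i + 2) ≠ P.tri t' (j + 2) := by
  intro h3
  -- If the third vertices agreed, the two triangles would have the same vertices and opposite
  -- orientation, so every edge of one has its twin in the other. By connectedness they are the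
  -- whole surface, and their volume terms cancel, contradicting `outward`.
  have all : ∀ (t t' : Fin P.numT) (i j : Fin 3), P.src t i = P.dst t' j → P.dst t i = P.src t' j →
      P.tri t (i + 2) = P.tri t' (j + 2) → ∀ t'', P.Adj t t'' → t'' = t' := by
    intro t t' i j h1 h2 h3 t'' ⟨k, l, h4, h5⟩
    simp only [Mesh.src, Mesh.dst] at h1 h2 h4 h5
    obtain ⟨m, hm1, hm2⟩ : ∃ m, P.src t' m = P.dst t k ∧ P.dst t' m = P.src t k := by
      simp only [Mesh.src, Mesh.dst]
      obtain ⟨a1, a2, a3, -, -, -, hk⟩ := fin_three_add i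
      obtain ⟨b1, b2, b3, -, -, -, -⟩ := fin_three_add j
      rcases hk k with rfl | rfl | rfl
      · exact ⟨j, h2.symm, h1.symm⟩
      · exact ⟨j + 2, by rw [a1, h3], by rw [b2, h2]⟩
      · exact ⟨j + 1, by rw [a2, h1], by rw [b1, h3]⟩
    exact ((P.eq_of_twin hm1 hm2 h5.symm h4.symm).1).symm
  have hmem : ∀ s, s = t ∨ s = t' := by
    intro s
    have := P.connected t s
    induction this with
    | refl => exact .inl rfl
    | tail _ h ih =>
      rcases ih with rfl | rfl
      · exact .inr (all _ t' i j h1 h2 h3 _ h)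
      · exact .inl (all _ t j i h2.symm h1.symm h3.symm _ h)
  have huniv : (Finset.univ : Finset (Fin P.numT)) = {t, t'} := by
    ext s; simpa using hmem s
  have hv := P.outward
  rw [Mesh.signedVolume, huniv, Finset.sum_pair hne, P.volume_term t i, P.volume_term t' j, ← h3] at hv
  simp only [Mesh.src, Mesh.dst] at h1 h2
  rw [← h1, ← h2] at hv
  simp only [dotProduct, Fin.sum_univ_three, cross_apply, cons_val] at hv
  linarith

theorem mem_solid {t : Fin P.numT} (i : Fin 3) {x y : ℝ} (hx : 0 ≤ x) (hy : 0 ≤ y) (h : x + y ≤ 1) :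
    P.pos (P.tri t i) + x • (P.pos (P.tri t (i + 1)) - P.pos (P.tri t i)) +
      y • (P.pos (P.tri t (i + 2)) - P.pos (P.tri t i)) ∈ P.solid t := by
  have hmem : ∀ k, P.pos (P.tri t k) ∈ P.solid t := fun k =>
    subset_convexHull ℝ _ ⟨_, ⟨k, rfl⟩, rfl⟩
  have := (convex_convexHull ℝ (P.pos '' P.verts t)).sum_mem (t := Finset.univ)
    (w := ![1 - x - y, x, y])
    (z := ![P.pos (P.tri t i), P.pos (P.tri t (i + 1)), P.pos (P.tri t (i + 2))])
    (by intro k _; fin_cases k <;> simp <;> linarith) (by simp [Fin.sum_univ_three]; ring)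
    (by intro k _; fin_cases k <;> exact hmem _)
  simp only [Fin.sum_univ_three, cons_val] at this
  have e : ∀ a b c : Fin 3 → ℝ, a + x • (b - a) + y • (c - a) = (1 - x - y) • a + x • b + y • c := by
    intro a b c
    simp only [smul_sub, sub_smul, one_smul]
    abel
  rw [e]
  exact this

/-- The normals of neighbouring facets are not parallel. -/
theorem cross_normal_ne_zero {t t' : Fin P.numT} (h : P.Adj t t') (hf : P.facetOf t ≠ P.facetOf t') :
    P.normal t ⨯₃ P.normal t' ≠ 0 := by
  intro h0
  have hne : t ≠ t' := fun e => hf (by rw [e])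
  obtain ⟨k, hk⟩ := exists_smul_of_cross_eq_zero (P.normal_ne_zero t) h0
  -- Parallel normals of equal direction would merge the facets. In the remaining case the second
  -- triangle is folded back onto the first.
  have hk0 : k < 0 := by
    by_contra hk0
    refine hf (Quotient.sound (.rel _ _ ⟨h, ?_⟩))
    rw [hk]
    exact SameRay.sameRay_nonneg_smul_right _ (not_lt.1 hk0)
  obtain ⟨i, j, h1, h2⟩ := h
  have h3 := P.third_vertex_ne h1 h2 hne
  simp only [Mesh.src, Mesh.dst] at h1 h2
  have hab : P.pos (P.tri t (i + 1)) - P.pos (P.tri t i) ≠ 0 :=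
    sub_ne_zero.2 (P.pos_injective.ne ((P.tri_injective t).ne (fin_three_add i).2.2.2.1))
  have hn := P.normal_ne_zero t
  have hn' := hk
  rw [P.normal_eq t i] at hn hk
  rw [P.normal_eq t' j, ← h1, ← h2] at hk
  set a := P.pos (P.tri t i) with ha
  set b := P.pos (P.tri t (i + 1)) with hb
  set c := P.pos (P.tri t (i + 2)) with hc
  set d := P.pos (P.tri t' (j + 2)) with hd
  -- In the common plane, with origin `a` and axes along `b - a` and `c - a`, the apex `d` has
  -- coordinates `(δ, -k)`. It is on the same side of the edge as `c` since `-k > 0`.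
  obtain ⟨δ, hδ⟩ : ∃ δ : ℝ, (d - a) - (-k) • (c - a) = δ • (b - a) := by
    apply exists_smul_of_cross_eq_zero hab
    have e : (a - b) ⨯₃ (d - b) = -((b - a) ⨯₃ (d - a)) := by
      ext m; fin_cases m <;> simp [cross_apply] <;> ring
    rw [e] at hk
    rw [map_sub, map_smul, neg_smul, ← hk]
    simp
  have hM : 0 < 2 * (1 + |δ| + -k) := by have := abs_nonneg δ; linarith
  have hm : ∀ r, r ≤ 1 + |δ| + -k → 1 / (2 * (1 + |δ| + -k)) * r ≤ 1 / 2 := by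
    intro r hr
    rw [one_div_mul_eq_div, div_le_div_iff₀ hM two_pos]
    linarith
  -- A point slightly off the midpoint of the edge, towards the inside, lies in both solid
  -- triangles; `β` is small enough for all barycentric coordinates to be nonnegative. Embeddedness
  -- would put it on the line of the edge.
  obtain ⟨β, hβ, hβk, hβ1, hβ2, hβ3⟩ : ∃ β : ℝ, 0 < β ∧ β * -k ≤ 1 / 2 ∧ β * δ ≤ 1 / 2 ∧ β * (1 - δ) ≤ 1 / 2 ∧
      β ≤ 1 / 2 := by
    have q1 := neg_abs_le δ
    have q2 := le_abs_self δ
    have q3 := abs_nonneg δ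
    refine ⟨1 / (2 * (1 + |δ| + -k)), by positivity, hm _ (by linarith), hm _ (by linarith),
      hm _ (by linarith), ?_⟩
    simpa using hm 1 (by linarith)
  have m1 := P.mem_solid (t := t) i (x := 1 / 2) (y := β * -k) (by norm_num) (by nlinarith) (by linarith)
  have m2 := P.mem_solid (t := t') j (x := 1 - (1 / 2 - β * δ) - β) (y := β) (by linarith) hβ.le (by linarith)
  rw [← h1, ← h2, ← ha, ← hb, ← hd] at m2
  rw [← ha, ← hb, ← hc] at m1
  have e : b + (1 - (1 / 2 - β * δ) - β) • (a - b) + β • (d - b) =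
      a + (1 / 2 : ℝ) • (b - a) + (β * -k) • (c - a) := by
    have hd' : d = a + (-k) • (c - a) + δ • (b - a) := by rw [← hδ]; abel
    rw [hd']
    ext m
    simp
    ring
  rw [e] at m2
  have m3 := P.embedded t t' hne ⟨m1, m2⟩
  have hsub : P.verts t ∩ P.verts t' ⊆ {P.tri t i, P.tri t (i + 1)} := by
    rintro w ⟨⟨m, rfl⟩, ⟨m', hm'⟩⟩
    rcases (fin_three_add i).2.2.2.2.2.2 m with rfl | rfl | rfl
    · simp
    · simp
    · exfalso
      rcases (fin_three_add j).2.2.2.2.2.2 m' with rfl | rfl | rfl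
      · rw [← h2] at hm'
        exact (fin_three_add i).2.2.2.2.2.1 (P.tri_injective t hm').symm
      · rw [← h1] at hm'
        exact (fin_three_add i).2.2.2.2.1 (P.tri_injective t hm').symm
      · exact h3 hm'.symm
  have hconv : Convex ℝ {y : Fin 3 → ℝ | (b - a) ⨯₃ (y - a) = 0} := by
    intro y hy z hz r s hr hs hrs
    simp only [Set.mem_ofPred_eq] at hy hz ⊢
    have : r • y + s • z - a = r • (y - a) + s • (z - a) := by
      have : a = (r + s) • a := by rw [hrs, one_smul]
      nth_rewrite 1 [this]
      rw [add_smul, smul_sub, smul_sub]; abel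
    rw [this, map_add, map_smul, map_smul, hy, hz]; simp
  have m4 := convexHull_min (t := {y : Fin 3 → ℝ | (b - a) ⨯₃ (y - a) = 0}) ?_ hconv m3
  · simp only [Set.mem_ofPred_eq] at m4
    have : a + (1 / 2 : ℝ) • (b - a) + (β * -k) • (c - a) - a = (1 / 2 : ℝ) • (b - a) + (β * -k) • (c - a) := by
      abel
    rw [this, map_add, map_smul, map_smul, cross_self, smul_zero, zero_add, smul_eq_zero] at m4
    rcases m4 with m4 | m4
    · nlinarith
    · exact hn m4
  · rintro _ ⟨w, hw, rfl⟩
    rcases hsub hw with rfl | rfl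
    · simp [← ha]
    · simp [← hb]

end Polyhedron

end Snapping

/-! ### Euler's formula and first homology modulo two. -/

namespace Snapping

open Matrix

namespace Polyhedron

variable (P : Polyhedron)

/-! ## Half-edges and Euler's formula -/

/-- Directed edges: a triangle together with the position of the tail. -/
abbrev HalfEdge := Fin P.numT × Fin 3

noncomputable def twinEdge (h : P.HalfEdge) : P.HalfEdge := (P.twin h.1 h.2).choose

theorem src_twinEdge (h : P.HalfEdge) : P.src (P.twinEdge h).1 (P.twinEdge h).2 = P.dst h.1 h.2 :=
  (P.twin h.1 h.2).choose_spec.1.1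

theorem dst_twinEdge (h : P.HalfEdge) : P.dst (P.twinEdge h).1 (P.twinEdge h).2 = P.src h.1 h.2 :=
  (P.twin h.1 h.2).choose_spec.1.2

theorem eq_twinEdge {h h' : P.HalfEdge} (h1 : P.src h'.1 h'.2 = P.dst h.1 h.2)
    (h2 : P.dst h'.1 h'.2 = P.src h.1 h.2) : h' = P.twinEdge h :=
  (P.twin h.1 h.2).unique ⟨h1, h2⟩ ⟨P.src_twinEdge h, P.dst_twinEdge h⟩

@[simp] theorem twinEdge_twinEdge (h : P.HalfEdge) : P.twinEdge (P.twinEdge h) = h :=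
  (P.eq_twinEdge (P.dst_twinEdge h).symm (P.src_twinEdge h).symm).symm

theorem halfEdge_eq {h h' : P.HalfEdge} (h1 : P.src h'.1 h'.2 = P.src h.1 h.2)
    (h2 : P.dst h'.1 h'.2 = P.dst h.1 h.2) : h' = h := by
  rw [← P.twinEdge_twinEdge h]
  exact P.eq_twinEdge (by rw [h1, P.dst_twinEdge]) (by rw [h2, P.src_twinEdge])

theorem src_ne_dst (h : P.HalfEdge) : P.src h.1 h.2 ≠ P.dst h.1 h.2 := fun e =>
  (fin_three_add h.2).2.2.2.1 (P.tri_injective h.1 e).symm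

theorem twinEdge_ne (h : P.HalfEdge) : P.twinEdge h ≠ h := by
  intro e
  have := P.src_twinEdge h
  rw [e] at this
  exact P.src_ne_dst h this

theorem adj_twinEdge (h : P.HalfEdge) : P.Adj h.1 (P.twinEdge h).1 :=
  ⟨h.2, (P.twinEdge h).2, (P.dst_twinEdge h).symm, (P.src_twinEdge h).symm⟩

theorem adj_iff {t t' : Fin P.numT} : P.Adj t t' ↔ ∃ i, (P.twinEdge (t, i)).1 = t' := by
  constructor
  · rintro ⟨i, j, h1, h2⟩
    exact ⟨i, by rw [← P.eq_twinEdge (h := (t, i)) (h' := (t', j)) h2.symm h1.symm]⟩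
  · rintro ⟨i, rfl⟩
    exact P.adj_twinEdge (t, i)

/-- The undirected edge of a half-edge. -/
def edgeOf (h : P.HalfEdge) : {e // e ∈ P.edges} :=
  ⟨s(P.src h.1 h.2, P.dst h.1 h.2), Finset.mem_image_of_mem
    (fun h : Fin P.numT × Fin 3 => s(P.src h.1 h.2, P.dst h.1 h.2)) (Finset.mem_univ h)⟩

theorem edgeOf_surjective : Function.Surjective P.edgeOf := by
  rintro ⟨e, he⟩
  obtain ⟨h, -, rfl⟩ := Finset.mem_image.1 he
  exact ⟨h, rfl⟩

theorem edgeOf_eq_iff {h h' : P.HalfEdge} : P.edgeOf h' = P.edgeOf h ↔ h' = h ∨ h' = P.twinEdge h := by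
  rw [Subtype.ext_iff]
  simp only [edgeOf, Sym2.eq_iff]
  constructor
  · rintro (⟨h1, h2⟩ | ⟨h1, h2⟩)
    · exact .inl (P.halfEdge_eq h1 h2)
    · exact .inr (P.eq_twinEdge h1 h2)
  · rintro (rfl | rfl)
    · exact .inl ⟨rfl, rfl⟩
    · exact .inr ⟨P.src_twinEdge h, P.dst_twinEdge h⟩

theorem filter_edgeOf (h : P.HalfEdge) :
    (Finset.univ.filter fun h' => P.edgeOf h' = P.edgeOf h) = {h, P.twinEdge h} := by
  ext h'
  simp [edgeOf_eq_iff]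

theorem two_mul_card_edges : 2 * P.edges.card = 3 * P.numT := by
  have h := Finset.card_eq_sum_card_fiberwise (s := (Finset.univ : Finset P.HalfEdge))
    (t := Finset.univ) (f := P.edgeOf) (fun _ _ => Finset.mem_univ _)
  have h2 : ∀ e, (Finset.univ.filter fun h' => P.edgeOf h' = e).card = 2 := by
    intro e
    obtain ⟨h, rfl⟩ := P.edgeOf_surjective e
    rw [filter_edgeOf, Finset.card_pair (P.twinEdge_ne h).symm]
  simp only [h2] at h
  simp at h
  omega

theorem numT_pos : 0 < P.numT := by
  by_contra h
  have h0 : P.numT = 0 := by omega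
  have hv := P.outward
  have : IsEmpty (Fin P.numT) := by rw [h0]; infer_instance
  simp [Mesh.signedVolume] at hv

theorem numV_pos : 0 < P.numV := (Nat.zero_le _).trans_lt (P.tri ⟨0, P.numT_pos⟩ 0).2

/-- The genus is an integer quotient by two; the additional 1 allows for rounding, so no parity
argument is needed. -/
theorem two_sub_eulerChar_le {g : ℕ} (hg : P.genus ≤ g) : 2 - P.eulerChar ≤ 2 * g + 1 := by
  unfold Mesh.genus at hg
  omega

/-- With `2 E = 3 F`, Euler's formula reads `F = 2 (V - χ)`. The term linear in the genus is
absorbed into the factor because `1 ≤ V`. -/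
theorem numT_le {g : ℕ} (hg : P.genus ≤ g) : P.numT ≤ (2 + 4 * g) * P.numV := by
  have h1 := P.two_sub_eulerChar_le hg
  have h2 := P.two_mul_card_edges
  have h3 := P.numV_pos
  unfold Mesh.eulerChar at h1
  have h4 : (P.numT : ℤ) ≤ 2 * P.numV + 4 * g := by omega
  have h5 : 4 * g ≤ 4 * g * P.numV := Nat.le_mul_of_pos_right _ h3
  have h6 : P.numT ≤ 2 * P.numV + 4 * g := by exact_mod_cast h4
  rw [add_mul]
  omega

/-! ## Chains modulo two -/

local notation "𝔽" => ZMod 2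

/-- The coboundary of a function on the vertices. -/
noncomputable def coboundary : (Fin P.numV → 𝔽) →ₗ[𝔽] ({e // e ∈ P.edges} → 𝔽) :=
  Matrix.mulVecLin (Matrix.of fun e v => if v ∈ e.1 then 1 else 0)

/-- The boundary of a chain of edges. -/
noncomputable def boundaryOne : ({e // e ∈ P.edges} → 𝔽) →ₗ[𝔽] (Fin P.numV → 𝔽) :=
  Matrix.mulVecLin (Matrix.of fun (e : {e // e ∈ P.edges}) v => if v ∈ e.1 then (1 : 𝔽) else 0)ᵀ

/-- The boundary of a chain of triangles. -/
noncomputable def boundaryTwo : (Fin P.numT → 𝔽) →ₗ[𝔽] ({e // e ∈ P.edges} → 𝔽) where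
  toFun τ e := ∑ h ∈ Finset.univ.filter (fun h => P.edgeOf h = e), τ h.1
  map_add' a b := by ext e; simp [Finset.sum_add_distrib]
  map_smul' c a := by ext e; simp [Finset.mul_sum]

theorem coboundary_edgeOf (φ : Fin P.numV → 𝔽) (h : P.HalfEdge) :
    P.coboundary φ (P.edgeOf h) = φ (P.src h.1 h.2) + φ (P.dst h.1 h.2) := by
  simp only [coboundary, mulVecLin_apply, mulVec, dotProduct, of_apply, edgeOf, Sym2.mem_iff,
    ite_mul, one_mul, zero_mul]
  rw [← Finset.sum_filter, show (Finset.univ.filter fun v => v = P.src h.1 h.2 ∨ v = P.dst h.1 h.2) =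
    {P.src h.1 h.2, P.dst h.1 h.2} by ext; simp, Finset.sum_pair (P.src_ne_dst h)]

theorem boundaryTwo_edgeOf (τ : Fin P.numT → 𝔽) (h : P.HalfEdge) :
    P.boundaryTwo τ (P.edgeOf h) = τ h.1 + τ (P.twinEdge h).1 := by
  simp only [boundaryTwo, LinearMap.coe_mk, AddHom.coe_mk]
  rw [filter_edgeOf, Finset.sum_pair (P.twinEdge_ne h).symm]

theorem boundaryOne_eq_zero_iff (c : {e // e ∈ P.edges} → 𝔽) :
    P.boundaryOne c = 0 ↔ ∀ φ, ∑ e, c e * P.coboundary φ e = 0 := by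
  have key : ∀ φ, ∑ e, c e * P.coboundary φ e = P.boundaryOne c ⬝ᵥ φ := by
    intro φ
    change c ⬝ᵥ P.coboundary φ = _
    simp only [coboundary, boundaryOne, mulVecLin_apply]
    rw [dotProduct_mulVec, ← mulVec_transpose]
  simp only [key]
  constructor
  · intro h φ; simp [h]
  · intro h; exact dotProduct_eq_zero_iff.1 h

theorem add_self_zmod (a : 𝔽) : a + a = 0 := CharTwo.add_self_eq_zero a

theorem eq_of_add_eq_zero {a b : 𝔽} (h : a + b = 0) : a = b := CharTwo.add_eq_zero.1 h

theorem sum_triangle (φ : Fin P.numV → 𝔽) (t : Fin P.numT) :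
    ∑ i, (φ (P.src t i) + φ (P.dst t i)) = 0 := by
  simp only [Mesh.src, Mesh.dst, Fin.sum_univ_three]
  have := add_self_zmod (φ (P.tri t 0) + φ (P.tri t 1) + φ (P.tri t 2))
  rw [← this, show (0 : Fin 3) + 1 = 1 from rfl, show (1 : Fin 3) + 1 = 2 from rfl,
    show (2 : Fin 3) + 1 = 0 from rfl]
  ring

theorem range_boundaryTwo_le : LinearMap.range P.boundaryTwo ≤ LinearMap.ker P.boundaryOne := by
  rintro _ ⟨τ, rfl⟩
  rw [LinearMap.mem_ker, boundaryOne_eq_zero_iff]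
  intro φ
  simp only [boundaryTwo, LinearMap.coe_mk, AddHom.coe_mk, Finset.sum_mul]
  have : ∀ e, ∑ h ∈ Finset.univ.filter (fun h => P.edgeOf h = e), τ h.1 * P.coboundary φ e =
      ∑ h ∈ Finset.univ.filter (fun h => P.edgeOf h = e),
        τ h.1 * (φ (P.src h.1 h.2) + φ (P.dst h.1 h.2)) := by
    intro e
    refine Finset.sum_congr rfl fun h hh => ?_
    rw [← P.coboundary_edgeOf, (Finset.mem_filter.1 hh).2]
  simp only [this]
  rw [Finset.sum_fiberwise, Fintype.sum_prod_type]
  refine Finset.sum_eq_zero fun t _ => ?_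
  have h0 := congrArg (fun x => τ t * x) (P.sum_triangle φ t)
  rwa [Finset.mul_sum, mul_zero] at h0

/-- For a connected surface this applies both to the coboundary on vertices and to the boundary of
triangle chains: their kernels contain only constants. -/
theorem finrank_ker_le_one {α : Type*} [Finite α] {M : Type*} [AddCommGroup M] [Module 𝔽 M]
    (f : (α → 𝔽) →ₗ[𝔽] M) (h : ∀ τ, f τ = 0 → ∀ a b, τ a = τ b) :
    Module.finrank 𝔽 (LinearMap.ker f) ≤ 1 := by
  classical
  rcases isEmpty_or_nonempty α with hα | ⟨⟨a⟩⟩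
  · have := Module.finrank_zero_of_subsingleton (R := 𝔽) (M := LinearMap.ker f)
    omega
  · by_cases hex : ∃ τ0 : LinearMap.ker f, τ0 ≠ 0
    · obtain ⟨τ0, h0⟩ := hex
      have h1 : τ0.1 a ≠ 0 := by
        intro h1
        apply h0
        ext b
        rw [h _ τ0.2 b a, h1]; rfl
      refine finrank_le_one τ0 fun τ => ⟨τ.1 a * (τ0.1 a)⁻¹, ?_⟩
      ext b
      simp only [SetLike.val_smul, Pi.smul_apply, smul_eq_mul]
      rw [h _ τ0.2 b a, h _ τ.2 b a, mul_assoc, inv_mul_cancel₀ h1, mul_one]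
    · push Not at hex
      have : Subsingleton (LinearMap.ker f) := ⟨fun x y => by rw [hex x, hex y]⟩
      have := Module.finrank_zero_of_subsingleton (R := 𝔽) (M := LinearMap.ker f)
      omega

theorem coboundary_const {φ : Fin P.numV → 𝔽} (h : P.coboundary φ = 0) (u w : Fin P.numV) :
    φ u = φ w := by
  have h1 : ∀ t i, φ (P.tri t i) = φ (P.tri t (i + 1)) := fun t i => by
    have := P.coboundary_edgeOf φ (t, i)
    rw [h] at this
    exact eq_of_add_eq_zero this.symm
  have h2 : ∀ t i, φ (P.tri t i) = φ (P.tri t 0) := by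
    intro t i
    have a := h1 t 0
    have b := h1 t 1
    fin_cases i
    · rfl
    · exact a.symm
    · exact (a.trans b).symm
  have h3 : ∀ t t', φ (P.tri t 0) = φ (P.tri t' 0) := by
    intro t t'
    have := P.connected t t'
    induction this with
    | refl => rfl
    | tail _ h ih =>
      obtain ⟨i, j, e, -⟩ := h
      rw [ih, ← h2 _ i]
      exact (congrArg φ e).trans (h2 _ _)
  obtain ⟨t, i, rfl⟩ := P.vertex_used u
  obtain ⟨t', i', rfl⟩ := P.vertex_used w
  exact (h2 t i).trans ((h3 t t').trans (h2 t' i').symm)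

theorem boundaryTwo_const {τ : Fin P.numT → 𝔽} (h : P.boundaryTwo τ = 0) (t t' : Fin P.numT) :
    τ t = τ t' := by
  have := P.connected t t'
  induction this with
  | refl => rfl
  | @tail b _ _ h' ih =>
    rw [ih]
    obtain ⟨i, rfl⟩ := P.adj_iff.1 h'
    have := P.boundaryTwo_edgeOf τ (b, i)
    rw [h] at this
    exact eq_of_add_eq_zero this.symm

/-- The first homology modulo two has dimension at most `2 - χ`. -/
theorem finrank_cycles_le {n : ℕ} (hn : 2 - P.eulerChar ≤ n) :
    Module.finrank 𝔽 (LinearMap.ker P.boundaryOne) ≤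
      Module.finrank 𝔽 (LinearMap.range P.boundaryTwo) + n := by
  -- The boundary of edge chains has the rank of its transpose, the coboundary, which is at least `V
  -- - 1`; the boundary of triangle chains has rank at least `F - 1`. So cycles exceed boundaries by
  -- at most `E - (V - 1) - (F - 1) = 2 - χ` dimensions.
  have h1 := P.boundaryTwo.finrank_range_add_finrank_ker
  have h2 := finrank_ker_le_one P.boundaryTwo fun τ => P.boundaryTwo_const
  have h3 := P.boundaryOne.finrank_range_add_finrank_ker
  have h4 := P.coboundary.finrank_range_add_finrank_ker
  have h5 := finrank_ker_le_one P.coboundary fun φ => P.coboundary_const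
  have h6 : Module.finrank 𝔽 (LinearMap.range P.boundaryOne) =
      Module.finrank 𝔽 (LinearMap.range P.coboundary) := Matrix.rank_transpose _
  rw [Module.finrank_fintype_fun_eq_card] at h1 h3 h4
  simp only [Fintype.card_fin, Fintype.card_coe] at h1 h3 h4
  unfold Mesh.eulerChar at hn
  omega

end Polyhedron

end Snapping

/-! ### Complete bipartite graphs of facets on a surface of bounded genus. -/

namespace Snapping

open Matrix

namespace Polyhedron

variable (P : Polyhedron)

local notation "𝔽" => ZMod 2

/-! ## Common neighbours of three facets -/

/-- A restriction of the cycles in `Q` has dimension at most `n` more than that of the boundaries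
in `Q`. -/
theorem finrank_map_le {M M' : Type*} [AddCommGroup M] [Module 𝔽 M] [FiniteDimensional 𝔽 M]
    [AddCommGroup M'] [Module 𝔽 M'] (f : M →ₗ[𝔽] M') {Q B Z : Submodule 𝔽 M} (hQ : Q ≤ Z) (hB : B ≤ Z)
    {n : ℕ} (h : Module.finrank 𝔽 Z ≤ Module.finrank 𝔽 B + n) :
    Module.finrank 𝔽 (Q.map f) ≤ Module.finrank 𝔽 ((Q ⊓ B : Submodule 𝔽 M).map f) + n := by
  -- `Q` exceeds `Q ⊓ B` by no more dimensions than `Q ⊔ B` exceeds `B`, hence by at most `n`.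
  -- Applying `f` does not enlarge this gap, since its kernel on `Q ⊓ B` is contained in that on
  -- `Q`.
  have h1 := Submodule.finrank_sup_add_finrank_inf_eq Q B
  have h2 := Submodule.finrank_mono (sup_le hQ hB)
  have rn : ∀ S : Submodule 𝔽 M, Module.finrank 𝔽 (S.map f) +
      Module.finrank 𝔽 (S ⊓ LinearMap.ker f : Submodule 𝔽 M) = Module.finrank 𝔽 S := by
    intro S
    have := (f.domRestrict S).finrank_range_add_finrank_ker
    rw [LinearMap.range_domRestrict] at this
    rw [← this]
    congr 1
    rw [LinearMap.ker_domRestrict]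
    rw [← Submodule.finrank_map_subtype_eq S, Submodule.map_comap_subtype]
  have h3 := rn Q
  have h4 := rn (Q ⊓ B)
  have h5 : Module.finrank 𝔽 (Q ⊓ B ⊓ LinearMap.ker f : Submodule 𝔽 M) ≤
      Module.finrank 𝔽 (Q ⊓ LinearMap.ker f : Submodule 𝔽 M) :=
    Submodule.finrank_mono (inf_le_inf_right _ inf_le_left)
  omega

/-- A nonzero matrix modulo two with even row and column sums has at least four nonzero entries. -/
theorem four_le_card_support {m : ℕ} (r : Fin 3 × Fin m → 𝔽) (hr : r ≠ 0)
    (h1 : ∀ i, ∑ j, r (j, i) = 0) (h2 : ∀ j, ∑ i, r (j, i) = 0) :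
    4 ≤ (Finset.univ.filter fun s => r s ≠ 0).card := by
  classical
  have other : ∀ {α : Type} [Fintype α] [DecidableEq α] (f : α → 𝔽), ∑ a, f a = 0 → ∀ a, f a ≠ 0 →
      ∃ b, b ≠ a ∧ f b ≠ 0 := by
    intro α _ _ f hf a ha
    by_contra! hc
    rw [Finset.sum_eq_single a (fun b _ hb => hc b hb) (by simp)] at hf
    exact ha hf
  -- A nonzero entry has a nonzero partner in its row and one in its column, and the latter again
  -- has a partner in its own row. This says that a complete bipartite graph has no cycle shorter
  -- than four.
  obtain ⟨⟨j, i⟩, hji⟩ := Function.ne_iff.1 hr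
  obtain ⟨i', hi', hji'⟩ := other _ (h2 j) i hji
  obtain ⟨j', hj', hj'i⟩ := other (fun j => r (j, i)) (h1 i) j hji
  obtain ⟨i'', hi'', hj'i''⟩ := other _ (h2 j') i hj'i
  have hsub : ({(j, i), (j, i'), (j', i), (j', i'')} : Finset (Fin 3 × Fin m)) ⊆
      Finset.univ.filter fun s => r s ≠ 0 := by
    intro s hs
    simp only [Finset.mem_insert, Finset.mem_singleton] at hs
    rcases hs with rfl | rfl | rfl | rfl <;> simpa
  refine le_trans (le_of_eq ?_) (Finset.card_le_card hsub)
  rw [Finset.card_insert_of_notMem, Finset.card_insert_of_notMem, Finset.card_insert_of_notMem,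
    Finset.card_singleton]
  · simpa using hi''.symm
  · simp [hj'.symm]
  · simp [hi'.symm, hj'.symm]

section CommonNeighbors

/- The half-edges `ε (j, i)` lead from `m` facets `A i` to three facets `B j`. -/
variable {κ : Type*} {m : ℕ} (fac : Fin P.numT → κ) (A : Fin m → κ) (B : Fin 3 → κ)
  (ε : Fin 3 × Fin m → P.HalfEdge)

/-- The edges that are contracted or belong to the graph formed by the facets `A i` and `B j`. -/
def graphEdges : Set P.HalfEdge :=
  {h | fac h.1 = fac (P.twinEdge h).1 ∨ ∃ s, h = ε s ∨ h = P.twinEdge (ε s)}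

/-- Vertices of the mesh in the same face of that graph. -/
def faceSetoid : Setoid (Fin P.numV) :=
  Relation.EqvGen.setoid fun u w => ∃ h ∉ P.graphEdges fac ε, P.src h.1 h.2 = u ∧ P.dst h.1 h.2 = w

/-- The edges of the graph at the boundary of a set of faces. -/
noncomputable def faceBoundary :
    (Quotient (P.faceSetoid fac ε) → 𝔽) →ₗ[𝔽] (Fin 3 × Fin m → 𝔽) where
  toFun g s := g (Quotient.mk _ (P.src (ε s).1 (ε s).2)) + g (Quotient.mk _ (P.dst (ε s).1 (ε s).2))
  map_add' a b := by ext s; simp only [Pi.add_apply]; ring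
  map_smul' c a := by ext s; simp only [Pi.smul_apply, smul_eq_mul, RingHom.id_apply]; ring

variable (hA : Function.Injective A) (hB : Function.Injective B) (hAB : ∀ i j, A i ≠ B j)
  (hε : ∀ j i, fac (ε (j, i)).1 = A i) (hε' : ∀ j i, fac (P.twinEdge (ε (j, i))).1 = B j)

include hAB hε hε' in
theorem not_interior (s : Fin 3 × Fin m) : fac (ε s).1 ≠ fac (P.twinEdge (ε s)).1 := by
  rw [hε, hε']
  exact hAB _ _

include hA hB hAB hε hε' in
theorem edgeOf_graph_injective : Function.Injective fun s => P.edgeOf (ε s) := by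
  rintro ⟨j, i⟩ ⟨j', i'⟩ h
  rcases P.edgeOf_eq_iff.1 h with h | h
  · have h1 := hε j i
    have h2 := hε' j i
    rw [h, hε] at h1
    rw [h, hε'] at h2
    rw [hA h1, hB h2]
  · have h1 := hε j i
    rw [h, hε'] at h1
    exact absurd h1.symm (hAB _ _)

include hAB hε hε' in
-- Modulo two the differences of `φ` sum to zero around every triangle, hence over all half-edges of
-- the facet. Edges inside the facet cancel in twin pairs, and edges not in the graph contribute
-- nothing because `φ` is constant along them; only the graph edges at the facet remain.
theorem sum_facet (φ : Fin P.numV → 𝔽)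
    (hφ : ∀ h ∉ P.graphEdges fac ε, φ (P.src h.1 h.2) = φ (P.dst h.1 h.2)) (f : κ)
    {α : Type} [Fintype α] (η : α → P.HalfEdge) (hη : Function.Injective η)
    (hf : ∀ h, (∃ a, h = η a) ↔ (fac h.1 = f ∧ ∃ s, h = ε s ∨ h = P.twinEdge (ε s))) :
    ∑ a, (φ (P.src (η a).1 (η a).2) + φ (P.dst (η a).1 (η a).2)) = 0 := by
  classical
  set d : P.HalfEdge → 𝔽 := fun h => φ (P.src h.1 h.2) + φ (P.dst h.1 h.2)
  have h1 : ∑ h ∈ Finset.univ.filter (fun h : P.HalfEdge => fac h.1 = f), d h = 0 := by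
    rw [Finset.sum_filter, Fintype.sum_prod_type]
    refine Finset.sum_eq_zero fun t _ => ?_
    by_cases ht : fac t = f
    · simpa [ht] using P.sum_triangle φ t
    · simp [ht]
  have h2 : ∑ h ∈ Finset.univ.filter (fun h : P.HalfEdge => fac h.1 = f ∧ fac (P.twinEdge h).1 = f),
      d h = 0 := by
    refine Finset.sum_involution (fun h _ => P.twinEdge h) ?_ ?_ ?_ ?_
    · intro h _
      simp only [d, src_twinEdge, dst_twinEdge]
      rw [add_comm (φ (P.dst _ _))]
      exact add_self_zmod _
    · intro h _ _; exact P.twinEdge_ne h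
    · intro h hh
      simp only [Finset.mem_filter, Finset.mem_univ, true_and, twinEdge_twinEdge] at hh ⊢
      exact hh.symm
    · intro h _; exact P.twinEdge_twinEdge h
  have h3 : ∑ h ∈ Finset.univ.filter (fun h : P.HalfEdge => fac h.1 = f ∧ ¬ fac (P.twinEdge h).1 = f),
      d h = 0 := by
    rw [← h1, ← Finset.sum_filter_add_sum_filter_not
      (Finset.univ.filter fun h : P.HalfEdge => fac h.1 = f) (fun h => fac (P.twinEdge h).1 = f),
      Finset.filter_filter, Finset.filter_filter, h2, zero_add]
  rw [← h3, ← Finset.sum_image (s := Finset.univ) (g := η) (f := d) (fun a _ b _ h => hη h)]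
  refine Finset.sum_subset ?_ ?_
  · intro h hh
    obtain ⟨a, -, rfl⟩ := Finset.mem_image.1 hh
    obtain ⟨q1, s, q2⟩ := (hf (η a)).1 ⟨a, rfl⟩
    simp only [Finset.mem_filter, Finset.mem_univ, true_and]
    refine ⟨q1, fun q3 => ?_⟩
    have := P.not_interior fac A B ε hAB hε hε' s
    rcases q2 with q2 | q2
    · rw [← q2, q1, q3] at this; exact this rfl
    · rw [q2] at q1 q3
      rw [twinEdge_twinEdge] at q3
      rw [q1, q3] at this; exact this rfl
  · intro h hh hh'
    simp only [Finset.mem_filter, Finset.mem_univ, true_and] at hh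
    have : h ∉ P.graphEdges fac ε := by
      rintro (hc | hc)
      · exact hh.2 (hc ▸ hh.1)
      · obtain ⟨a, ha⟩ := (hf h).2 ⟨hh.1, hc⟩
        exact hh' (Finset.mem_image.2 ⟨a, Finset.mem_univ _, ha.symm⟩)
    simp only [d]
    rw [hφ h this]
    exact add_self_zmod _

theorem faceBoundary_const (g : Quotient (P.faceSetoid fac ε) → 𝔽) (h : P.HalfEdge)
    (hh : h ∉ P.graphEdges fac ε) :
    g (Quotient.mk _ (P.src h.1 h.2)) = g (Quotient.mk _ (P.dst h.1 h.2)) :=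
  congrArg g (Quotient.sound (.rel _ _ ⟨h, hh, rfl, rfl⟩))

include hA hB hAB hε hε' in
/-- Every face of the graph has at least four edges. -/
theorem four_le_faceBoundary (g : Quotient (P.faceSetoid fac ε) → 𝔽)
    (hg : P.faceBoundary fac ε g ≠ 0) :
    4 ≤ (Finset.univ.filter fun s => P.faceBoundary fac ε g s ≠ 0).card := by
  have hinj := P.edgeOf_graph_injective fac A B ε hA hB hAB hε hε'
  have hc := P.faceBoundary_const fac ε g
  refine four_le_card_support _ hg (fun i => ?_) fun j => ?_
  · refine P.sum_facet fac A B ε hAB hε hε' (fun v => g (Quotient.mk _ v)) hc (A i)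
      (fun j => ε (j, i)) ?_ ?_
    · intro j j' h
      simpa using hinj (congrArg P.edgeOf h)
    · intro h
      constructor
      · rintro ⟨j, rfl⟩
        exact ⟨hε j i, _, .inl rfl⟩
      · rintro ⟨h1, ⟨j, i'⟩, rfl | rfl⟩
        · rw [hε] at h1
          exact ⟨j, by rw [hA h1]⟩
        · rw [hε'] at h1
          exact absurd h1.symm (hAB _ _)
  · have := P.sum_facet fac A B ε hAB hε hε' (fun v => g (Quotient.mk _ v)) hc (B j)
      (fun i => P.twinEdge (ε (j, i))) ?_ ?_
    · rw [← this]
      refine Finset.sum_congr rfl fun i _ => ?_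
      simp only [src_twinEdge, dst_twinEdge]
      exact add_comm _ _
    · intro i i' h
      change P.twinEdge (ε (j, i)) = P.twinEdge (ε (j, i')) at h
      have h' : ε (j, i) = ε (j, i') := by
        rw [← P.twinEdge_twinEdge (ε (j, i)), h, twinEdge_twinEdge]
      simpa using hinj (congrArg P.edgeOf h')
    · intro h
      constructor
      · rintro ⟨i, rfl⟩
        exact ⟨hε' j i, _, .inr rfl⟩
      · rintro ⟨h1, ⟨j', i⟩, rfl | rfl⟩
        · rw [hε] at h1
          exact absurd h1 (hAB _ _)
        · rw [hε'] at h1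
          exact ⟨i, by rw [hB h1]⟩

include hA hB hAB hε hε' in
-- Double counting: the boundaries of single faces span the range, each nonzero one has at least
-- four edges, and every edge lies on at most two faces.
theorem finrank_faceBoundary_le :
    Module.finrank 𝔽 (LinearMap.range (P.faceBoundary fac ε)) * 4 ≤ 3 * m * 2 := by
  classical
  have : Finite (Quotient (P.faceSetoid fac ε)) := Quotient.finite _
  have := Fintype.ofFinite (Quotient (P.faceSetoid fac ε))
  set R := P.faceBoundary fac ε
  set S : Finset (Quotient (P.faceSetoid fac ε)) :=
    Finset.univ.filter fun c => R (Pi.single c 1) ≠ 0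
  have h1 : Module.finrank 𝔽 (LinearMap.range R) ≤ S.card := by
    have : LinearMap.range R ≤ Submodule.span 𝔽 (S.image (fun c : Quotient (P.faceSetoid fac ε) => R (Pi.single c 1 : Quotient (P.faceSetoid fac ε) → 𝔽)) : Finset _) := by
      rintro _ ⟨g, rfl⟩
      rw [LinearMap.pi_apply_eq_sum_univ R g]
      refine Submodule.sum_mem _ fun c _ => Submodule.smul_mem _ _ ?_
      have e : (fun j => if c = j then (1 : 𝔽) else 0) = Pi.single c 1 := by
        ext j; simp [Pi.single_apply, eq_comm]
      rw [e]
      by_cases h0 : R (Pi.single c 1) = 0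
      · rw [h0]; exact Submodule.zero_mem _
      · exact Submodule.subset_span (Finset.mem_coe.2 (Finset.mem_image.2 ⟨c, by simp [S, h0], rfl⟩))
    exact (Submodule.finrank_mono this).trans ((finrank_span_finset_le_card _).trans
      Finset.card_image_le)
  have h2 : S.card * 4 ≤ (Finset.univ : Finset (Fin 3 × Fin m)).card * 2 := by
    refine Finset.card_mul_le_card_mul (fun (c : Quotient (P.faceSetoid fac ε)) s => R (Pi.single c 1 : Quotient (P.faceSetoid fac ε) → 𝔽) s ≠ 0) ?_ ?_
    · intro c hc
      exact P.four_le_faceBoundary fac A B ε hA hB hAB hε hε' _ (Finset.mem_filter.1 hc).2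
    · intro s _
      refine (Finset.card_le_card (t := {Quotient.mk _ (P.src (ε s).1 (ε s).2),
        Quotient.mk _ (P.dst (ε s).1 (ε s).2)}) ?_).trans Finset.card_le_two
      intro c hc
      have hc := (Finset.mem_bipartiteBelow _).1 hc |>.2
      by_contra hcon
      simp only [Finset.mem_insert, Finset.mem_singleton, not_or] at hcon
      apply hc
      change (Pi.single c 1 : Quotient (P.faceSetoid fac ε) → 𝔽) (Quotient.mk _ _) +
        (Pi.single c 1 : Quotient (P.faceSetoid fac ε) → 𝔽) (Quotient.mk _ _) = 0
      rw [Pi.single_eq_of_ne (Ne.symm hcon.1), Pi.single_eq_of_ne (Ne.symm hcon.2), add_zero]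
  simp only [Finset.card_univ, Fintype.card_prod, Fintype.card_fin] at h2
  omega

/-- Evaluation of a chain on the edges of the graph. -/
noncomputable def chainEval : ({e // e ∈ P.edges} → 𝔽) →ₗ[𝔽] Module.Dual 𝔽 (Fin 3 × Fin m → 𝔽) :=
  LinearMap.mk₂ 𝔽 (fun c g => ∑ s, c (P.edgeOf (ε s)) * g s)
    (by intros; simp [add_mul, Finset.sum_add_distrib])
    (by intros; simp [Finset.mul_sum, mul_assoc])
    (by intros; simp [mul_add, Finset.sum_add_distrib])
    (by intros; simp only [Pi.smul_apply, smul_eq_mul, Finset.mul_sum]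
        exact Finset.sum_congr rfl fun _ _ => by ring)

/-- The chains that avoid the edges inside the facets. -/
def outerChains : Submodule 𝔽 ({e // e ∈ P.edges} → 𝔽) where
  carrier := {c | ∀ h : P.HalfEdge, fac h.1 = fac (P.twinEdge h).1 → c (P.edgeOf h) = 0}
  add_mem' ha hb h hh := by simp [ha h hh, hb h hh]
  zero_mem' _ _ := rfl
  smul_mem' c a ha h hh := by simp [ha h hh]

include hA hB hAB hε hε' in
-- A functional that vanishes on all face boundaries is realised by a cycle of the mesh: its values
-- are kept on the graph edges and completed on edges outside the graph, never using edges inside a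
-- facet.
theorem dualAnnihilator_le : (LinearMap.range (P.faceBoundary fac ε)).dualAnnihilator ≤
    (LinearMap.ker P.boundaryOne ⊓ P.outerChains fac).map (P.chainEval ε) := by
  classical
  intro L hL
  have hinj := P.edgeOf_graph_injective fac A B ε hA hB hAB hε hε'
  rw [Submodule.mem_dualAnnihilator] at hL
  set r : (Fin P.numV → 𝔽) →ₗ[𝔽] (Fin 3 × Fin m → 𝔽) :=
    LinearMap.pi fun s => (LinearMap.proj (R := 𝔽) (φ := fun _ => 𝔽) (P.src (ε s).1 (ε s).2) +
      LinearMap.proj (R := 𝔽) (φ := fun _ => 𝔽) (P.dst (ε s).1 (ε s).2))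
  set δ : (Fin P.numV → 𝔽) →ₗ[𝔽] ({h // h ∉ P.graphEdges fac ε} → 𝔽) :=
    LinearMap.pi fun h => (LinearMap.proj (R := 𝔽) (φ := fun _ => 𝔽) (P.src h.1.1 h.1.2) +
      LinearMap.proj (R := 𝔽) (φ := fun _ => 𝔽) (P.dst h.1.1 h.1.2))
  have h1 : L ∘ₗ r ∈ (LinearMap.ker δ).dualAnnihilator := by
    rw [Submodule.mem_dualAnnihilator]
    intro φ hφ
    have hφ' : ∀ u w, (P.faceSetoid fac ε) u w → φ u = φ w := by
      intro u w h
      induction h with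
      | rel x y h =>
        obtain ⟨h, hh, rfl, rfl⟩ := h
        exact eq_of_add_eq_zero (congrFun (LinearMap.mem_ker.1 hφ) ⟨h, hh⟩)
      | refl => rfl
      | symm _ _ _ ih => exact ih.symm
      | trans _ _ _ _ _ ih1 ih2 => exact ih1.trans ih2
    exact hL _ ⟨Quotient.lift φ hφ', rfl⟩
  -- A function with zero differences off the graph is constant on faces, so `L ∘ r` vanishes on the
  -- kernel of `δ` and factors as `μ ∘ δ`. The values of `μ` on the other edges are what closes the
  -- chain to a cycle.
  rw [← LinearMap.range_dualMap_eq_dualAnnihilator_ker] at h1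
  obtain ⟨μ, hμ⟩ := h1
  set c : {e // e ∈ P.edges} → 𝔽 :=
    ∑ h : {h // h ∉ P.graphEdges fac ε}, Pi.single (P.edgeOf h.1) (μ (Pi.single h 1)) +
    ∑ s, Pi.single (P.edgeOf (ε s)) (L (Pi.single s 1)) with hc
  have hcv : ∀ e, c e = ∑ h : {h // h ∉ P.graphEdges fac ε},
      (Pi.single (P.edgeOf h.1) (μ (Pi.single h 1)) : {e // e ∈ P.edges} → 𝔽) e +
      ∑ s, (Pi.single (P.edgeOf (ε s)) (L (Pi.single s 1)) : {e // e ∈ P.edges} → 𝔽) e := fun e => by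
    simp [hc, Finset.sum_apply]
  have hnon : ∀ h : {h // h ∉ P.graphEdges fac ε}, ∀ h', P.edgeOf h' = P.edgeOf h.1 →
      h' ∉ P.graphEdges fac ε := by
    rintro ⟨h, hh⟩ h' he hh'
    rcases P.edgeOf_eq_iff.1 he with rfl | rfl
    · exact hh hh'
    · apply hh
      rcases hh' with hh' | ⟨s, hh' | hh'⟩
      · rw [twinEdge_twinEdge] at hh'
        exact .inl hh'.symm
      · exact .inr ⟨s, .inr (by rw [← hh', twinEdge_twinEdge])⟩
      · exact .inr ⟨s, .inl (by rw [← P.twinEdge_twinEdge h, hh', twinEdge_twinEdge])⟩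
  have sumL : ∀ {α : Type} [Fintype α] [DecidableEq α] (F : (α → 𝔽) →ₗ[𝔽] 𝔽) (g : α → 𝔽),
      F g = ∑ a, F (Pi.single a 1) * g a := by
    intro α _ _ F g
    rw [LinearMap.pi_apply_eq_sum_univ F g]
    refine Finset.sum_congr rfl fun a _ => ?_
    rw [smul_eq_mul, mul_comm]
    congr 2
    ext j; simp [Pi.single_apply, eq_comm]
  refine ⟨c, ⟨?_, ?_⟩, ?_⟩
  · rw [SetLike.mem_coe, LinearMap.mem_ker, boundaryOne_eq_zero_iff]
    intro φ
    have e1 : ∀ (e0 : {e // e ∈ P.edges}) (x : 𝔽), ∑ e,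
        (Pi.single e0 x : {e // e ∈ P.edges} → 𝔽) e * P.coboundary φ e = x * P.coboundary φ e0 := by
      intro e0 x
      rw [Finset.sum_eq_single e0 (fun e _ he => by rw [Pi.single_eq_of_ne he, zero_mul]) (by simp),
        Pi.single_eq_same]
    simp only [hcv, add_mul, Finset.sum_add_distrib, Finset.sum_mul]
    rw [Finset.sum_comm, Finset.sum_comm (s := Finset.univ) (t := (Finset.univ : Finset (Fin 3 × Fin m)))]
    simp only [e1, coboundary_edgeOf]
    have e2 := LinearMap.congr_fun hμ φ
    rw [LinearMap.dualMap_apply, LinearMap.comp_apply, sumL μ, sumL L] at e2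
    have e3 := add_self_zmod (∑ s, L (Pi.single s 1) * r φ s)
    nth_rewrite 1 [← e2] at e3
    exact e3
  · intro h hh
    rw [hcv, Finset.sum_eq_zero, Finset.sum_eq_zero, add_zero]
    · intro s _
      refine Pi.single_eq_of_ne (fun he => ?_) _
      have := P.not_interior fac A B ε hAB hε hε' s
      rcases P.edgeOf_eq_iff.1 he with rfl | rfl
      · exact this hh
      · rw [twinEdge_twinEdge] at hh
        exact this hh.symm
    · intro h' _
      exact Pi.single_eq_of_ne (fun he => hnon h' h he (.inl hh)) _
  · refine LinearMap.ext fun g => ?_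
    rw [sumL L g]
    change ∑ s, c (P.edgeOf (ε s)) * g s = _
    refine Finset.sum_congr rfl fun s _ => ?_
    congr 1
    rw [hcv, Finset.sum_eq_zero, zero_add, Finset.sum_eq_single s, Pi.single_eq_same]
    · intro s' _ hs'
      exact Pi.single_eq_of_ne (hinj.ne hs'.symm) _
    · simp
    · intro h _
      exact Pi.single_eq_of_ne (fun he => hnon h _ he (.inr ⟨s, .inl rfl⟩)) _

/-- The cuts of the complete bipartite graph. -/
noncomputable def cuts (m : ℕ) : (Fin 3 ⊕ Fin m → 𝔽) →ₗ[𝔽] Module.Dual 𝔽 (Fin 3 × Fin m → 𝔽) :=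
  LinearMap.mk₂ 𝔽 (fun τ g => ∑ s, (τ (.inl s.1) + τ (.inr s.2)) * g s)
    (by intros; simp only [Pi.add_apply, ← Finset.sum_add_distrib]
        exact Finset.sum_congr rfl fun _ _ => by ring)
    (by intros; simp only [Pi.smul_apply, smul_eq_mul, Finset.mul_sum]
        exact Finset.sum_congr rfl fun _ _ => by ring)
    (by intros; simp [mul_add, Finset.sum_add_distrib])
    (by intros; simp only [Pi.smul_apply, smul_eq_mul, Finset.mul_sum]
        exact Finset.sum_congr rfl fun _ _ => by ring)

include hε hε' in
-- If the boundary of `τ` avoids the edges inside facets, `τ` is constant on every facet. On a graph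
-- edge the boundary is then the sum of the values at its two end facets.
theorem boundaries_le_cuts
    (hfac : ∀ τ : Fin P.numT → 𝔽,
      (∀ h : P.HalfEdge, fac h.1 = fac (P.twinEdge h).1 → τ h.1 = τ (P.twinEdge h).1) →
      ∀ t t', fac t = fac t' → τ t = τ t') :
    (LinearMap.ker P.boundaryOne ⊓ P.outerChains fac ⊓ LinearMap.range P.boundaryTwo).map
      (P.chainEval ε) ≤ LinearMap.range (cuts m) := by
  classical
  rintro _ ⟨_, ⟨⟨-, h1⟩, τ, rfl⟩, rfl⟩
  have h2 := hfac τ fun h hh => by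
    have := h1 h hh
    rw [boundaryTwo_edgeOf] at this
    exact eq_of_add_eq_zero this
  set val : κ → 𝔽 := fun f => if hf : ∃ t, fac t = f then τ hf.choose else 0
  have hval : ∀ t, val (fac t) = τ t := by
    intro t
    have hf : ∃ t', fac t' = fac t := ⟨t, rfl⟩
    simp only [val, dif_pos hf]
    exact h2 _ _ hf.choose_spec
  refine ⟨Sum.elim (fun j => val (B j)) fun i => val (A i), LinearMap.ext fun g => ?_⟩
  change ∑ s : Fin 3 × Fin m, _ * _ = ∑ s, P.boundaryTwo τ (P.edgeOf (ε s)) * g s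
  refine Finset.sum_congr rfl fun s _ => ?_
  rw [boundaryTwo_edgeOf, ← hval, ← hval, hε, hε', Sum.elim_inl, Sum.elim_inr, add_comm]

include hA hB hAB hε hε' in
-- The annihilator of the face boundaries has dimension at least `3m - 3m/2`. It embeds into
-- restricted cycles, which exceed the restricted boundaries by at most `n`, and those lie in the
-- cut space of dimension at most `m + 3`. So `3m/2 ≤ m + 3 + n`.
theorem common_le {n : ℕ} (hn : 2 - P.eulerChar ≤ n)
    (hfac : ∀ τ : Fin P.numT → 𝔽,
      (∀ h : P.HalfEdge, fac h.1 = fac (P.twinEdge h).1 → τ h.1 = τ (P.twinEdge h).1) →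
      ∀ t t', fac t = fac t' → τ t = τ t') : m ≤ 6 + 2 * n := by
  have h1 := P.finrank_faceBoundary_le fac A B ε hA hB hAB hε hε'
  have h2 := Subspace.finrank_add_finrank_dualAnnihilator_eq
    (LinearMap.range (P.faceBoundary fac ε))
  have h3 := Submodule.finrank_mono (P.dualAnnihilator_le fac A B ε hA hB hAB hε hε')
  have h4 := finrank_map_le (P.chainEval ε)
    (Q := LinearMap.ker P.boundaryOne ⊓ P.outerChains fac) inf_le_left P.range_boundaryTwo_le
    (P.finrank_cycles_le hn)
  have h5 := Submodule.finrank_mono (P.boundaries_le_cuts fac A B ε hε hε' hfac)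
  have h6 := LinearMap.finrank_range_le (cuts m)
  rw [Module.finrank_fintype_fun_eq_card] at h2 h6
  simp only [Fintype.card_prod, Fintype.card_sum, Fintype.card_fin] at h2 h6
  omega

end CommonNeighbors

/-- Three facets have a bounded number of common neighbours. -/
theorem card_common_neighbors_le {g : ℕ} (hg : P.genus ≤ g) {f : Fin 3 → P.Facet}
    (hf : Function.Injective f) (S : Finset P.Facet) (hS : ∀ a ∈ S, ∀ j, P.Neighbor a (f j)) :
    S.card ≤ 4 * g + 8 := by
  have hsel : ∀ s : Fin 3 × Fin S.card, ∃ h : P.HalfEdge,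
      P.facetOf h.1 = (S.equivFin.symm s.2).1 ∧ P.facetOf (P.twinEdge h).1 = f s.1 := by
    intro s
    obtain ⟨-, t, t', h1, h2, h3⟩ := hS _ (S.equivFin.symm s.2).2 s.1
    obtain ⟨i, rfl⟩ := P.adj_iff.1 h3
    exact ⟨(t, i), h1, h2⟩
  choose ε hε hε' using hsel
  have := P.common_le P.facetOf (fun i => (S.equivFin.symm i).1) f ε
    (fun i i' h => by simpa using Subtype.ext h) hf
    (fun i j => (hS _ (S.equivFin.symm i).2 j).1) (fun j i => hε (j, i)) (fun j i => hε' (j, i))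
    (n := 2 * g + 1) (by exact_mod_cast P.two_sub_eulerChar_le hg) ?_
  · omega
  · intro τ hτ t t' h
    have h' : Relation.EqvGen (fun t t' => P.Adj t t' ∧ SameRay ℝ (P.normal t) (P.normal t')) t t' :=
      Quotient.exact h
    clear h
    induction h' with
    | rel x y h =>
      obtain ⟨i, rfl⟩ := P.adj_iff.1 h.1
      exact hτ (x, i) (Quotient.sound (.rel _ _ h))
    | refl => rfl
    | symm _ _ _ ih => exact ih.symm
    | trans _ _ _ _ _ ih1 ih2 => exact ih1.trans ih2

end Polyhedron

end Snapping

/-! ### Minimal fixtures as irredundant covers. -/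

namespace Snapping

open Matrix

/-! ## Fixtures and candidates -/

/-- A choice of one normal vector for every facet. -/
def Polyhedron.NormalField (P : Polyhedron) (ν : P.Facet → Fin 3 → ℝ) : Prop :=
  ∀ f, ∃ t, P.facetOf t = f ∧ ν f = P.normal t

/-- A finger that may be attached to the palm `p`. -/
structure Polyhedron.Finger (P : Polyhedron) (p : P.Facet) (F : P.Facet × P.Facet) : Prop where
  body : P.Neighbor p F.1
  tip : P.Neighbor F.1 F.2
  ne : F.2 ≠ p

variable {P : Polyhedron} {ν : P.Facet → Fin 3 → ℝ}

namespace Polyhedron.NormalField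

theorem ne_zero (hν : P.NormalField ν) (f : P.Facet) : ν f ≠ 0 := by
  obtain ⟨t, -, h⟩ := hν f
  rw [h]
  exact P.normal_ne_zero t

theorem mem_hemisphere (hν : P.NormalField ν) {f : P.Facet} {v : Fin 3 → ℝ} :
    v ∈ P.hemisphere f ↔ v ∈ unitSphere ∧ 0 < v ⬝ᵥ ν f := by
  obtain ⟨t, rfl, h⟩ := hν f
  rw [h]
  exact P.mem_hemisphere

theorem cross_ne_zero (hν : P.NormalField ν) {f f' : P.Facet} (h : P.Neighbor f f') :
    ν f ⨯₃ ν f' ≠ 0 := by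
  obtain ⟨hne, t, t', rfl, rfl, hadj⟩ := h
  obtain ⟨x, hx, hx'⟩ := hν (P.facetOf t)
  obtain ⟨y, hy, hy'⟩ := hν (P.facetOf t')
  rw [hx', hy']
  have h0 := P.cross_normal_ne_zero hadj hne
  obtain ⟨a, ha, e⟩ := (P.sameRay_normal hx).exists_pos_left (P.normal_ne_zero _) (P.normal_ne_zero _)
  obtain ⟨b, hb, e'⟩ := (P.sameRay_normal hy).exists_pos_left (P.normal_ne_zero _) (P.normal_ne_zero _)
  rw [← e, ← e', map_smul, map_smul, LinearMap.smul_apply] at h0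
  exact fun h => h0 (by rw [h, smul_zero, smul_zero])

/-- Some facets cover the sphere when every direction is blocked by one of them. -/
theorem cover_iff (hν : P.NormalField ν) (A : Set P.Facet) :
    unitSphere = (⋃ f ∈ A, P.hemisphere f) ↔
      ∀ w : Fin 3 → ℝ, (∀ f ∈ A, w ⬝ᵥ ν f ≤ 0) → w = 0 := by
  constructor
  · intro h w hw
    by_contra h0
    have hpos := dot_pos_of_ne_zero h0
    have hs : (Real.sqrt (w ⬝ᵥ w))⁻¹ • w ∈ unitSphere := by
      have := Real.mul_self_sqrt hpos.le
      have h' := (Real.sqrt_pos.2 hpos).ne'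
      simp only [unitSphere, Set.mem_ofPred_eq, smul_dotProduct, dotProduct_smul, smul_eq_mul]
      field_simp
      linarith
    rw [h] at hs
    simp only [Set.mem_iUnion] at hs
    obtain ⟨f, hf, hs⟩ := hs
    have h1 := (hν.mem_hemisphere.1 hs).2
    rw [smul_dotProduct, smul_eq_mul] at h1
    have := hw f hf
    have h2 := inv_pos.2 (Real.sqrt_pos.2 hpos)
    nlinarith
  · intro h
    apply Set.Subset.antisymm
    · intro v hv
      by_contra hcon
      simp only [Set.mem_iUnion, not_exists, hν.mem_hemisphere, not_and, not_lt] at hcon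
      have := h v fun f hf => hcon f hf hv
      rw [this] at hv
      simp [unitSphere] at hv
    · refine Set.iUnion₂_subset fun f _ v hv => (hν.mem_hemisphere.1 hv).1

end Polyhedron.NormalField

/-- A valid fixture with `K` fingers, these given as a list that is filled up with copies of the
first one. -/
structure Candidate (ν : P.Facet → Fin 3 → ℝ) (K : ℕ) (p : P.Facet) (F : Fin 4 → P.Facet × P.Facet) :
    Prop where
  finger : ∀ j, P.Finger p (F j)
  inj : ∀ i j : Fin 4, i < K → j < K → (F i).1 = (F j).1 → i = j
  cover : ∀ w : Fin 3 → ℝ, w ⬝ᵥ ν p ≤ 0 → (∀ j, w ⬝ᵥ ν (F j).1 ≤ 0) → (∀ j, w ⬝ᵥ ν (F j).2 ≤ 0) →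
    w = 0
  free : ∃ w : Fin 3 → ℝ, w ≠ 0 ∧ w ⬝ᵥ ν p ≤ 0 ∧ ∀ j, w ⬝ᵥ ν (F j).1 ≤ 0

/-- The entries from the `K`-th on are copies of the first one. -/
def Padded {α : Type*} (K : ℕ) (F : Fin 4 → α) : Prop := ∀ j : Fin 4, K ≤ j → F j = F 0

theorem Candidate.exists_fixture (hν : P.NormalField ν) {K : ℕ} {p : P.Facet}
    {F : Fin 4 → P.Facet × P.Facet} (h : Candidate ν K p F) (hp : Padded K F) (hK : 0 < K)
    (hK' : K ≤ 4) :
    ∃ G : Fixture P, G.Valid ∧ G.fingers.card = K ∧ G.palm = p ∧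
      ∀ A, A ∈ G.fingers ↔ ∃ i : Fin 4, i < K ∧ F i = A := by
  classical
  have hall : ∀ j, ∃ i : Fin 4, i < K ∧ F i = F j := by
    intro j
    rcases lt_or_ge (j : ℕ) K with hj | hj
    · exact ⟨j, hj, rfl⟩
    · exact ⟨0, hK, (hp j hj).symm⟩
  set S : Finset (P.Facet × P.Facet) := (Finset.univ.filter fun i : Fin 4 => (i : ℕ) < K).image F
  have hS : ∀ A, A ∈ S ↔ ∃ i : Fin 4, i < K ∧ F i = A := by simp [S]
  refine ⟨⟨p, S, ?_, ?_, ?_, ?_⟩, ⟨?_, ?_⟩, ?_, rfl, hS⟩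
  · intro A hA; obtain ⟨i, -, rfl⟩ := (hS A).1 hA; exact (h.finger i).body
  · intro A hA; obtain ⟨i, -, rfl⟩ := (hS A).1 hA; exact (h.finger i).tip
  · intro A hA; obtain ⟨i, -, rfl⟩ := (hS A).1 hA; exact (h.finger i).ne
  · intro A hA B hB e
    obtain ⟨i, hi, rfl⟩ := (hS A).1 hA
    obtain ⟨j, hj, rfl⟩ := (hS B).1 hB
    rw [h.inj i j hi hj e]
  · rw [hν.cover_iff]
    have hm : ∀ j, F j ∈ S := fun j => (hS _).2 (hall j)
    exact fun w hw => h.cover w (hw _ (.inl (.inl rfl))) (fun j => hw _ (.inl (.inr ⟨_, hm j, rfl⟩)))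
      fun j => hw _ (.inr ⟨_, hm j, rfl⟩)
  · rw [Ne, hν.cover_iff]
    obtain ⟨w, hw, h1, h2⟩ := h.free
    refine fun hc => hw (hc w ?_)
    rintro f (rfl | ⟨A, hA, rfl⟩)
    · exact h1
    · obtain ⟨j, -, rfl⟩ := (hS A).1 hA
      exact h2 j
  · change S.card = K
    rw [Finset.card_image_of_injOn]
    · interval_cases K <;> decide
    · intro i hi j hj e
      exact h.inj i j (by simpa using hi) (by simpa using hj) (by rw [e])

theorem Fixture.Valid.card_pos {G : Fixture P} (h : G.Valid) : 0 < G.fingers.card := by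
  rw [Finset.card_pos, Finset.nonempty_iff_ne_empty]
  intro h0
  refine h.2 (h.1.trans ?_)
  have : G.allFacets = G.palmBodies := by
    ext f; simp [Fixture.allFacets, h0]
  rw [this]

/-- Filling up with copies of the first finger changes none of the sets of facets, so a single test
with four slots serves all numbers of fingers. -/
theorem Fixture.Valid.exists_candidate (hν : P.NormalField ν) {G : Fixture P} (h : G.Valid)
    (h4 : G.fingers.card ≤ 4) :
    ∃ F : Fin 4 → P.Facet × P.Facet, Candidate ν G.fingers.card G.palm F ∧
      Padded G.fingers.card F ∧ (∀ i, F i ∈ G.fingers) ∧ ∀ A ∈ G.fingers, ∃ i, F i = A := by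
  classical
  have hpos := h.card_pos
  set e := G.fingers.equivFin
  set F : Fin 4 → P.Facet × P.Facet := fun j =>
    if hj : (j : ℕ) < G.fingers.card then (e.symm ⟨j, hj⟩).1 else (e.symm ⟨0, hpos⟩).1
  have hF : ∀ i : Fin 4, ∀ hi : (i : ℕ) < G.fingers.card, F i = (e.symm ⟨i, hi⟩).1 := fun i hi => by
    simp [F, hi]
  have hm : ∀ j, F j ∈ G.fingers := by
    intro j
    by_cases hj : (j : ℕ) < G.fingers.card <;> simp [F, hj]
  have hsurj : ∀ A ∈ G.fingers, ∃ i, F i = A := by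
    intro A hA
    refine ⟨⟨e ⟨A, hA⟩, (e ⟨A, hA⟩).2.trans_le h4⟩, ?_⟩
    rw [hF _ (e ⟨A, hA⟩).2]
    simp
  refine ⟨F, ⟨fun j => ⟨G.body_neighbor _ (hm j), G.tip_neighbor _ (hm j), G.tip_ne_palm _ (hm j)⟩,
    ?_, ?_, ?_⟩, ?_, hm, hsurj⟩
  · intro i j hi hj hij
    have h1 := G.bodies_distinct _ (hm i) _ (hm j) hij
    rw [hF i hi, hF j hj] at h1
    have h2 := e.symm.injective (Subtype.ext h1)
    simpa [Fin.ext_iff] using h2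
  · intro w h1 h2 h3
    refine (hν.cover_iff _).1 h.1 w ?_
    rintro f ((rfl | ⟨A, hA, rfl⟩) | ⟨A, hA, rfl⟩)
    · exact h1
    · obtain ⟨i, rfl⟩ := hsurj A hA; exact h2 i
    · obtain ⟨i, rfl⟩ := hsurj A hA; exact h3 i
  · have := h.2
    rw [Ne, hν.cover_iff] at this
    push Not at this
    obtain ⟨w, h1, h2⟩ := this
    exact ⟨w, h2, h1 _ (.inl rfl), fun j => h1 _ (.inr ⟨_, hm j, rfl⟩)⟩
  · intro j hj
    simp [F, hj.not_gt, hpos]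

/-- In a valid fixture with the minimal number of fingers no finger can be dropped. -/
theorem Fixture.Valid.irredundant (hν : P.NormalField ν) {G : Fixture P} (h : G.Valid)
    (hmin : ∀ G' : Fixture P, G'.Valid → G.fingers.card ≤ G'.fingers.card) {ι : Type*}
    (F : ι → P.Facet × P.Facet) (hF : Function.Injective F) (hm : ∀ i, F i ∈ G.fingers)
    (hsurj : ∀ A ∈ G.fingers, ∃ i, F i = A) :
    ∃ v, Irredundant (fun i => {ν (F i).1, ν (F i).2}) (ν G.palm) v := by
  classical
  have cover : ∀ z : Fin 3 → ℝ, z ⬝ᵥ ν G.palm ≤ 0 →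
      (∀ i, ∀ x ∈ ({ν (F i).1, ν (F i).2} : Set _), z ⬝ᵥ x ≤ 0) → z = 0 := by
    intro z h1 h2
    refine (hν.cover_iff _).1 h.1 z ?_
    rintro f ((rfl | ⟨A, hA, rfl⟩) | ⟨A, hA, rfl⟩)
    · exact h1
    · obtain ⟨i, rfl⟩ := hsurj A hA; exact h2 i _ (.inl rfl)
    · obtain ⟨i, rfl⟩ := hsurj A hA; exact h2 i _ (.inr rfl)
  have key : ∀ i, ∃ w : Fin 3 → ℝ, w ≠ 0 ∧ w ⬝ᵥ ν G.palm ≤ 0 ∧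
      ∀ j, i ≠ j → ∀ x ∈ ({ν (F j).1, ν (F j).2} : Set _), w ⬝ᵥ x ≤ 0 := by
    intro i
    let G' : Fixture P :=
      ⟨G.palm, G.fingers.erase (F i), fun A hA => G.body_neighbor A (Finset.mem_of_mem_erase hA),
        fun A hA => G.tip_neighbor A (Finset.mem_of_mem_erase hA),
        fun A hA => G.tip_ne_palm A (Finset.mem_of_mem_erase hA),
        fun A hA B hB => G.bodies_distinct A (Finset.mem_of_mem_erase hA) B
          (Finset.mem_of_mem_erase hB)⟩
    have hG' : ¬ G'.Valid := fun hv => by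
      have := hmin G' hv
      have h2 := Finset.card_erase_lt_of_mem (hm i)
      exact absurd this (not_le.2 h2)
    -- With fewer bodies the sphere stays uncovered, so minimality can only be violated by the full
    -- cover; its failure supplies the direction `w`.
    have hfree : unitSphere ≠ ⋃ f ∈ G'.palmBodies, P.hemisphere f := by
      have := h.2
      rw [Ne, hν.cover_iff] at this ⊢
      refine fun hc => this fun w hw => hc w fun f hf => hw f ?_
      rcases hf with rfl | ⟨A, hA, rfl⟩
      · exact .inl rfl
      · exact .inr ⟨A, Finset.mem_of_mem_erase hA, rfl⟩
    have hnc : ¬ unitSphere = ⋃ f ∈ G'.allFacets, P.hemisphere f := fun hc => hG' ⟨hc, hfree⟩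
    rw [hν.cover_iff] at hnc
    push Not at hnc
    obtain ⟨w, hw, hw0⟩ := hnc
    refine ⟨w, hw0, hw _ (.inl (.inl rfl)), fun j hij x hx => ?_⟩
    have hj : F j ∈ G'.fingers := Finset.mem_erase.2 ⟨fun e => hij (hF e.symm), hm j⟩
    rcases hx with rfl | rfl
    · exact hw _ (.inl (.inr ⟨_, hj, rfl⟩))
    · exact hw _ (.inr ⟨_, hj, rfl⟩)
  choose v hv0 hvp hv using key
  refine ⟨v, fun i j hij x hx => hv i j hij x hx, hvp, fun i => ?_, cover, fun i =>
    ⟨_, .inl rfl, hν.cross_ne_zero (G.body_neighbor _ (hm i))⟩⟩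
  by_contra hcon
  push Not at hcon
  refine hv0 i (cover _ (hvp i) fun j x hx => ?_)
  by_cases hij : i = j
  · subst hij; exact hcon x hx
  · exact hv i j hij x hx

/-- A valid fixture with the minimal number of fingers has at most four of them. -/
theorem Fixture.Valid.card_le_four (hν : P.NormalField ν) {G : Fixture P} (h : G.Valid)
    (hmin : ∀ G' : Fixture P, G'.Valid → G.fingers.card ≤ G'.fingers.card) :
    G.fingers.card ≤ 4 := by
  by_contra! hlt
  obtain ⟨v, hv⟩ := h.irredundant hν hmin (fun F : G.fingers => F.1) Subtype.val_injective
    (fun i => i.2) fun A hA => ⟨⟨A, hA⟩, rfl⟩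
  let e := G.fingers.equivFin
  exact hv.no_five (fun i : Fin 5 => e.symm (Fin.castLE hlt i)) fun i j hij => by
    simpa using hij

end Snapping

/-! ### Recovering a fixture with four fingers from two of them. -/

namespace Snapping

open Matrix

/-! ## Fixtures with four fingers -/

variable {P : Polyhedron} {ν : P.Facet → Fin 3 → ℝ}

/-- Since `u` and `a` are orthogonal, `u` and `u × a` form an orthogonal basis of the complement of
`a`. -/
theorem exists_smul_add_cross {u a w : Fin 3 → ℝ} (hu : u ≠ 0) (ha : a ≠ 0) (hua : u ⬝ᵥ a = 0)
    (hw : w ⬝ᵥ a = 0) : ∃ s β : ℝ, w = s • u + β • (u ⨯₃ a) := by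
  have h0 := (dot_pos_of_ne_zero hu).ne'
  obtain ⟨β, hβ⟩ := exists_smul_cross (w := w - ((w ⬝ᵥ u) / (u ⬝ᵥ u)) • u)
    (cross_ne_zero_of_dot hu ha hua) (by
      rw [sub_dotProduct, smul_dotProduct, smul_eq_mul, div_mul_cancel₀ _ h0, sub_self])
    (by rw [sub_dotProduct, smul_dotProduct, hw, hua, smul_zero, sub_self])
  exact ⟨_, β, by rw [← hβ]; abel⟩

/-- A body `b` on the positive side leaves `s u + z` free exactly when `s` is at most the slope `-(z
· b) / (u · b)`. So a body of larger slope can replace one of smaller slope, whatever `s` is. -/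
theorem polar_of_slope_le {u z b b' : Fin 3 → ℝ} {s : ℝ} (h : (s • u + z) ⬝ᵥ b ≤ 0)
    (hb : 0 < u ⬝ᵥ b) (hb' : 0 < u ⬝ᵥ b')
    (hle : -(z ⬝ᵥ b) / (u ⬝ᵥ b) ≤ -(z ⬝ᵥ b') / (u ⬝ᵥ b')) : (s • u + z) ⬝ᵥ b' ≤ 0 := by
  rw [add_dotProduct, smul_dotProduct, smul_eq_mul] at h ⊢
  have h1 : s ≤ -(z ⬝ᵥ b) / (u ⬝ᵥ b) := by rw [le_div_iff₀ hb]; linarith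
  have h2 := h1.trans hle
  rw [le_div_iff₀ hb'] at h2
  linarith

/-- The directions in which an uncovered direction may deviate from the axis `u`. -/
def scanDirections (u a b : Fin 3 → ℝ) : Fin 4 → Fin 3 → ℝ := ![u ⨯₃ a, a ⨯₃ u, u ⨯₃ b, b ⨯₃ u]

/-- A finger whose body is parallel to `u` and whose tip is on the positive side; its body is not
that of `A`. -/
structure TipSide (ν : P.Facet → Fin 3 → ℝ) (p : P.Facet) (A : P.Facet × P.Facet) (u : Fin 3 → ℝ)
    (F : P.Facet × P.Facet) : Prop where
  finger : P.Finger p F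
  ne : F.1 ≠ A.1
  body : u ⬝ᵥ ν F.1 = 0
  tip : 0 < u ⬝ᵥ ν F.2

/-- The result of the search for fingers on the positive side of `u`: fingers `c i` with extremal
slopes with respect to the directions `z i`, and three fingers `r i` with different bodies parallel
to `u`. -/
structure HalfScan (ν : P.Facet → Fin 3 → ℝ) (p : P.Facet) (A : P.Facet × P.Facet) (u : Fin 3 → ℝ)
    (z : Fin 4 → Fin 3 → ℝ) (c : Fin 4 → P.Facet × P.Facet) (r : Fin 3 → P.Facet × P.Facet) :
    Prop where
  slope : ∀ i F, P.Finger p F → 0 < u ⬝ᵥ ν F.1 → P.Finger p (c i) ∧ 0 < u ⬝ᵥ ν (c i).1 ∧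
    -(z i ⬝ᵥ ν F.1) / (u ⬝ᵥ ν F.1) ≤ -(z i ⬝ᵥ ν (c i).1) / (u ⬝ᵥ ν (c i).1)
  rep : ∀ i F, TipSide ν p A u F → (∀ j < i, (r j).1 ≠ F.1) →
    TipSide ν p A u (r i) ∧ ∀ j < i, (r j).1 ≠ (r i).1

namespace HalfScan

variable {p : P.Facet} {A : P.Facet × P.Facet} {u : Fin 3 → ℝ} {z : Fin 4 → Fin 3 → ℝ}
  {c : Fin 4 → P.Facet × P.Facet} {r : Fin 3 → P.Facet × P.Facet}

/-- Three representatives with different bodies cannot all be spoilt by two forbidden bodies. If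
fewer were found, the body of `F` itself is among them, and it is allowed. -/
theorem exists_rep (h : HalfScan ν p A u z c r) {F : P.Facet × P.Facet} (hF : TipSide ν p A u F)
    {x y : P.Facet} (hx : F.1 ≠ x) (hy : F.1 ≠ y) :
    ∃ i, TipSide ν p A u (r i) ∧ (r i).1 ≠ x ∧ (r i).1 ≠ y := by
  by_contra! hcon
  have h0 := h.rep 0 F hF (by simp)
  have hn : ∀ i, TipSide ν p A u (r i) → (r i).1 ≠ F.1 := fun i hi e =>
    hy (e ▸ hcon i hi (e ▸ hx))
  have h1 := h.rep 1 F hF (by simpa [Fin.forall_fin_succ] using hn 0 h0.1)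
  have h2 := h.rep 2 F hF (by
    simpa [Fin.forall_fin_succ] using ⟨hn 0 h0.1, hn 1 h1.1⟩)
  have d01 := h1.2 0 (by simp)
  have d02 := h2.2 0 (by simp)
  have d12 := h2.2 1 (by decide)
  have c0 := hcon 0 h0.1
  have c1 := hcon 1 h1.1
  have c2 := hcon 2 h2.1
  by_cases e0 : (r 0).1 = x
  · have e1 : (r 1).1 ≠ x := fun e => d01 (e0.trans e.symm)
    have e2 : (r 2).1 ≠ x := fun e => d02 (e0.trans e.symm)
    exact d12 ((c1 e1).trans (c2 e2).symm)
  · by_cases e1 : (r 1).1 = x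
    · have e2 : (r 2).1 ≠ x := fun e => d12 (e1.trans e.symm)
      exact d02 ((c0 e0).trans (c2 e2).symm)
    · exact d01 ((c0 e0).trans (c1 e1).symm)

end HalfScan

/-- Four fingers, two of which together with the palm span the plane orthogonal to `u`, and the
others of which are on the two sides of this plane. -/
structure Sided (ν : P.Facet → Fin 3 → ℝ) (p : P.Facet) (u : Fin 3 → ℝ)
    (A₁ A₂ A₃ A₄ : P.Facet × P.Facet) : Prop where
  finger₁ : P.Finger p A₁
  finger₂ : P.Finger p A₂
  finger₃ : P.Finger p A₃
  finger₄ : P.Finger p A₄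
  ne₁₂ : A₁.1 ≠ A₂.1
  ne₁₃ : A₁.1 ≠ A₃.1
  ne₁₄ : A₁.1 ≠ A₄.1
  ne₂₃ : A₂.1 ≠ A₃.1
  ne₂₄ : A₂.1 ≠ A₄.1
  ne₃₄ : A₃.1 ≠ A₄.1
  palm : u ⬝ᵥ ν p = 0
  body₃ : u ⬝ᵥ ν A₃.1 = 0
  body₄ : u ⬝ᵥ ν A₄.1 = 0
  spans : ∀ w : Fin 3 → ℝ, w ⬝ᵥ ν p ≤ 0 → w ⬝ᵥ ν A₃.1 ≤ 0 → w ⬝ᵥ ν A₃.2 ≤ 0 →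
    w ⬝ᵥ ν A₄.1 ≤ 0 → w ⬝ᵥ ν A₄.2 ≤ 0 → ∃ s : ℝ, w = s • u
  pos : 0 < u ⬝ᵥ ν A₁.1 ∨ u ⬝ᵥ ν A₁.1 = 0 ∧ 0 < u ⬝ᵥ ν A₁.2
  neg : u ⬝ᵥ ν A₂.1 < 0 ∨ u ⬝ᵥ ν A₂.1 = 0 ∧ u ⬝ᵥ ν A₂.2 < 0

namespace Sided

variable {p : P.Facet} {u : Fin 3 → ℝ} {A₁ A₂ A₃ A₄ : P.Facet × P.Facet}

theorem neg_symm (h : Sided ν p u A₁ A₂ A₃ A₄) : Sided ν p (-u) A₂ A₁ A₃ A₄ where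
  finger₁ := h.finger₂
  finger₂ := h.finger₁
  finger₃ := h.finger₃
  finger₄ := h.finger₄
  ne₁₂ := h.ne₁₂.symm
  ne₁₃ := h.ne₂₃
  ne₁₄ := h.ne₂₄
  ne₂₃ := h.ne₁₃
  ne₂₄ := h.ne₁₄
  ne₃₄ := h.ne₃₄
  palm := by rw [neg_dotProduct, h.palm, neg_zero]
  body₃ := by rw [neg_dotProduct, h.body₃, neg_zero]
  body₄ := by rw [neg_dotProduct, h.body₄, neg_zero]
  spans := fun w h1 h2 h3 h4 h5 => by
    obtain ⟨s, rfl⟩ := h.spans w h1 h2 h3 h4 h5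
    exact ⟨-s, by simp⟩
  pos := by simpa only [neg_dotProduct, neg_pos, neg_eq_zero] using h.neg
  neg := by simpa only [neg_dotProduct, neg_lt_zero, neg_eq_zero] using h.pos

theorem symm (h : Sided ν p u A₁ A₂ A₃ A₄) : Sided ν p u A₁ A₂ A₄ A₃ where
  finger₁ := h.finger₁
  finger₂ := h.finger₂
  finger₃ := h.finger₄
  finger₄ := h.finger₃
  ne₁₂ := h.ne₁₂
  ne₁₃ := h.ne₁₄
  ne₁₄ := h.ne₁₃
  ne₂₃ := h.ne₂₄
  ne₂₄ := h.ne₂₃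
  ne₃₄ := h.ne₃₄.symm
  palm := h.palm
  body₃ := h.body₄
  body₄ := h.body₃
  spans := fun w h1 h2 h3 h4 h5 => h.spans w h1 h4 h5 h2 h3
  pos := h.pos
  neg := h.neg

theorem smul (h : Sided ν p u A₁ A₂ A₃ A₄) {c : ℝ} (hc : 0 < c) : Sided ν p (c • u) A₁ A₂ A₃ A₄ where
  finger₁ := h.finger₁
  finger₂ := h.finger₂
  finger₃ := h.finger₃
  finger₄ := h.finger₄
  ne₁₂ := h.ne₁₂
  ne₁₃ := h.ne₁₃
  ne₁₄ := h.ne₁₄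
  ne₂₃ := h.ne₂₃
  ne₂₄ := h.ne₂₄
  ne₃₄ := h.ne₃₄
  palm := by rw [smul_dotProduct, h.palm, smul_zero]
  body₃ := by rw [smul_dotProduct, h.body₃, smul_zero]
  body₄ := by rw [smul_dotProduct, h.body₄, smul_zero]
  spans := fun w h1 h2 h3 h4 h5 => by
    obtain ⟨s, rfl⟩ := h.spans w h1 h2 h3 h4 h5
    exact ⟨s / c, by rw [smul_smul, div_mul_cancel₀ _ hc.ne']⟩
  pos := by
    simpa only [smul_dotProduct, smul_eq_mul, mul_pos_iff_of_pos_left hc, mul_eq_zero, hc.ne',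
      false_or] using h.pos
  neg := by
    have : ∀ x : ℝ, c * x < 0 ↔ x < 0 := fun x => by
      rw [← neg_pos, ← mul_neg, mul_pos_iff_of_pos_left hc, neg_pos]
    simpa only [smul_dotProduct, smul_eq_mul, this, mul_eq_zero, hc.ne', false_or] using h.neg

/-- An unblocked direction lies on the axis because of the spanning pair, and the fingers on the two
sides exclude either sense. Nothing else about the first two fingers matters for covering, so only
the free direction has to be preserved when they are exchanged. -/
theorem candidate (h : Sided ν p u A₁ A₂ A₃ A₄)
    (hw : ∃ w : Fin 3 → ℝ, w ≠ 0 ∧ w ⬝ᵥ ν p ≤ 0 ∧ w ⬝ᵥ ν A₁.1 ≤ 0 ∧ w ⬝ᵥ ν A₂.1 ≤ 0 ∧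
      w ⬝ᵥ ν A₃.1 ≤ 0 ∧ w ⬝ᵥ ν A₄.1 ≤ 0) : Candidate ν 4 p ![A₁, A₂, A₃, A₄] where
  finger := by
    simpa [Fin.forall_fin_succ] using ⟨h.finger₁, h.finger₂, h.finger₃, h.finger₄⟩
  inj := by
    intro i j _ _ hij
    have := h.ne₁₂; have := h.ne₁₃; have := h.ne₁₄
    have := h.ne₂₃; have := h.ne₂₄; have := h.ne₃₄
    fin_cases i <;> fin_cases j <;> first | rfl | (exfalso; simp at hij; tauto)
  cover := by
    intro w hp hb ht
    obtain ⟨s, rfl⟩ := h.spans w hp (hb 2) (ht 2) (hb 3) (ht 3)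
    have hb1 : (s • u) ⬝ᵥ ν A₁.1 ≤ 0 := hb 0
    have hb2 : (s • u) ⬝ᵥ ν A₂.1 ≤ 0 := hb 1
    have ht1 : (s • u) ⬝ᵥ ν A₁.2 ≤ 0 := ht 0
    have ht2 : (s • u) ⬝ᵥ ν A₂.2 ≤ 0 := ht 1
    simp only [smul_dotProduct, smul_eq_mul] at hb1 hb2 ht1 ht2
    have h1 : s ≤ 0 := by
      by_contra! hs
      rcases h.pos with h1 | ⟨-, h1⟩ <;> have := mul_pos hs h1 <;> linarith
    have h2 : 0 ≤ s := by
      by_contra! hs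
      rcases h.neg with h1 | ⟨-, h1⟩ <;> have := mul_pos_of_neg_of_neg hs h1 <;> linarith
    rw [le_antisymm h1 h2, zero_smul]
  free := by
    obtain ⟨w, h0, hp, h1, h2, h3, h4⟩ := hw
    exact ⟨w, h0, hp, by simpa [Fin.forall_fin_succ] using ⟨h1, h2, h3, h4⟩⟩

theorem replace (h : Sided ν p u A₁ A₂ A₃ A₄) {F₁ F₂ : P.Facet × P.Facet} (h₁ : P.Finger p F₁)
    (h₂ : P.Finger p F₂) (h12 : F₁.1 ≠ F₂.1) (h13 : F₁.1 ≠ A₃.1) (h14 : F₁.1 ≠ A₄.1)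
    (h23 : F₂.1 ≠ A₃.1) (h24 : F₂.1 ≠ A₄.1)
    (pos : 0 < u ⬝ᵥ ν F₁.1 ∨ u ⬝ᵥ ν F₁.1 = 0 ∧ 0 < u ⬝ᵥ ν F₁.2)
    (neg : u ⬝ᵥ ν F₂.1 < 0 ∨ u ⬝ᵥ ν F₂.1 = 0 ∧ u ⬝ᵥ ν F₂.2 < 0) : Sided ν p u F₁ F₂ A₃ A₄ :=
  { h with
    finger₁ := h₁
    finger₂ := h₂
    ne₁₂ := h12
    ne₁₃ := h13
    ne₁₄ := h14
    ne₂₃ := h23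
    ne₂₄ := h24
    pos := pos
    neg := neg }

/-- The two sides of a fixture with four fingers can be replaced by fingers found by the searches. -/
theorem exists_of_scans (h : Sided ν p u A₁ A₂ A₃ A₄) (hν : P.NormalField ν) (hu : u ≠ 0)
    {w : Fin 3 → ℝ} (hw0 : w ≠ 0) (hp : w ⬝ᵥ ν p ≤ 0) (h1 : w ⬝ᵥ ν A₁.1 ≤ 0)
    (h2 : w ⬝ᵥ ν A₂.1 ≤ 0) (h3 : w ⬝ᵥ ν A₃.1 ≤ 0) (h4 : w ⬝ᵥ ν A₄.1 ≤ 0)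
    (ht : w ⬝ᵥ ν p = 0 ∨ w ⬝ᵥ ν A₃.1 = 0) {c c' : Fin 4 → P.Facet × P.Facet}
    {r r' : Fin 3 → P.Facet × P.Facet}
    (hc : HalfScan ν p A₃ u (scanDirections u (ν p) (ν A₃.1)) c r)
    (hc' : HalfScan ν p A₃ (-u) (scanDirections u (ν p) (ν A₃.1)) c' r') :
    ∃ F₁ F₂, ((∃ i, F₁ = c i) ∨ ∃ i, F₁ = r i) ∧ ((∃ i, F₂ = c' i) ∨ ∃ i, F₂ = r' i) ∧
      Candidate ν 4 p ![F₁, F₂, A₃, A₄] := by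
  have hneg : ∀ f, 0 < -u ⬝ᵥ ν f ↔ u ⬝ᵥ ν f < 0 := fun f => by rw [neg_dotProduct, neg_pos]
  have hz : ∀ f f', u ⬝ᵥ ν f ≠ 0 → u ⬝ᵥ ν f' = 0 → f ≠ f' := by
    rintro f f' h h' rfl; exact h h'
  have axis : ∀ s : ℝ, s ≠ 0 → s • u ≠ 0 := fun s hs => smul_ne_zero hs hu
  rcases h.pos with pos | ⟨pos, pos'⟩ <;> rcases h.neg with neg | ⟨neg, neg'⟩
  -- Both bodies lie off the plane, so the free direction is not on the axis. Being tight at the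
  -- palm or at the third body, it is, up to a positive factor, `s u` plus one of the four scan
  -- directions. The value of `s` is unknown, but extremal slopes suit every `s`.
  · obtain ⟨i, t, s, ht, e⟩ : ∃ i, ∃ t s : ℝ, 0 < t ∧
        t • w = s • u + scanDirections u (ν p) (ν A₃.1) i := by
      have key : ∀ (s β : ℝ) (x : Fin 3 → ℝ), w = s • u + β • (u ⨯₃ x) →
          ∃ t s' : ℝ, 0 < t ∧ t • w = s' • u + u ⨯₃ x ∨ 0 < t ∧ t • w = s' • u + x ⨯₃ u := by
        intro s β x hw
        have hβ : β ≠ 0 := by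
          rintro rfl
          rw [zero_smul, add_zero] at hw
          rw [hw, smul_dotProduct, smul_eq_mul] at h1 h2
          have e1 : s ≤ 0 := by by_contra! hs; have := mul_pos hs pos; linarith
          have e2 : 0 ≤ s := by by_contra! hs; have := mul_pos_of_neg_of_neg hs neg; linarith
          exact hw0 (by rw [hw, le_antisymm e1 e2, zero_smul])
        rcases lt_or_gt_of_ne hβ with hb | hb
        · refine ⟨(-β)⁻¹, (-β)⁻¹ * s, .inr ⟨inv_pos.2 (neg_pos.2 hb), ?_⟩⟩
          rw [hw, smul_add, smul_smul, smul_smul, ← cross_anticomm u x, inv_neg, neg_mul β⁻¹ β,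
            inv_mul_cancel₀ hβ, neg_one_smul]
        · refine ⟨β⁻¹, β⁻¹ * s, .inl ⟨inv_pos.2 hb, ?_⟩⟩
          rw [hw, smul_add, smul_smul, smul_smul, inv_mul_cancel₀ hβ, one_smul]
      rcases ht with ht | ht
      · obtain ⟨s, β, e⟩ := exists_smul_add_cross hu (hν.ne_zero p) h.palm ht
        obtain ⟨t, s', h' | h'⟩ := key s β _ e
        exacts [⟨0, t, s', h'⟩, ⟨1, t, s', h'⟩]
      · obtain ⟨s, β, e⟩ := exists_smul_add_cross hu (hν.ne_zero A₃.1) h.body₃ ht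
        obtain ⟨t, s', h' | h'⟩ := key s β _ e
        exacts [⟨2, t, s', h'⟩, ⟨3, t, s', h'⟩]
    have scale : ∀ x, w ⬝ᵥ x ≤ 0 → (s • u + scanDirections u (ν p) (ν A₃.1) i) ⬝ᵥ x ≤ 0 := by
      intro x hx
      rw [← e, smul_dotProduct, smul_eq_mul]
      exact mul_nonpos_of_nonneg_of_nonpos ht.le hx
    obtain ⟨f1, p1, k1⟩ := hc.slope i A₁ h.finger₁ pos
    obtain ⟨f2, p2, k2⟩ := hc'.slope i A₂ h.finger₂ ((hneg _).2 neg)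
    have q2 := (hneg _).1 p2
    refine ⟨c i, c' i, .inl ⟨i, rfl⟩, .inl ⟨i, rfl⟩, (h.replace f1 f2 ?_ (hz _ _ p1.ne' h.body₃)
      (hz _ _ p1.ne' h.body₄) (hz _ _ q2.ne h.body₃) (hz _ _ q2.ne h.body₄) (.inl p1)
      (.inl q2)).candidate ⟨_, e ▸ smul_ne_zero ht.ne' hw0,
      scale _ hp, polar_of_slope_le (scale _ h1) pos p1 k1, ?_, scale _ h3, scale _ h4⟩⟩
    · intro e; rw [e] at p1; linarith
    · have := polar_of_slope_le (u := -u) (s := -s) (b := ν A₂.1) (b' := ν (c' i).1)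
        (z := scanDirections u (ν p) (ν A₃.1) i) (by rw [neg_smul_neg]; exact scale _ h2)
        ((hneg _).2 neg) p2 k2
      rwa [neg_smul_neg] at this
  -- Here no body is on the negative side, so `-u` is free and any finger with its body on the
  -- positive side will do. The representative on the other side only has to avoid the body of `A₄`;
  -- that of `A₃` is excluded by `TipSide`.
  · obtain ⟨f1, p1, -⟩ := hc.slope 0 A₁ h.finger₁ pos
    have hF : TipSide ν p A₃ (-u) A₂ :=
      ⟨h.finger₂, h.ne₂₃, by rw [neg_dotProduct, neg, neg_zero], (hneg _).2 neg'⟩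
    obtain ⟨j, hj, hj4, -⟩ := hc'.exists_rep hF h.ne₂₄ h.ne₂₄
    have b2 : u ⬝ᵥ ν (r' j).1 = 0 := by have := hj.body; rwa [neg_dotProduct, neg_eq_zero] at this
    refine ⟨c 0, r' j, .inl ⟨0, rfl⟩, .inr ⟨j, rfl⟩, (h.replace f1 hj.finger (hz _ _ p1.ne' b2)
      (hz _ _ p1.ne' h.body₃) (hz _ _ p1.ne' h.body₄) hj.ne hj4 (.inl p1)
      (.inr ⟨b2, (hneg _).1 hj.tip⟩)).candidate ⟨(-1 : ℝ) • u, axis _ (by norm_num), ?_⟩⟩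
    simp only [smul_dotProduct, h.palm, h.body₃, h.body₄, b2, smul_eq_mul]
    norm_num
    exact p1.le
  · obtain ⟨f2, p2, -⟩ := hc'.slope 0 A₂ h.finger₂ ((hneg _).2 neg)
    have q2 := (hneg _).1 p2
    have hF : TipSide ν p A₃ u A₁ := ⟨h.finger₁, h.ne₁₃, pos, pos'⟩
    obtain ⟨j, hj, hj4, -⟩ := hc.exists_rep hF h.ne₁₄ h.ne₁₄
    refine ⟨r j, c' 0, .inr ⟨j, rfl⟩, .inl ⟨0, rfl⟩, (h.replace hj.finger f2
      (hz _ _ q2.ne hj.body).symm hj.ne hj4 (hz _ _ q2.ne h.body₃) (hz _ _ q2.ne h.body₄)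
      (.inr ⟨hj.body, hj.tip⟩) (.inl q2)).candidate ⟨u, hu, ?_⟩⟩
    simp only [h.palm, h.body₃, h.body₄, hj.body]
    exact ⟨le_rfl, le_rfl, q2.le, le_rfl, le_rfl⟩
  -- All bodies are parallel to the axis, so `u` is free and only distinctness matters. The negative
  -- representative avoids `A₁` as well as `A₄`, so that `A₁` still witnesses a positive one
  -- avoiding it.
  · have hF : TipSide ν p A₃ u A₁ := ⟨h.finger₁, h.ne₁₃, pos, pos'⟩
    have hF' : TipSide ν p A₃ (-u) A₂ :=
      ⟨h.finger₂, h.ne₂₃, by rw [neg_dotProduct, neg, neg_zero], (hneg _).2 neg'⟩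
    obtain ⟨j, hj, hj4, hj1⟩ := hc'.exists_rep hF' h.ne₂₄ h.ne₁₂.symm
    obtain ⟨i, hi, hi4, hij⟩ := hc.exists_rep hF h.ne₁₄ hj1.symm
    have b2 : u ⬝ᵥ ν (r' j).1 = 0 := by have := hj.body; rwa [neg_dotProduct, neg_eq_zero] at this
    refine ⟨r i, r' j, .inr ⟨i, rfl⟩, .inr ⟨j, rfl⟩, (h.replace hi.finger hj.finger hij hi.ne hi4
      hj.ne hj4 (.inr ⟨hi.body, hi.tip⟩) (.inr ⟨b2, (hneg _).1 hj.tip⟩)).candidate ⟨u, hu, ?_⟩⟩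
    simp only [h.palm, h.body₃, h.body₄, hi.body, b2, le_refl, and_self]

end Sided

/-- A minimal fixture with four fingers can be found from two of its fingers. -/
theorem Fixture.Valid.exists_two_fingers (hν : P.NormalField ν) {G : Fixture P} (h : G.Valid)
    (hmin : ∀ G' : Fixture P, G'.Valid → G.fingers.card ≤ G'.fingers.card)
    (h4 : G.fingers.card = 4) :
    ∃ A₃ A₄, P.Finger G.palm A₃ ∧ P.Finger G.palm A₄ ∧ ∀ u, u = ν G.palm ⨯₃ ν A₃.1 → ∀ c c' r r',
      HalfScan ν G.palm A₃ u (scanDirections u (ν G.palm) (ν A₃.1)) c r →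
      HalfScan ν G.palm A₃ (-u) (scanDirections u (ν G.palm) (ν A₃.1)) c' r' →
      ∃ F₁ F₂, ((∃ i, F₁ = c i) ∨ ∃ i, F₁ = r i) ∧ ((∃ i, F₂ = c' i) ∨ ∃ i, F₂ = r' i) ∧
        Candidate ν 4 G.palm ![F₁, F₂, A₃, A₄] := by
  obtain ⟨F, hF, -, hm, hsurj⟩ := h.exists_candidate hν h4.le
  rw [h4] at hF
  have hinj : ∀ i j : Fin 4, (F i).1 = (F j).1 → i = j := fun i j => hF.inj i j i.2 j.2
  obtain ⟨v, hv⟩ := h.irredundant hν hmin F (fun i j e => hinj i j (by rw [e])) hm hsurj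
  obtain ⟨i, j, k, l, ⟨hij, hik, hil, hjk, hjl, hkl⟩, U, hU0, hUp, hUk, hUl, hspan, hi, ⟨x, hx, hx'⟩,
    hj, y, hy, hy'⟩ := hv.exists_structure
  have hS : Sided ν G.palm U (F i) (F j) (F k) (F l) := by
    refine ⟨hF.finger i, hF.finger j, hF.finger k, hF.finger l, ?_, ?_, ?_, ?_, ?_, ?_, hUp,
      hUk _ (.inl rfl), hUl _ (.inl rfl), ?_, ?_, ?_⟩
    · exact fun e => hij (hinj _ _ e)
    · exact fun e => hik (hinj _ _ e)
    · exact fun e => hil (hinj _ _ e)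
    · exact fun e => hjk (hinj _ _ e)
    · exact fun e => hjl (hinj _ _ e)
    · exact fun e => hkl (hinj _ _ e)
    · intro w h1 h2 h3 h4 h5
      refine hspan w h1 ?_ ?_
      · rintro x (rfl | rfl) <;> assumption
      · rintro x (rfl | rfl) <;> assumption
    · rcases (hi _ (.inl rfl)).lt_or_eq with h | h
      · exact .inl h
      · refine .inr ⟨h.symm, ?_⟩
        rcases hx with rfl | rfl
        · exact absurd h hx'.ne
        · exact hx'
    · rcases (hj _ (.inl rfl)).lt_or_eq with h | h
      · exact .inl h
      · refine .inr ⟨h, ?_⟩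
        rcases hy with rfl | rfl
        · exact absurd h hy'.ne
        · exact hy'
  obtain ⟨w, hw0, hwp, hw⟩ := hF.free
  obtain ⟨w, hw0, hwp, h1, h2, h3, h4, ht⟩ := exists_polar_tight
    (hν.cross_ne_zero (hF.finger i).body) hw0 hwp (hw i) (hw j) (hw k) (hw l)
  have main : ∀ A₁ A₂ A₃ A₄, Sided ν G.palm U A₁ A₂ A₃ A₄ → w ⬝ᵥ ν A₁.1 ≤ 0 → w ⬝ᵥ ν A₂.1 ≤ 0 →
      w ⬝ᵥ ν A₃.1 ≤ 0 → w ⬝ᵥ ν A₄.1 ≤ 0 → (w ⬝ᵥ ν G.palm = 0 ∨ w ⬝ᵥ ν A₃.1 = 0) →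
      ∀ u, u = ν G.palm ⨯₃ ν A₃.1 → ∀ c c' r r',
      HalfScan ν G.palm A₃ u (scanDirections u (ν G.palm) (ν A₃.1)) c r →
      HalfScan ν G.palm A₃ (-u) (scanDirections u (ν G.palm) (ν A₃.1)) c' r' →
      ∃ F₁ F₂, ((∃ i, F₁ = c i) ∨ ∃ i, F₁ = r i) ∧ ((∃ i, F₂ = c' i) ∨ ∃ i, F₂ = r' i) ∧
        Candidate ν 4 G.palm ![F₁, F₂, A₃, A₄] := by
    intro A₁ A₂ A₃ A₄ hS h1 h2 h3 h4 ht u hu c c' r r' hc hc'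
    have hu0 : u ≠ 0 := hu ▸ hν.cross_ne_zero hS.finger₃.body
    -- The program knows the axis only as the cross product of the palm and the third body, which is
    -- `U` up to a nonzero factor; a negative factor exchanges the two sides.
    obtain ⟨d, hd⟩ := exists_smul_cross (hν.cross_ne_zero hS.finger₃.body) hS.palm hS.body₃
    rw [← hu] at hd
    have hd0 : d ≠ 0 := by rintro rfl; exact hU0 (by rw [hd, zero_smul])
    rcases lt_or_gt_of_ne hd0 with hneg | hpos
    · have hS' := hS.neg_symm.smul (c := (-d)⁻¹) (inv_pos.2 (neg_pos.2 hneg))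
      rw [show (-d)⁻¹ • -U = u by
        rw [hd, ← neg_smul, smul_smul, inv_mul_cancel₀ (neg_ne_zero.2 hd0), one_smul]] at hS'
      exact hS'.exists_of_scans hν hu0 hw0 hwp h2 h1 h3 h4 ht hc hc'
    · have hS' := hS.smul (inv_pos.2 hpos)
      rw [show d⁻¹ • U = u by rw [hd, smul_smul, inv_mul_cancel₀ hd0, one_smul]] at hS'
      exact hS'.exists_of_scans hν hu0 hw0 hwp h1 h2 h3 h4 ht hc hc'
  -- The scan directions refer to the palm and the third body, so a direction tight at the fourth
  -- one requires exchanging the spanning fingers.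
  rcases ht with ht | ht | ht
  · exact ⟨F k, F l, hF.finger k, hF.finger l, main _ _ _ _ hS h1 h2 h3 h4 (.inl ht)⟩
  · exact ⟨F k, F l, hF.finger k, hF.finger l, main _ _ _ _ hS h1 h2 h3 h4 (.inr ht)⟩
  · exact ⟨F l, F k, hF.finger l, hF.finger k, main _ _ _ _ hS.symm h1 h2 h4 h3 (.inr ht)⟩

end Snapping

/-! ### Search loops, and reading normals from the memory. -/

namespace Snapping

open Matrix

namespace Prog

variable {N C : ℕ} {s : Mem} {Q : Mem → Prop}

/-- A loop every round of which keeps `J`, moves up in the preorder `M`, and establishes `D k`, which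
persists along `M`. -/
theorem Runs.loop_rel {l : Bool} {i : ℕ} {e : NExp} {p : Prog} {n : ℕ} {J : Mem → Prop}
    {M : Mem → Mem → Prop} {D : ℕ → Mem → Prop} (hn : n ≤ bound N C l) (hi : p.writes i = false)
    (he : ∀ s', (Prog.loop l i e p).Frame s s' → e.eval s' = n)
    (hJi : ∀ s' x, J s' → J (s'.setNat i 0 x)) (hJ : J s)
    (hM : ∀ s x, M s (s.setNat i 0 x)) (hM0 : M s s) (hMt : ∀ {a b c}, M a b → M b c → M a c)
    (hD : ∀ k s s', M s s' → D k s → D k s')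
    (step : ∀ k < n, ∀ s', (Prog.loop l i e p).Frame s s' → s'.nat i 0 = k → J s' →
      p.Runs N C s' fun s'' => J s'' ∧ M s' s'' ∧ D k s'') :
    (Prog.loop l i e p).Runs N C s fun s' => J s' ∧ M s s' ∧ ∀ k < n, D k s' := by
  refine Runs.loop (n := n) (fun k s' => J s' ∧ M s s' ∧ ∀ k' < k, D k' s') hn hi he ?_
    ⟨hJ, hM0, by simp⟩ ?_ (fun _ _ h => h)
  · rintro k s' x ⟨h1, h2, h3⟩
    exact ⟨hJi _ _ h1, hMt h2 (hM _ _), fun k' hk' => hD _ _ _ (hM _ _) (h3 k' hk')⟩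
  · rintro k hk s' hF hs ⟨h1, h2, h3⟩
    refine (step k hk s' hF hs h1).mono ?_
    rintro s'' - ⟨h4, h5, h6⟩
    refine ⟨h4, hMt h2 h5, fun k' hk' => ?_⟩
    rcases Nat.lt_succ_iff_lt_or_eq.1 hk' with h | rfl
    exacts [hD _ _ _ h5 (h3 _ h), h6]

/-- A search: either something has been reported, or `D` is known. -/
def Searched (J : Mem → Prop) (D : Prop) (s s' : Mem) : Prop :=
  J s' ∧ (s.outCount ≠ 0 → s'.outCount ≠ 0) ∧ (s'.outCount ≠ 0 ∨ D)

theorem Searched.mono {J : Mem → Prop} {D D' : Prop} {s s' : Mem} (h : Searched J D s s')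
    (hD : D → D') : Searched J D' s s' := ⟨h.1, h.2.1, h.2.2.imp_right hD⟩

theorem Runs.search_loop {l : Bool} {i : ℕ} {e : NExp} {p : Prog} {n : ℕ} {J : Mem → Prop}
    {D : ℕ → Prop} (hn : n ≤ bound N C l) (hi : p.writes i = false)
    (he : ∀ s', (Prog.loop l i e p).Frame s s' → e.eval s' = n) (hi4 : i ≠ 4)
    (hJi : ∀ s' x, J s' → J (s'.setNat i 0 x)) (hJ : J s)
    (step : ∀ k < n, ∀ s', (Prog.loop l i e p).Frame s s' → s'.nat i 0 = k → J s' →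
      p.Runs N C s' (Searched J (D k) s')) :
    (Prog.loop l i e p).Runs N C s (Searched J (∀ k < n, D k) s) := by
  have h4 : ∀ (s : Mem) x, (s.setNat i 0 x).outCount = s.outCount := fun s x => by
    rw [Mem.outCount, s.setNat_nat_of_ne _ _ hi4.symm]; rfl
  refine (Runs.loop_rel (J := J) (M := fun s s' => s.outCount ≠ 0 → s'.outCount ≠ 0)
    (D := fun k s' => s'.outCount ≠ 0 ∨ D k) hn hi he hJi hJ (fun s x => by rw [h4]; exact id) id
    (fun h h' => h' ∘ h) (fun k s s' h => Or.imp_left h) step).mono ?_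
  rintro s' - ⟨h1, h2, h3⟩
  refine ⟨h1, h2, ?_⟩
  by_cases h : s'.outCount ≠ 0
  · exact .inl h
  · exact .inr fun k hk => (h3 k hk).resolve_left h

theorem Runs.search_seqs {α : Type*} {f : α → Prog} {J : Mem → Prop} {D : α → Prop} (L : List α)
    (hJ : J s) (step : ∀ a ∈ L, ∀ s', (seqs (L.map f)).Frame s s' → J s' →
      (f a).Runs N C s' (Searched J (D a) s')) :
    (seqs (L.map f)).Runs N C s (Searched J (∀ a ∈ L, D a) s) := by
  have hcons : ∀ a (L : List α) A, (seqs ((a :: L).map f)).writes A = false →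
      (f a).writes A = false ∧ (seqs (L.map f)).writes A = false := fun a L A h => by
    simpa [seqs, writes] using h
  induction L generalizing s with
  | nil => exact Runs.skip ⟨hJ, id, .inr (by simp)⟩
  | cons a L ih =>
    refine Runs.seq ((step a (by simp) s (Frame.refl _ _) hJ).mono ?_)
    rintro s1 hF ⟨h1, h2, h3⟩
    refine (ih h1 fun b hb s' hF' => step b (by simp [hb]) s'
      ((hF.mono fun A hA => (hcons a L A hA).1).trans
        (hF'.mono fun A hA => (hcons a L A hA).2))).mono ?_
    rintro s2 - ⟨h4, h5, h6⟩
    refine ⟨h4, fun h => h5 (h2 h), ?_⟩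
    rcases h3 with h3 | h3
    · exact .inl (h5 h3)
    · exact h6.imp_right fun h6 => by simpa using ⟨h3, h6⟩

end Prog

/-! ## The normals of the triangles in the memory -/

/-- The number of triangles. -/
def numTExp : NExp := .get 0 (.lit 1)

/-- The number of directed edges. -/
def numHExp : NExp := .mul (.lit 3) numTExp

/-- The `i`-th vertex of a triangle. -/
def cornerExp (i : ℕ) (t : NExp) : VExp := fun c => .get c (.get (i + 1) t)

/-- The normal of a triangle. -/
def normalExp (t : NExp) : VExp :=
  ((cornerExp 1 t).sub (cornerExp 0 t)).cross ((cornerExp 2 t).sub (cornerExp 0 t))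

/-- The input of `P` is still in the memory. -/
structure Polyhedron.HasInput (P : Polyhedron) (s : Mem) : Prop where
  real : s.real = P.input.real
  nat : ∀ A ≤ 3, s.nat A = P.input.nat A

namespace Polyhedron.HasInput

variable {P : Polyhedron} {s : Mem}

theorem numT (h : P.HasInput s) : numTExp.eval s = P.numT := by
  simp [numTExp, NExp.eval, h.nat 0 (by norm_num), input]

theorem numH (h : P.HasInput s) : numHExp.eval s = 3 * P.numT := by
  simp [numHExp, NExp.eval, h.numT]

theorem corner (h : P.HasInput s) (i : Fin 3) (t : Fin P.numT) :
    s.nat (i + 1) t = P.tri t i := by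
  rw [h.nat _ (by omega)]
  fin_cases i <;> simp [input, cornerEntry]

theorem coord (h : P.HasInput s) (c : Fin 3) (v : Fin P.numV) : s.real c v = P.pos v c := by
  rw [h.real]
  fin_cases c <;> simp [input, coordEntry]

theorem cornerExp (h : P.HasInput s) {t : NExp} {x : Fin P.numT} (ht : t.eval s = x) (i : Fin 3) :
    (cornerExp i t).eval s = P.pos (P.tri x i) := by
  ext c
  simp only [VExp.eval, Snapping.cornerExp, RExp.eval, NExp.eval, ht, h.corner, h.coord]

theorem normalExp (h : P.HasInput s) {t : NExp} {x : Fin P.numT} (ht : t.eval s = x) :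
    (normalExp t).eval s = P.normal x := by
  have h0 := h.cornerExp ht 0
  have h1 := h.cornerExp ht 1
  have h2 := h.cornerExp ht 2
  simp only [Fin.val_zero, Fin.val_one, Fin.val_two] at h0 h1 h2
  rw [Snapping.normalExp, VExp.eval_cross, VExp.eval_sub, VExp.eval_sub, h0, h1, h2, Mesh.normal]

end Polyhedron.HasInput

/-- No direction has a nonpositive product with all vectors of the list. -/
def coverExp (L : List VExp) : BExp :=
  .all (L.map fun a => .all (L.map fun b =>
    .or (a.cross b).isZero (.any (L.map fun c => .rlt (.lit 0) ((a.cross b).dot c)))))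

/-- By `exists_cross_of_polar` it suffices to refute the finitely many cross products of members;
the two hypotheses on the list are those of that lemma. -/
theorem holds_coverExp {s : Mem} (L : List VExp) (h0 : ∀ a ∈ L, a.eval s ≠ 0)
    (h1 : ∃ a ∈ L, ∃ b ∈ L, a.eval s ⨯₃ b.eval s ≠ 0) :
    (coverExp L).Holds s ↔ ∀ w : Fin 3 → ℝ, (∀ a ∈ L, w ⬝ᵥ a.eval s ≤ 0) → w = 0 := by
  simp only [coverExp, BExp.holds_all, List.mem_map, forall_exists_index, and_imp,
    forall_apply_eq_imp_iff₂, BExp.holds_or, VExp.holds_isZero, VExp.eval_cross, BExp.holds_any,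
    BExp.holds_rlt, VExp.eval_dot, exists_exists_and_eq_and, RExp.eval, Int.cast_zero]
  constructor
  · intro h w hw
    by_contra hw0
    obtain ⟨a, ha, b, hb, hab⟩ := h1
    have : Finite {a // a ∈ L} := L.finite_toSet
    obtain ⟨i, j, hij, hk⟩ := exists_cross_of_polar (fun x : {a // a ∈ L} => x.1.eval s)
      ⟨⟨a, ha⟩, ⟨b, hb⟩, hab⟩ (fun x => h0 _ x.2) hw0 (fun x => hw _ x.2)
    rcases h i.1 i.2 j.1 j.2 with h | ⟨c, hc, h⟩
    · exact hij h
    · exact absurd (hk ⟨c, hc⟩) (not_le.2 h)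
  · intro h a ha b hb
    by_contra! hcon
    exact hcon.1 (h _ hcon.2)

end Snapping

/-! ### Deciding and reporting a single candidate. -/

namespace Snapping

open Matrix

/-! ## Testing a candidate -/

/-- The body of the finger number `k`. -/
def bodyExp (k : NExp) : NExp := .get 11 k

/-- The tip of the finger number `k`. -/
def tipExp (k : NExp) : NExp := .get 12 k

/-- Test whether two facets are neighbours. -/
def neighborExp (x y : NExp) : BExp := .not (.neq (.get 13 (.add (.mul x numTExp) y)) (.lit 0))

/-- Test whether `k` is a finger for the palm `p`. -/
def fingerExp (p k : NExp) : BExp :=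
  .and (neighborExp p (bodyExp k)) (.and (neighborExp (bodyExp k) (tipExp k)) (.not (.neq (tipExp k) p)))

/-- A list of fingers, the number of each of which is stored in a variable. -/
abbrev Registers := Fin 4 → ℕ

def palmBodiesExp (p : NExp) (R : Registers) : List VExp :=
  normalExp p :: (List.finRange 4).map fun j => normalExp (bodyExp (var (R j)))

def tipsExp (R : Registers) : List VExp :=
  (List.finRange 4).map fun j => normalExp (tipExp (var (R j)))

def distinctExp (K : ℕ) (R : Registers) : BExp :=
  .all ((List.finRange 4).map fun i : Fin 4 => .all ((List.finRange 4).map fun j : Fin 4 =>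
    if i < j ∧ (j : ℕ) < K then .not (.neq (bodyExp (var (R i))) (bodyExp (var (R j)))) else .tt))

/-- Test whether the palm in the variable `p` and the first `K` fingers form a valid fixture. -/
def candidateExp (K p : ℕ) (R : Registers) : BExp :=
  .and (.all ((List.finRange 4).map fun j => fingerExp (var p) (var (R j)))) (.and (distinctExp K R)
    (.and (coverExp (palmBodiesExp (var p) R ++ tipsExp R))
      (.not (coverExp (palmBodiesExp (var p) R)))))

/-- Report a fixture. -/
def recordProg (K p : ℕ) (R : Registers) : Prog :=
  .seq (.nset 4 (.lit 0) (.lit K)) (.seq (.nset 4 (.lit 1) (var p))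
    (.seqs ((List.finRange 4).map fun j : Fin 4 => .seq (.nset 5 (.lit j) (bodyExp (var (R j))))
      (.nset 6 (.lit j) (tipExp (var (R j)))))))

/-- Report a fixture if it is valid and if none has been reported before. -/
def testProg (K p : ℕ) (R : Registers) : Prog :=
  .ite (.and (.neq (.get 4 (.lit 0)) (.lit 0)) (candidateExp K p R)) (recordProg K p R) .skip

theorem testProg_writes {K p : ℕ} {R : Registers} {A : ℕ} (h : A ≠ 4 ∧ A ≠ 5 ∧ A ≠ 6) :
    (testProg K p R).writes A = false := by
  simp [testProg, recordProg, Prog.writes, Prog.seqs, List.finRange, h.1, h.2.1, h.2.2]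

/-- The tables with the fingers and the neighbours. A facet `f` is designated by its triangle
`σ f`. -/
structure Ready (P : Polyhedron) (σ : P.Facet → Fin P.numT) (φ : ℕ → P.Facet × P.Facet) (s : Mem) :
    Prop extends P.HasInput s where
  body : ∀ k < 3 * P.numT, s.nat 11 k = σ (φ k).1
  tip : ∀ k < 3 * P.numT, s.nat 12 k = σ (φ k).2
  neighbor : ∀ x y : Fin P.numT, s.nat 13 (x * P.numT + y) ≠ 0 ↔
    ∃ f f', σ f = x ∧ σ f' = y ∧ P.Neighbor f f'

/-- The state during the search for fixtures with `K` fingers. -/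
structure Searching (P : Polyhedron) (σ : P.Facet → Fin P.numT) (φ : ℕ → P.Facet × P.Facet) (K : ℕ)
    (s : Mem) : Prop where
  ready : Ready P σ φ s
  answered : s.outCount ≠ 0 → P.Answered s
  none : s.outCount ≠ 0 ∨ ∀ G : Fixture P, G.Valid → K ≤ G.fingers.card

/-- The arrays with input, output and tables. -/
def Protected (A : ℕ) : Prop := A ≤ 6 ∨ A = 11 ∨ A = 12 ∨ A = 13

instance : DecidablePred Protected := fun _ => inferInstanceAs (Decidable (_ ∨ _))

section

variable {P : Polyhedron} {σ : P.Facet → Fin P.numT} {φ : ℕ → P.Facet × P.Facet} {K N C : ℕ}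
  {s s' : Mem}

theorem Ready.congr (h : Ready P σ φ s)
    (hn : ∀ A, Protected A → A ∉ [4, 5, 6] → s'.nat A = s.nat A) (hr : s'.real = s.real) :
    Ready P σ φ s' where
  real := hr.trans h.real
  nat A hA := (hn A (.inl (by omega)) (by simp; omega)).trans (h.nat A hA)
  body := by rw [hn 11 (by decide) (by decide)]; exact h.body
  tip := by rw [hn 12 (by decide) (by decide)]; exact h.tip
  neighbor := by rw [hn 13 (by decide) (by decide)]; exact h.neighbor

theorem Searching.congr (h : Searching P σ φ K s) (hn : ∀ A, Protected A → s'.nat A = s.nat A)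
    (hr : s'.real = s.real) : Searching P σ φ K s' := by
  have h4 := hn 4 (by decide)
  have h5 := hn 5 (by decide)
  have h6 := hn 6 (by decide)
  have e : s'.outCount = s.outCount := by rw [Mem.outCount, h4]; rfl
  refine ⟨h.ready.congr (fun _ hA _ => hn _ hA) hr, ?_, ?_⟩
  · rw [e]
    intro h0
    have := h.answered h0
    simpa only [Polyhedron.Answered, Fixture.ListedIn, e, h4, h5, h6] using this
  · rw [e]
    exact h.none

theorem Searching.setNat (h : Searching P σ φ K s) {i : ℕ} (hi : ¬ Protected i) (j x : ℕ) :
    Searching P σ φ K (s.setNat i j x) :=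
  h.congr (fun _ hA => s.setNat_nat_of_ne _ _ fun e => hi (e ▸ hA)) rfl

theorem Searching.frame (h : Searching P σ φ K s) {p : Prog} (hp : p.Frame s s')
    (hw : ∀ A, Protected A → p.writes A = false) : Searching P σ φ K s' :=
  h.congr (fun A hA => hp.nat A (hw A hA)) hp.real

theorem normalField (hσ : ∀ f, P.facetOf (σ f) = f) : P.NormalField fun f => P.normal (σ f) :=
  fun f => ⟨σ f, hσ f, rfl⟩

theorem injective_of_section (hσ : ∀ f, P.facetOf (σ f) = f) : Function.Injective σ :=
  Function.LeftInverse.injective hσ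

namespace Ready

theorem evalBody (h : Ready P σ φ s) {k : NExp} (hk : k.eval s < 3 * P.numT) :
    (bodyExp k).eval s = σ (φ (k.eval s)).1 := h.body _ hk

theorem evalTip (h : Ready P σ φ s) {k : NExp} (hk : k.eval s < 3 * P.numT) :
    (tipExp k).eval s = σ (φ (k.eval s)).2 := h.tip _ hk

theorem holds_neighborExp (h : Ready P σ φ s) {x y : NExp} {a b : Fin P.numT} (hx : x.eval s = a)
    (hy : y.eval s = b) :
    (neighborExp x y).Holds s ↔ ∃ f f', σ f = a ∧ σ f' = b ∧ P.Neighbor f f' := by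
  rw [← h.neighbor]
  simp [neighborExp, NExp.eval, hx, hy, h.numT]

theorem holds_fingerExp (h : Ready P σ φ s) (hσ : ∀ f, P.facetOf (σ f) = f) {p k : NExp}
    {a : Fin P.numT} (hp : p.eval s = a) (hk : k.eval s < 3 * P.numT) :
    (fingerExp p k).Holds s ↔ ∃ f, σ f = a ∧ P.Finger f (φ (k.eval s)) := by
  have hinj := injective_of_section hσ
  simp only [fingerExp, BExp.holds_and, h.holds_neighborExp hp (h.evalBody hk),
    h.holds_neighborExp (h.evalBody hk) (h.evalTip hk), BExp.holds_not, BExp.holds_neq,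
    h.evalTip hk, hp]
  constructor
  · rintro ⟨⟨f, f', rfl, e, h1⟩, ⟨g, g', e1, e2, h2⟩, h3⟩
    rw [hinj e] at h1
    rw [hinj e1, hinj e2] at h2
    exact ⟨f, rfl, h1, h2, fun e => h3 (by rw [e])⟩
  · rintro ⟨f, rfl, h1, h2, h3⟩
    exact ⟨⟨_, _, rfl, rfl, h1⟩, ⟨_, _, rfl, rfl, h2⟩, fun e => h3 (hinj (Fin.ext e))⟩

theorem holds_candidateExp (h : Ready P σ φ s) (hσ : ∀ f, P.facetOf (σ f) = f) {p : ℕ}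
    {R : Registers} {a : Fin P.numT} (hp : s.nat p 0 = a) (hR : ∀ j, s.nat (R j) 0 < 3 * P.numT) :
    (candidateExp K p R).Holds s ↔ ∃ f, σ f = a ∧
      Candidate (fun f => P.normal (σ f)) K f fun j => φ (s.nat (R j) 0) := by
  have hν := normalField hσ
  have hinj := injective_of_section hσ
  have hb : ∀ j, (normalExp (bodyExp (var (R j)))).eval s = P.normal (σ (φ (s.nat (R j) 0)).1) :=
    fun j => h.normalExp (h.evalBody (hR j))
  have ht : ∀ j, (normalExp (tipExp (var (R j)))).eval s = P.normal (σ (φ (s.nat (R j) 0)).2) :=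
    fun j => h.normalExp (h.evalTip (hR j))
  have hF : (∀ j, ∃ f, σ f = a ∧ P.Finger f (φ (s.nat (R j) 0))) ↔
      ∃ f, σ f = a ∧ ∀ j, P.Finger f (φ (s.nat (R j) 0)) := by
    constructor
    · intro h
      obtain ⟨f, hf, -⟩ := h 0
      refine ⟨f, hf, fun j => ?_⟩
      obtain ⟨f', hf', h'⟩ := h j
      rwa [← hinj (hf'.trans hf.symm)]
    · rintro ⟨f, hf, h⟩ j
      exact ⟨f, hf, h j⟩
  have hD : (distinctExp K R).Holds s ↔
      ∀ i j : Fin 4, i < K → j < K → (φ (s.nat (R i) 0)).1 = (φ (s.nat (R j) 0)).1 → i = j := by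
    have e : ∀ i j : Fin 4, (if i < j ∧ (j : ℕ) < K then
        BExp.not (.neq (bodyExp (var (R i))) (bodyExp (var (R j)))) else .tt).Holds s ↔
        (i < j → (j : ℕ) < K → (φ (s.nat (R i) 0)).1 ≠ (φ (s.nat (R j) 0)).1) := by
      intro i j
      split_ifs with hij
      · have e1 : (bodyExp (var (R i))).eval s = σ (φ (s.nat (R i) 0)).1 := h.evalBody (hR i)
        have e2 : (bodyExp (var (R j))).eval s = σ (φ (s.nat (R j) 0)).1 := h.evalBody (hR j)
        simp only [BExp.holds_not, BExp.holds_neq, e1, e2, hij.1, hij.2, forall_true_left]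
        exact not_congr ⟨fun e => hinj (Fin.ext e), fun e => by rw [e]⟩
      · exact iff_of_true Nat.zero_lt_one fun h1 h2 => absurd ⟨h1, h2⟩ hij
    simp only [distinctExp, BExp.holds_all, List.mem_map, List.mem_finRange, true_and,
      forall_exists_index, forall_apply_eq_imp_iff, e]
    constructor
    · intro hd i j hi hj hij
      rcases lt_trichotomy i j with hlt | he | hlt
      · exact absurd hij (hd i j hlt hj)
      · exact he
      · exact absurd hij.symm (hd j i hlt hi)
    · intro hd i j hij hj e
      exact absurd (hd i j (lt_trans hij hj) hj e) hij.ne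
  simp only [candidateExp, BExp.holds_and, BExp.holds_all, List.mem_map, List.mem_finRange, true_and,
    forall_exists_index, forall_apply_eq_imp_iff, hD,
    fun j => h.holds_fingerExp hσ (p := var p) hp (k := var (R j)) (hR j)]
  rw [show (∀ j, ∃ f, σ f = a ∧ P.Finger f (φ ((var (R j)).eval s))) ↔ _ from hF]
  have hpalm : ∀ f, σ f = a → (normalExp (var p)).eval s = P.normal (σ f) := fun f hf =>
    h.normalExp (by rw [hf]; exact hp)
  have hcov : ∀ f, σ f = a → (∀ j, P.Finger f (φ (s.nat (R j) 0))) →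
      (∀ c ∈ palmBodiesExp (var p) R ++ tipsExp R, c.eval s ≠ 0) ∧
      ∃ c ∈ palmBodiesExp (var p) R, ∃ d ∈ palmBodiesExp (var p) R, c.eval s ⨯₃ d.eval s ≠ 0 := by
    intro f hf hfin
    refine ⟨?_, ⟨_, List.mem_cons_self, _, List.mem_cons_of_mem _ (List.mem_map_of_mem
      (List.mem_finRange 0)), ?_⟩⟩
    · intro c hc
      simp only [palmBodiesExp, tipsExp, List.mem_append, List.mem_cons, List.mem_map,
        List.mem_finRange, true_and] at hc
      rcases hc with (rfl | ⟨j, rfl⟩) | ⟨j, rfl⟩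
      · rw [hpalm f hf]; exact P.normal_ne_zero _
      · rw [hb]; exact P.normal_ne_zero _
      · rw [ht]; exact P.normal_ne_zero _
    · rw [hpalm f hf, hb]
      exact hν.cross_ne_zero (hfin 0).body
  have hall : ∀ f, σ f = a → ∀ w : Fin 3 → ℝ, (∀ c ∈ palmBodiesExp (var p) R, w ⬝ᵥ c.eval s ≤ 0) ↔
      w ⬝ᵥ P.normal (σ f) ≤ 0 ∧ ∀ j, w ⬝ᵥ P.normal (σ (φ (s.nat (R j) 0)).1) ≤ 0 := by
    intro f hf w
    simp only [palmBodiesExp, List.mem_cons, List.mem_map, List.mem_finRange, true_and,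
      forall_eq_or_imp, forall_exists_index, forall_apply_eq_imp_iff, hpalm f hf, hb]
  have hall' : ∀ w : Fin 3 → ℝ, (∀ c ∈ tipsExp R, w ⬝ᵥ c.eval s ≤ 0) ↔
      ∀ j, w ⬝ᵥ P.normal (σ (φ (s.nat (R j) 0)).2) ≤ 0 := by
    intro w
    simp only [tipsExp, List.mem_map, List.mem_finRange, true_and, forall_exists_index,
      forall_apply_eq_imp_iff, ht]
  have hC : ∀ f, σ f = a → (∀ j, P.Finger f (φ (s.nat (R j) 0))) →
      (((coverExp (palmBodiesExp (var p) R ++ tipsExp R)).Holds s ∧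
        ¬ (coverExp (palmBodiesExp (var p) R)).Holds s) ↔
      (∀ w : Fin 3 → ℝ, w ⬝ᵥ P.normal (σ f) ≤ 0 →
        (∀ j, w ⬝ᵥ P.normal (σ (φ (s.nat (R j) 0)).1) ≤ 0) →
        (∀ j, w ⬝ᵥ P.normal (σ (φ (s.nat (R j) 0)).2) ≤ 0) → w = 0) ∧
      ∃ w : Fin 3 → ℝ, w ≠ 0 ∧ w ⬝ᵥ P.normal (σ f) ≤ 0 ∧
        ∀ j, w ⬝ᵥ P.normal (σ (φ (s.nat (R j) 0)).1) ≤ 0) := by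
    intro f hf hfin
    obtain ⟨h0, c, hc, d, hd, hcd⟩ := hcov f hf hfin
    rw [holds_coverExp _ h0 ⟨c, List.mem_append_left _ hc, d, List.mem_append_left _ hd, hcd⟩,
      holds_coverExp _ (fun c hc => h0 c (List.mem_append_left _ hc)) ⟨c, hc, d, hd, hcd⟩]
    simp only [List.forall_mem_append, hall f hf, hall', and_imp, not_forall, exists_prop]
    exact and_congr_right fun _ => exists_congr fun w => by tauto
  constructor
  · rintro ⟨⟨f, hf, hfin⟩, hd, hc, hc'⟩
    obtain ⟨h1, h2⟩ := (hC f hf hfin).1 ⟨hc, hc'⟩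
    exact ⟨f, hf, hfin, hd, h1, h2⟩
  · rintro ⟨f, hf, hfin, hd, h1, h2⟩
    obtain ⟨hc, hc'⟩ := (hC f hf hfin).2 ⟨h1, h2⟩
    exact ⟨⟨f, hf, hfin⟩, hd, hc, hc'⟩

end Ready

theorem recordProg_runs {p : ℕ} {R : Registers} (hp : p ≠ 4 ∧ p ≠ 5 ∧ p ≠ 6)
    (hR : ∀ j, R j ≠ 4 ∧ R j ≠ 5 ∧ R j ≠ 6) :
    (recordProg K p R).Runs N C s fun s' => s'.nat 4 0 = K ∧ s'.nat 4 1 = s.nat p 0 ∧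
      ∀ j : Fin 4, s'.nat 5 j = s.nat 11 (s.nat (R j) 0) ∧ s'.nat 6 j = s.nat 12 (s.nat (R j) 0) := by
  have hR0 := hR 0
  have hR1 := hR 1
  have hR2 := hR 2
  have hR3 := hR 3
  refine Prog.Runs.seq (.nset (.seq (.nset ?_)))
  refine Prog.Runs.seqs_cons (.seq (.nset (.nset ?_)))
  refine Prog.Runs.seqs_cons (.seq (.nset (.nset ?_)))
  refine Prog.Runs.seqs_cons (.seq (.nset (.nset ?_)))
  refine Prog.Runs.seqs_cons (.seq (.nset (.nset (.seqs_nil ?_))))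
  simp [NExp.eval, bodyExp, tipExp, Fin.forall_fin_succ, Mem.setNat, Function.update_apply,
    hp, hR0, hR1, hR2, hR3]

/-- The test reports a valid fixture, or the tested one is not valid. -/
theorem testProg_runs (hσ : ∀ f, P.facetOf (σ f) = f) (hs : Searching P σ φ K s) {p : ℕ}
    {R : Registers} (hp : p ≠ 4 ∧ p ≠ 5 ∧ p ≠ 6) (hR : ∀ j, R j ≠ 4 ∧ R j ≠ 5 ∧ R j ≠ 6)
    (hK : 0 < K) (hK' : K ≤ 4) {a : Fin P.numT} (ha : s.nat p 0 = a)
    (hk : ∀ j, s.nat (R j) 0 < 3 * P.numT) (hpad : ∀ j : Fin 4, K ≤ j → R j = R 0) :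
    (testProg K p R).Runs N C s (Prog.Searched (Searching P σ φ K) (∀ f, σ f = a →
      ¬ Candidate (fun f => P.normal (σ f)) K f fun j => φ (s.nat (R j) 0)) s) := by
  refine Prog.Runs.ite ?_ ?_
  · rw [BExp.holds_and, hs.ready.holds_candidateExp hσ ha hk]
    rintro ⟨h0, f, hf, hc⟩
    -- Nothing has been reported so far, so every valid fixture has at least `K` fingers; this is
    -- where minimality of the reported one comes from.
    have hnone := hs.none.resolve_left (not_not.2 h0)
    obtain ⟨G, hG, hcard, hpalm, hmem⟩ := hc.exists_fixture (normalField hσ)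
      (fun j hj => by rw [hpad j hj]) hK hK'
    refine (recordProg_runs (s := s) hp hR).mono ?_
    rintro s' hF ⟨h1, h2, h3⟩
    have hout : s'.outCount = K := h1
    have h0' : s'.outCount ≠ 0 := by rw [hout]; exact hK.ne'
    have hready : Ready P σ φ s' := hs.ready.congr (fun A _ hA => hF.nat A (by
      simpa [recordProg, Prog.writes, Prog.seqs, List.finRange] using hA)) hF.real
    have names : ∀ g, P.Names (σ g : Fin P.numT) g := fun g => ⟨(σ g).2, hσ g⟩
    have names_eq : ∀ {g g'}, P.Names (σ g : Fin P.numT) g' → g = g' := by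
      rintro g g' ⟨_, h⟩
      rw [← hσ g, ← h]
    have hb : ∀ j : Fin 4, s'.nat 5 j = σ (φ (s.nat (R j) 0)).1 := fun j => by
      rw [(h3 j).1, hs.ready.body _ (hk j)]
    have ht : ∀ j : Fin 4, s'.nat 6 j = σ (φ (s.nat (R j) 0)).2 := fun j => by
      rw [(h3 j).2, hs.ready.tip _ (hk j)]
    refine ⟨⟨hready, fun _ => .inr ⟨by rw [hout]; exact hK, G, hG, ⟨?_, ?_, ?_⟩, ?_⟩, .inl h0'⟩,
      fun _ => h0', .inl h0'⟩
    · rw [hout, hcard]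
    · rw [h2, ha, ← hf, hpalm]; exact names f
    · intro F
      rw [hmem, hout]
      constructor
      · rintro ⟨i, hi, rfl⟩
        exact ⟨i, hi, by rw [hb]; exact names _, by rw [ht]; exact names _⟩
      · rintro ⟨i, hi, h5, h6⟩
        have e5 := hb ⟨i, by omega⟩
        have e6 := ht ⟨i, by omega⟩
        simp only at e5 e6
        rw [e5] at h5
        rw [e6] at h6
        exact ⟨⟨i, by omega⟩, hi, Prod.ext (names_eq h5) (names_eq h6)⟩
    · intro G' hG'
      rw [hcard]
      exact hnone G' hG'
  · intro h
    refine Prog.Runs.skip ⟨hs, id, ?_⟩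
    rw [BExp.holds_and, not_and_or, hs.ready.holds_candidateExp hσ ha hk] at h
    rcases h with h | h
    · exact .inl h
    · exact .inr fun f hf hc => h ⟨f, hf, hc⟩

end

end Snapping

/-! ### Facets as classes of adjacent coplanar triangles. -/

namespace Snapping

open Matrix

/-! ## Labels of the facets -/

namespace Prog

variable {N C : ℕ} {s : Mem}

/-- Programs run one after another, each of which keeps `J`, moves up in the preorder `M`, and
establishes `D a`, which persists along `M`. -/
theorem Runs.seqs_rel {α : Type*} {f : α → Prog} {J : Mem → Prop} {M : Mem → Mem → Prop}
    {D : α → Mem → Prop} (L : List α) (hJ : J s) (hM0 : ∀ s, M s s)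
    (hMt : ∀ {a b c}, M a b → M b c → M a c) (hD : ∀ a s s', M s s' → D a s → D a s')
    (step : ∀ a ∈ L, ∀ s', (seqs (L.map f)).Frame s s' → J s' →
      (f a).Runs N C s' fun s'' => J s'' ∧ M s' s'' ∧ D a s'') :
    (seqs (L.map f)).Runs N C s fun s' => J s' ∧ M s s' ∧ ∀ a ∈ L, D a s' := by
  have hcons : ∀ a (L : List α) A, (seqs ((a :: L).map f)).writes A = false →
      (f a).writes A = false ∧ (seqs (L.map f)).writes A = false := fun a L A h => by
    simpa [seqs, writes] using h
  induction L generalizing s with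
  | nil => exact Runs.skip ⟨hJ, hM0 s, by simp⟩
  | cons a L ih =>
    refine Runs.seq ((step a (by simp) s (Frame.refl _ _) hJ).mono ?_)
    rintro s1 hF ⟨h1, h2, h3⟩
    refine (ih h1 fun b hb s' hF' => step b (by simp [hb]) s'
      ((hF.mono fun A hA => (hcons a L A hA).1).trans
        (hF'.mono fun A hA => (hcons a L A hA).2))).mono ?_
    rintro s2 - ⟨h4, h5, h6⟩
    refine ⟨h4, hMt h2 h5, fun b hb => ?_⟩
    rcases List.mem_cons.1 hb with rfl | hb
    exacts [hD _ _ _ h5 h3, h6 b hb]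

end Prog

variable {P : Polyhedron} {s s' : Mem} {N C : ℕ}

theorem Polyhedron.HasInput.frame (h : P.HasInput s) {p : Prog} (hp : p.Frame s s')
    (hw : ∀ A ≤ 3, p.writes A = false) : P.HasInput s' :=
  ⟨hp.real.trans h.real, fun A hA => (hp.nat A (hw A hA)).trans (h.nat A hA)⟩

theorem Polyhedron.HasInput.setNat (h : P.HasInput s) {A : ℕ} (hA : 3 < A) (j x : ℕ) :
    P.HasInput (s.setNat A j x) :=
  ⟨h.real, fun B hB => (s.setNat_nat_of_ne _ _ (by omega)).trans (h.nat B hB)⟩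

theorem sameRay_iff {a b : Fin 3 → ℝ} (ha : a ≠ 0) (hb : b ≠ 0) :
    SameRay ℝ a b ↔ a ⨯₃ b = 0 ∧ 0 < a ⬝ᵥ b := by
  constructor
  · intro h
    obtain ⟨c, hc, rfl⟩ := h.exists_pos_left ha hb
    simp only [map_smul, cross_self, smul_zero, dotProduct_smul, smul_eq_mul, true_and]
    exact mul_pos hc (dot_pos_of_ne_zero ha)
  · rintro ⟨h1, h2⟩
    obtain ⟨c, rfl⟩ := exists_smul_of_cross_eq_zero ha h1
    rw [dotProduct_smul, smul_eq_mul] at h2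
    exact SameRay.sameRay_pos_smul_right a (pos_of_mul_pos_left h2 (dot_pos_of_ne_zero ha).le)

/-- Test whether the `i`-th directed edge of the triangle `t` has its twin in `t'`. -/
def edgeExp (i : Fin 3) (t t' : NExp) : BExp :=
  .any ((List.finRange 3).map fun j : Fin 3 =>
    .and (.neq (.get (i + 1) t) (.get (((j + 1 : Fin 3) : ℕ) + 1) t'))
      (.neq (.get (((i + 1 : Fin 3) : ℕ) + 1) t) (.get (j + 1) t')))

/-- Test whether two triangles are adjacent and coplanar. -/
def mergeExp (t t' : NExp) : BExp :=
  .and (.any ((List.finRange 3).map fun i => edgeExp i t t'))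
    (.and ((normalExp t).cross (normalExp t')).isZero
      (.rlt (.lit 0) ((normalExp t).dot (normalExp t'))))

theorem Polyhedron.HasInput.holds_edgeExp (h : P.HasInput s) {t t' : NExp} {a b : Fin P.numT}
    (ht : t.eval s = a) (ht' : t'.eval s = b) (i : Fin 3) :
    (edgeExp i t t').Holds s ↔ (P.twinEdge (a, i)).1 = b := by
  have e : (edgeExp i t t').Holds s ↔ ∃ j, P.src a i = P.dst b j ∧ P.dst a i = P.src b j := by
    simp only [edgeExp, BExp.holds_any, List.mem_map, List.mem_finRange, true_and,
      exists_exists_eq_and, BExp.holds_and, BExp.holds_neq, NExp.eval, ht, ht', h.corner]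
    exact exists_congr fun j => and_congr Fin.ext_iff.symm Fin.ext_iff.symm
  rw [e]
  constructor
  · rintro ⟨j, h1, h2⟩
    rw [← P.eq_twinEdge (h := (a, i)) (h' := (b, j)) h2.symm h1.symm]
  · rintro rfl
    exact ⟨(P.twinEdge (a, i)).2, (P.dst_twinEdge (a, i)).symm, (P.src_twinEdge (a, i)).symm⟩

theorem Polyhedron.HasInput.holds_mergeExp (h : P.HasInput s) {t t' : NExp} {a b : Fin P.numT}
    (ht : t.eval s = a) (ht' : t'.eval s = b) :
    (mergeExp t t').Holds s ↔ P.Adj a b ∧ SameRay ℝ (P.normal a) (P.normal b) := by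
  simp only [mergeExp, BExp.holds_and, BExp.holds_any, List.mem_map, List.mem_finRange, true_and,
      exists_exists_eq_and, h.holds_edgeExp ht ht', VExp.holds_isZero, VExp.eval_cross,
      BExp.holds_rlt, VExp.eval_dot, h.normalExp ht, h.normalExp ht', RExp.eval, Int.cast_zero,
      P.adj_iff, sameRay_iff (P.normal_ne_zero a) (P.normal_ne_zero b)]

/-- Replace all labels that are equal to the variable `27` by the variable `28`. -/
def relabelProg : Prog :=
  .loop true 29 numTExp (.ite (.neq (.get 10 (var 29)) (var 27)) (.nset 10 (var 29) (var 28)) .skip)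

/-- Merge the labels of adjacent coplanar triangles. -/
def mergeProg : Prog :=
  .loop true 20 numTExp (.loop true 21 numTExp (.ite (mergeExp (var 20) (var 21))
    (.seq (.nset 27 (.lit 0) (.get 10 (var 21))) (.seq (.nset 28 (.lit 0) (.get 10 (var 20)))
      relabelProg)) .skip))

/-- Label the triangles in such a way that the triangles of a facet have the same label, which is one
of them. -/
def labelProg : Prog :=
  .seq (.loop true 20 numTExp (.nset 10 (var 20) (var 20))) mergeProg

theorem relabelProg_runs (h : P.HasInput s) (hN : P.numT ≤ N) :
    relabelProg.Runs N C s fun s' => ∀ a < P.numT,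
      s'.nat 10 a = if s.nat 10 a = s.nat 27 0 then s.nat 28 0 else s.nat 10 a := by
  have hw : ∀ A ≤ 3, relabelProg.writes A = false := by decide
  refine Prog.Runs.loop (n := P.numT) (fun k s' => ∀ a, s'.nat 10 a =
    if a < k ∧ s.nat 10 a = s.nat 27 0 then s.nat 28 0 else s.nat 10 a) hN rfl
    (fun s' hF => (h.frame hF hw).numT) ?_ ?_ ?_ ?_
  · intro k s' x hI a
    rw [s'.setNat_nat_of_ne _ _ (by norm_num)]
    exact hI a
  · simp
  · intro k _ s' hF hk hI
    have e27 : s'.nat 27 0 = s.nat 27 0 := by rw [hF.nat 27 rfl]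
    have e28 : s'.nat 28 0 = s.nat 28 0 := by rw [hF.nat 28 rfl]
    have e10 : s'.nat 10 k = s.nat 10 k := by rw [hI]; simp
    refine Prog.Runs.ite (fun hb => .nset fun a => ?_) (fun hb => .skip fun a => ?_)
    · simp only [BExp.holds_neq, NExp.eval, hk, e10, e27] at hb
      simp only [NExp.eval, hk, e28, Mem.setNat_nat_same, Function.update_apply, hI]
      by_cases ha : a = k
      · subst ha; simp [hb]
      · have hak : a < k + 1 ↔ a < k := by omega
        simp only [ha, hak, if_false]
    · simp only [BExp.holds_neq, NExp.eval, hk, e10, e27] at hb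
      rw [hI]
      by_cases ha : a = k
      · subst ha; simp [hb]
      · have hak : a < k + 1 ↔ a < k := by omega
        simp only [hak]
  · intro s' _ hI a ha
    rw [hI]
    simp [ha]

/-- Every label is a triangle of the facet, and its own label. -/
def LabelsWithin (P : Polyhedron) (s : Mem) : Prop :=
  ∀ a : Fin P.numT, ∃ b : Fin P.numT, s.nat 10 a = b ∧ s.nat 10 b = b ∧ P.facetOf b = P.facetOf a

/-- Equal labels stay equal. -/
def LabelsCoarser (P : Polyhedron) (s s' : Mem) : Prop :=
  ∀ a b : Fin P.numT, s.nat 10 a = s.nat 10 b → s'.nat 10 a = s'.nat 10 b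

/-- The invariant `LabelsWithin` keeps labels from being too coarse. Conversely, each pair to be
merged gets equal labels in its round, and relabelling never separates equal labels; so one pass
over all pairs suffices. -/
theorem mergeProg_runs (h : P.HasInput s) (hN : P.numT ≤ N) (hs : LabelsWithin P s) :
    mergeProg.Runs N C s fun s' => LabelsWithin P s' ∧
      ∀ a b : Fin P.numT, P.facetOf a = P.facetOf b → s'.nat 10 a = s'.nat 10 b := by
  have hset : ∀ (s : Mem) A x, A ≠ 10 → (s.setNat A 0 x).nat 10 = s.nat 10 := fun s A x hA =>
    s.setNat_nat_of_ne _ _ hA.symm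
  have hJ : ∀ A, A ≠ 10 → ∀ s x, LabelsWithin P s → LabelsWithin P (s.setNat A 0 x) :=
    fun A hA s x h => by unfold LabelsWithin; rw [hset _ _ _ hA]; exact h
  have hM : ∀ A, A ≠ 10 → ∀ s x, LabelsCoarser P s (s.setNat A 0 x) :=
    fun A hA s x => by unfold LabelsCoarser; rw [hset _ _ _ hA]; exact fun _ _ => id
  have hMt : ∀ {a b c}, LabelsCoarser P a b → LabelsCoarser P b c → LabelsCoarser P a c :=
    fun h h' x y e => h' _ _ (h _ _ e)
  have step : ∀ s, P.HasInput s → LabelsWithin P s → ∀ t t' : Fin P.numT, s.nat 20 0 = t →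
      s.nat 21 0 = t' → (Prog.ite (mergeExp (var 20) (var 21))
        (.seq (.nset 27 (.lit 0) (.get 10 (var 21))) (.seq (.nset 28 (.lit 0) (.get 10 (var 20)))
          relabelProg)) .skip).Runs N C s fun s' => LabelsWithin P s' ∧ LabelsCoarser P s s' ∧
        (P.Adj t t' ∧ SameRay ℝ (P.normal t) (P.normal t') → s'.nat 10 t = s'.nat 10 t') := by
    intro s h hs t t' ht ht'
    refine Prog.Runs.ite (fun hb => .seq (.nset (.seq (.nset ?_)))) (fun hb => ?_)
    · rw [h.holds_mergeExp (t := var 20) (t' := var 21) ht ht'] at hb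
      refine (relabelProg_runs ((h.setNat (by norm_num) _ _).setNat (by norm_num) _ _) hN).mono ?_
      · intro s' _ hs'
        have hs' : ∀ a : Fin P.numT, s'.nat 10 a =
            if s.nat 10 a = s.nat 10 t' then s.nat 10 t else s.nat 10 a := by
          intro a
          rw [hs' a a.2]
          simp [Mem.setNat, NExp.eval, ht, ht']
        refine ⟨fun a => ?_, fun a b hab => ?_, fun _ => ?_⟩
        · obtain ⟨b, h1, h2, h3⟩ := hs a
          obtain ⟨c, h4, h5, h6⟩ := hs t
          by_cases hab : s.nat 10 a = s.nat 10 t'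
          -- The label of `t` remains its own label: it either is untouched or is replaced by the
          -- label of `t`, which is itself.
          · refine ⟨c, by rw [hs', if_pos hab, h4], ?_, ?_⟩
            · rw [hs', h5]; split_ifs <;> simp [h4]
            · obtain ⟨d, h7, -, h9⟩ := hs t'
              have : b = d := Fin.ext (by rw [← h1, ← h7, hab])
              rw [h6, ← h3, this, h9]
              exact Quotient.sound (.rel _ _ hb)
          · exact ⟨b, by rw [hs', if_neg hab, h1], by rw [hs', h2, ← h1, if_neg hab], h3⟩
        · rw [hs', hs', hab]
        · rw [hs', hs', if_pos rfl]
          split_ifs <;> rfl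
    · rw [h.holds_mergeExp (t := var 20) (t' := var 21) ht ht'] at hb
      exact .skip ⟨hs, fun _ _ => id, fun h => absurd h hb⟩
  have hw : ∀ A ≤ 3, mergeProg.writes A = false := by decide
  refine (Prog.Runs.loop_rel (N := N) (C := C) (l := true) (n := P.numT) (J := LabelsWithin P) (M := LabelsCoarser P)
    (D := fun t s' => ∀ ht : t < P.numT, ∀ t' < P.numT, ∀ ht' : t' < P.numT,
      P.Adj ⟨t, ht⟩ ⟨t', ht'⟩ ∧ SameRay ℝ (P.normal ⟨t, ht⟩) (P.normal ⟨t', ht'⟩) →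
        s'.nat 10 t = s'.nat 10 t')
    hN rfl (fun s' hF => (h.frame hF hw).numT) (hJ 20 (by norm_num)) hs (hM 20 (by norm_num))
    (fun _ _ => id) hMt
    (fun t s s' hM hd ht t' h1 ht' hb => hM ⟨t, ht⟩ ⟨t', ht'⟩ (hd ht t' h1 ht' hb)) ?_).mono ?_
  · intro t ht s' hF h20 hs'
    have h' := h.frame hF hw
    have hw' : ∀ A ≤ 3, (Prog.loop true 21 numTExp (.ite (mergeExp (var 20) (var 21))
        (.seq (.nset 27 (.lit 0) (.get 10 (var 21))) (.seq (.nset 28 (.lit 0) (.get 10 (var 20)))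
          relabelProg)) .skip)).writes A = false := by decide
    refine (Prog.Runs.loop_rel (N := N) (C := C) (l := true) (n := P.numT) (J := LabelsWithin P) (M := LabelsCoarser P)
      (D := fun t' s' => ∀ ht' : t' < P.numT,
        P.Adj ⟨t, ht⟩ ⟨t', ht'⟩ ∧ SameRay ℝ (P.normal ⟨t, ht⟩) (P.normal ⟨t', ht'⟩) →
          s'.nat 10 t = s'.nat 10 t')
      hN rfl (fun s'' hF => (h'.frame hF hw').numT) (hJ 21 (by norm_num)) hs' (hM 21 (by norm_num))
      (fun _ _ => id) hMt
      (fun t' s s' hM hd ht' hb => hM ⟨t, ht⟩ ⟨t', ht'⟩ (hd ht' hb)) ?_).mono ?_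
    · intro t' ht' s'' hF' h21 hs''
      exact (step s'' (h'.frame hF' hw') hs'' ⟨t, ht⟩ ⟨t', ht'⟩ (by rw [hF'.nat 20 rfl]; exact h20)
        h21).mono fun _ _ ⟨h1, h2, h3⟩ => ⟨h1, h2, fun _ => h3⟩
    · rintro s'' - ⟨h1, h2, h3⟩
      exact ⟨h1, h2, fun _ => h3⟩
  · rintro s' - ⟨h1, -, h3⟩
    refine ⟨h1, fun a b hab => ?_⟩
    have h' : Relation.EqvGen (fun t t' => P.Adj t t' ∧ SameRay ℝ (P.normal t) (P.normal t')) a b :=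
      Quotient.exact hab
    clear hab
    induction h' with
    | rel x y h => exact h3 x x.2 x.2 y y.2 y.2 h
    | refl => rfl
    | symm _ _ _ ih => exact ih.symm
    | trans _ _ _ _ _ ih1 ih2 => exact ih1.trans ih2

theorem labelProg_runs (h : P.HasInput s) (hN : P.numT ≤ N) :
    labelProg.Runs N C s fun s' => ∃ σ : P.Facet → Fin P.numT, (∀ f, P.facetOf (σ f) = f) ∧
      ∀ a : Fin P.numT, s'.nat 10 a = σ (P.facetOf a) := by
  have hw : ∀ A ≤ 3, (Prog.loop true 20 numTExp (.nset 10 (var 20) (var 20))).writes A = false := by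
    decide
  refine Prog.Runs.seq (Prog.Runs.mono (Q := fun s' => ∀ a < P.numT, s'.nat 10 a = a)
    (Prog.Runs.loop (n := P.numT) (fun k s' => ∀ a < k, s'.nat 10 a = a) hN rfl
      (fun s' hF => (h.frame hF hw).numT) ?_ (by simp) ?_ fun _ _ => id) ?_)
  · intro k s' x hI
    rw [s'.setNat_nat_of_ne _ _ (by norm_num)]
    exact hI
  · intro k _ s' _ hk hI
    refine .nset fun a ha => ?_
    simp only [NExp.eval, hk, Mem.setNat_nat_same, Function.update_apply]
    split_ifs with hak
    · exact hak.symm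
    · exact hI a (by omega)
  · intro s1 hF h1
    refine (mergeProg_runs (h.frame hF hw) hN fun a => ⟨a, h1 a a.2, h1 a a.2, rfl⟩).mono ?_
    rintro s' - ⟨h2, h3⟩
    choose L hL hL' hL'' using h2
    have hout : ∀ f : P.Facet, P.facetOf (Quotient.out f) = f := fun f => Quotient.out_eq f
    refine ⟨fun f => L (Quotient.out f), fun f => (hL'' _).trans (hout f), fun a => ?_⟩
    rw [← hL]
    exact h3 _ _ (hout _).symm

end Snapping

/-! ### Numbering fingers by directed edges. -/

namespace Snapping

open Matrix

/-! ## The table of fingers -/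

variable {P : Polyhedron} {s s' : Mem} {N C : ℕ}

/-- The pair of facets at the `i`-th edge of the triangle `t` has the number `3 * t + i`. -/
noncomputable def Polyhedron.pairAt (P : Polyhedron) (k : ℕ) : P.Facet × P.Facet :=
  if h : k / 3 < P.numT then
    (P.facetOf ⟨k / 3, h⟩, P.facetOf (P.twinEdge (⟨k / 3, h⟩, ⟨k % 3, Nat.mod_lt _ (by norm_num)⟩)).1)
  else (P.facetOf ⟨0, P.numT_pos⟩, P.facetOf ⟨0, P.numT_pos⟩)

theorem Polyhedron.pairAt_eq (P : Polyhedron) (t : Fin P.numT) (i : Fin 3) :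
    P.pairAt (3 * t + i) = (P.facetOf t, P.facetOf (P.twinEdge (t, i)).1) := by
  have h1 : (3 * (t : ℕ) + i) / 3 = t := by omega
  have h2 : (3 * (t : ℕ) + i) % 3 = i := by omega
  have h3 : (⟨(3 * (t : ℕ) + i) / 3, h1.trans_lt t.2⟩ : Fin P.numT) = t := Fin.ext h1
  have h4 : (⟨(3 * (t : ℕ) + i) % 3, Nat.mod_lt _ (by norm_num)⟩ : Fin 3) = i := Fin.ext h2
  have h5 : (3 * (t : ℕ) + i) / 3 < P.numT := h1.trans_lt t.2
  rw [pairAt, dif_pos h5, h3, h4]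

/-- Neighbours share an edge, so linearly many numbers reach all fingers. A finger may have several
numbers, and some numbers give a pair of equal facets; the tests sort these out. -/
theorem Polyhedron.exists_pairAt {F : P.Facet × P.Facet} (h : P.Neighbor F.1 F.2) :
    ∃ k < 3 * P.numT, P.pairAt k = F := by
  obtain ⟨-, t, t', h1, h2, h3⟩ := h
  obtain ⟨i, rfl⟩ := P.adj_iff.1 h3
  exact ⟨3 * t + i, by omega, by rw [pairAt_eq, h1, h2]⟩

def labelExp (t : NExp) : NExp := .get 10 t

/-- Enter the pair of facets at the `i`-th edge of `t` into the tables, if `t'` is the triangle on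
the other side. -/
def entryProg (i : Fin 3) : Prog :=
  .ite (edgeExp i (var 20) (var 21))
    (.seq (.nset 11 (.add (.mul (.lit 3) (var 20)) (.lit i)) (labelExp (var 20)))
      (.seq (.nset 12 (.add (.mul (.lit 3) (var 20)) (.lit i)) (labelExp (var 21)))
        (.ite (.neq (labelExp (var 20)) (labelExp (var 21))) .skip
          (.nset 13 (.add (.mul (labelExp (var 20)) numTExp) (labelExp (var 21))) (.lit 1))))) .skip

/-- Fill the tables of the fingers and of the neighbours. -/
def tableProg : Prog :=
  .loop true 20 numTExp (.loop true 21 numTExp (.seqs ((List.finRange 3).map entryProg)))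

section

variable {σ : P.Facet → Fin P.numT}

/-- The entry number `k` of the table of fingers is correct. -/
def EntryCorrect (σ : P.Facet → Fin P.numT) (k : ℕ) (s : Mem) : Prop :=
  s.nat 11 k = σ (P.pairAt k).1 ∧ s.nat 12 k = σ (P.pairAt k).2 ∧
    (P.Neighbor (P.pairAt k).1 (P.pairAt k).2 →
      s.nat 13 (σ (P.pairAt k).1 * P.numT + σ (P.pairAt k).2) ≠ 0)

/-- Only pairs of neighbours are entered. -/
def NeighborsSound (σ : P.Facet → Fin P.numT) (s : Mem) : Prop :=
  ∀ x y : Fin P.numT, s.nat 13 (x * P.numT + y) ≠ 0 → ∃ f f', σ f = x ∧ σ f' = y ∧ P.Neighbor f f'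

/-- Correct entries stay correct. -/
def EntriesKept (σ : P.Facet → Fin P.numT) (s s' : Mem) : Prop :=
  ∀ k < 3 * P.numT, EntryCorrect σ k s → EntryCorrect σ k s'

theorem pair_injective {T : ℕ} {x y x' y' : Fin T} (h : (x : ℕ) * T + y = x' * T + y') :
    x = x' ∧ y = y' := by
  have hT : 0 < T := x.pos
  have h1 : ∀ a b : Fin T, ((a : ℕ) * T + b) / T = a := fun a b => by
    rw [add_comm, Nat.add_mul_div_right _ _ hT, Nat.div_eq_of_lt b.2, zero_add]
  have h2 : ∀ a b : Fin T, ((a : ℕ) * T + b) % T = b := fun a b => by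
    rw [add_comm, Nat.add_mul_mod_self_right, Nat.mod_eq_of_lt b.2]
  exact ⟨Fin.ext (by rw [← h1 x y, h, h1]), Fin.ext (by rw [← h2 x y, h, h2])⟩

/-- Monotonicity rests on two facts: an entry is only ever overwritten by the same correct value,
and the neighbour table only receives ones. -/
theorem entryProg_runs (hσ : ∀ f, P.facetOf (σ f) = f) (h : P.HasInput s)
    (hl : ∀ a : Fin P.numT, s.nat 10 a = σ (P.facetOf a)) {t t' : Fin P.numT} (ht : s.nat 20 0 = t)
    (ht' : s.nat 21 0 = t') (hs : NeighborsSound σ s) (i : Fin 3) :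
    (entryProg i).Runs N C s fun s' => NeighborsSound σ s' ∧ EntriesKept σ s s' ∧
      ((P.twinEdge (t, i)).1 = t' → EntryCorrect σ (3 * t + i) s') := by
  refine Prog.Runs.ite (fun hb => ?_) (fun hb => ?_)
  · rw [h.holds_edgeExp (t := var 20) (t' := var 21) ht ht'] at hb
    have hF : P.pairAt (3 * t + i) = (P.facetOf t, P.facetOf t') := by rw [P.pairAt_eq, hb]
    have hadj : P.Adj t t' := P.adj_iff.2 ⟨i, hb⟩
    have main : ∀ s', s'.nat 11 = Function.update (s.nat 11) (3 * t + i) (σ (P.facetOf t)) →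
        s'.nat 12 = Function.update (s.nat 12) (3 * t + i) (σ (P.facetOf t')) →
        (∀ n, s.nat 13 n ≠ 0 → s'.nat 13 n ≠ 0) → (P.facetOf t ≠ P.facetOf t' →
          s'.nat 13 (σ (P.facetOf t) * P.numT + σ (P.facetOf t')) ≠ 0) →
        EntriesKept σ s s' ∧ EntryCorrect σ (3 * t + i) s' := by
      intro s' h11 h12 h13 h13'
      have hc : EntryCorrect σ (3 * t + i) s' := by
        refine ⟨by rw [h11, hF, Function.update_self], by rw [h12, hF, Function.update_self], ?_⟩
        rw [hF]
        exact fun hn => h13' hn.1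
      refine ⟨fun k _ hk => ?_, hc⟩
      by_cases e : k = 3 * t + i
      · rw [e]; exact hc
      · exact ⟨by rw [h11, Function.update_of_ne e, hk.1], by rw [h12, Function.update_of_ne e, hk.2.1],
          fun hn => h13 _ (hk.2.2 hn)⟩
    refine .seq (.nset (.seq (.nset ?_)))
    set s1 := (s.setNat 11 _ _).setNat 12 _ _ with hs1
    have h11 : s1.nat 11 = Function.update (s.nat 11) (3 * t + i) (σ (P.facetOf t)) := by
      simp [hs1, Mem.setNat, NExp.eval, ht, labelExp, hl]
    have h12 : s1.nat 12 = Function.update (s.nat 12) (3 * t + i) (σ (P.facetOf t')) := by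
      simp [hs1, Mem.setNat, NExp.eval, ht, ht', labelExp, hl]
    have h13 : s1.nat 13 = s.nat 13 := by simp [hs1, Mem.setNat]
    have hlt : (labelExp (var 20)).eval s1 = σ (P.facetOf t) := by
      simp [hs1, Mem.setNat, NExp.eval, ht, labelExp, hl]
    have hlt' : (labelExp (var 21)).eval s1 = σ (P.facetOf t') := by
      simp [hs1, Mem.setNat, NExp.eval, ht', labelExp, hl]
    have hT : numTExp.eval s1 = P.numT :=
      ((h.setNat (A := 11) (by norm_num) _ _).setNat (A := 12) (by norm_num) _ _).numT
    refine .ite (fun he => .skip ?_) (fun he => .nset ?_)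
    · rw [BExp.holds_neq, hlt, hlt'] at he
      obtain ⟨h1, h2⟩ := main s1 h11 h12 (fun n hn => by rwa [h13])
        (fun hne => absurd (injective_of_section hσ (Fin.ext he)) hne)
      refine ⟨?_, h1, fun _ => h2⟩
      unfold NeighborsSound
      rw [h13]
      exact hs
    · have hne : P.facetOf t ≠ P.facetOf t' := fun e => he (by rw [BExp.holds_neq, hlt, hlt', e])
      set s2 := s1.setNat 13 _ _ with hs2
      have h13' : s2.nat 13 = Function.update (s.nat 13)
          (σ (P.facetOf t) * P.numT + σ (P.facetOf t')) 1 := by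
        rw [hs2, Mem.setNat_nat_same, h13]
        simp only [NExp.eval, hlt, hlt', hT]
      obtain ⟨h1, h2⟩ := main s2
        (by rw [hs2, Mem.setNat_nat_of_ne _ _ _ (by norm_num), h11])
        (by rw [hs2, Mem.setNat_nat_of_ne _ _ _ (by norm_num), h12])
        (fun n hn => by rw [h13', Function.update_apply]; split_ifs; exacts [one_ne_zero, hn])
        (fun _ => by rw [h13', Function.update_self]; exact one_ne_zero)
      refine ⟨fun x y hxy => ?_, h1, fun _ => h2⟩
      rw [h13', Function.update_apply] at hxy
      split_ifs at hxy with he'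
      · obtain ⟨rfl, rfl⟩ := pair_injective he'
        exact ⟨_, _, rfl, rfl, hne, t, t', rfl, rfl, hadj⟩
      · exact hs x y hxy
  · rw [h.holds_edgeExp (t := var 20) (t' := var 21) ht ht'] at hb
    exact .skip ⟨hs, fun _ _ => id, fun h => absurd h hb⟩

theorem tableProg_runs (hσ : ∀ f, P.facetOf (σ f) = f) (h : P.HasInput s)
    (hl : ∀ a : Fin P.numT, s.nat 10 a = σ (P.facetOf a)) (h13 : ∀ n, s.nat 13 n = 0)
    (hN : P.numT ≤ N) : tableProg.Runs N C s fun s' => Ready P σ P.pairAt s' := by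
  have hset : ∀ A, A = 20 ∨ A = 21 → ∀ s k x, EntryCorrect σ k (Mem.setNat s A 0 x) ↔
      EntryCorrect σ k s := by
    rintro A (rfl | rfl) s k x <;>
    · unfold EntryCorrect
      rw [s.setNat_nat_of_ne _ _ (by norm_num), s.setNat_nat_of_ne _ _ (by norm_num),
        s.setNat_nat_of_ne _ _ (by norm_num)]
  have hJ : ∀ A, A = 20 ∨ A = 21 → ∀ s x, NeighborsSound σ s → NeighborsSound σ (s.setNat A 0 x) := by
    rintro A (rfl | rfl) s x h <;>
    · unfold NeighborsSound
      rw [s.setNat_nat_of_ne _ _ (by norm_num)]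
      exact h
  have hM : ∀ A, A = 20 ∨ A = 21 → ∀ s x, EntriesKept σ s (s.setNat A 0 x) :=
    fun A hA s x k _ hk => (hset A hA s k x).2 hk
  have hMt : ∀ {a b c}, EntriesKept σ a b → EntriesKept σ b c → EntriesKept σ a c :=
    fun h1 h2 k hk h => h2 k hk (h1 k hk h)
  have hw : ∀ A ≤ 3, tableProg.writes A = false := by decide
  refine (Prog.Runs.loop_rel (N := N) (C := C) (l := true) (n := P.numT) (J := NeighborsSound σ)
    (M := EntriesKept σ)
    (D := fun t s' => ∀ ht : t < P.numT, ∀ t' < P.numT, ∀ i : Fin 3,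
      (P.twinEdge (⟨t, ht⟩, i)).1 = t' → EntryCorrect σ (3 * t + i) s')
    hN rfl (fun s' hF => (h.frame hF hw).numT) (hJ 20 (.inl rfl)) (fun x y hxy => absurd (h13 _) hxy)
    (hM 20 (.inl rfl)) (fun _ _ => id) hMt
    (fun t s s' hM hd ht t' h1 i hb => hM _ (by omega) (hd ht t' h1 i hb)) ?_).mono ?_
  · intro t ht s1 hF h20 hs1
    have h1 := h.frame hF hw
    have hw' : ∀ A ≤ 3, (Prog.loop true 21 numTExp
      (.seqs ((List.finRange 3).map entryProg))).writes A = false := by decide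
    refine (Prog.Runs.loop_rel (N := N) (C := C) (l := true) (n := P.numT) (J := NeighborsSound σ)
      (M := EntriesKept σ)
      (D := fun t' s' => ∀ i : Fin 3,
        (P.twinEdge (⟨t, ht⟩, i)).1 = t' → EntryCorrect σ (3 * t + i) s')
      hN rfl (fun s'' hF => (h1.frame hF hw').numT) (hJ 21 (.inr rfl)) hs1 (hM 21 (.inr rfl))
      (fun _ _ => id) hMt (fun t' s s' hM hd i hb => hM _ (by omega) (hd i hb)) ?_).mono ?_
    · intro t' ht' s2 hF' h21 hs2
      have h2 := h1.frame hF' hw'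
      refine (Prog.Runs.seqs_rel (J := NeighborsSound σ) (M := EntriesKept σ)
        (D := fun i s' => (P.twinEdge (⟨t, ht⟩, i)).1 = t' → EntryCorrect σ (3 * t + i) s')
        _ hs2 (fun _ _ _ => id) hMt (fun i s s' hM hd hb => hM _ (by omega) (hd hb)) ?_).mono ?_
      · intro i _ s3 hF'' hs3
        refine (entryProg_runs (t := ⟨t, ht⟩) (t' := ⟨t', ht'⟩) hσ (h2.frame hF'' (by decide)) ?_ ?_ ?_
          hs3 i).mono ?_
        · rw [hF''.nat 10 (by decide), hF'.nat 10 (by decide), hF.nat 10 (by decide)]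
          exact hl
        · rw [hF''.nat 20 (by decide), hF'.nat 20 (by decide), h20]
        · rw [hF''.nat 21 (by decide), h21]
        · rintro s4 - ⟨h4, h5, h6⟩
          exact ⟨h4, h5, fun hb => h6 (Fin.ext hb)⟩
      · rintro s3 - ⟨h4, h5, h6⟩
        exact ⟨h4, h5, fun i => h6 i (List.mem_finRange i)⟩
    · rintro s2 - ⟨h4, h5, h6⟩
      exact ⟨h4, h5, fun _ => h6⟩
  · rintro s' hF ⟨h4, -, h6⟩
    have hc : ∀ k < 3 * P.numT, EntryCorrect σ k s' := by
      intro k hk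
      have := h6 (k / 3) (by omega) (by omega) _ (P.twinEdge (⟨k / 3, by omega⟩,
        ⟨k % 3, Nat.mod_lt _ (by norm_num)⟩)).1.2 ⟨k % 3, Nat.mod_lt _ (by norm_num)⟩ rfl
      simpa [Nat.div_add_mod] using this
    have hi := h.frame hF hw
    refine { real := hi.real, nat := hi.nat, body := fun k hk => (hc k hk).1,
             tip := fun k hk => (hc k hk).2.1, neighbor := fun x y => ⟨h4 x y, ?_⟩ }
    rintro ⟨f, f', rfl, rfl, hn⟩
    obtain ⟨k, hk, e⟩ := P.exists_pairAt (F := (f, f')) hn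
    have := (hc k hk).2.2
    rw [e] at this
    exact this hn

end

end Snapping

/-! ### Exhaustive search, and scans for an extremal finger. -/

namespace Snapping

open Matrix

/-! ## The search for fixtures with one, two and four fingers -/

variable {P : Polyhedron} {σ : P.Facet → Fin P.numT} {φ : ℕ → P.Facet × P.Facet} {K N C : ℕ}
  {s s' : Mem}

theorem search_register {i : ℕ} {e : NExp} {p : Prog} {n : ℕ} {D : ℕ → Prop}
    (he : ∀ s, P.HasInput s → e.eval s = n) (hn : n ≤ N) (hi : ¬ Protected i)
    (hi' : p.writes i = false) (hw : ∀ A ≤ 3, (Prog.loop true i e p).writes A = false)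
    (hs : Searching P σ φ K s)
    (step : ∀ k < n, ∀ s', (Prog.loop true i e p).Frame s s' → s'.nat i 0 = k →
      Searching P σ φ K s' → p.Runs N C s' (Prog.Searched (Searching P σ φ K) (D k) s')) :
    (Prog.loop true i e p).Runs N C s
      (Prog.Searched (Searching P σ φ K) (∀ k < n, D k) s) :=
  Prog.Runs.search_loop hn hi' (fun _ hF => he _ (hs.ready.toHasInput.frame hF hw))
    (fun e => hi (by subst e; decide)) (fun _ _ h => h.setNat hi _ _) hs step

/-- Valid fixtures have at least `K` fingers, and none has exactly `K`, unless something was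
reported. -/
theorem Searching.succ {s₀ : Mem}
    (h : Prog.Searched (Searching P σ φ K) (∀ G : Fixture P, G.Valid → G.fingers.card ≠ K) s₀ s) :
    Searching P σ φ (K + 1) s := by
  obtain ⟨h1, -, h2⟩ := h
  refine ⟨h1.ready, h1.answered, ?_⟩
  rcases h2 with h2 | h2
  · exact .inl h2
  · exact h1.none.imp_right fun h G hG => lt_of_le_of_ne (h G hG) (h2 G hG).symm

theorem Fixture.Valid.exists_numbers (hσ : ∀ f, P.facetOf (σ f) = f) {G : Fixture P} (h : G.Valid)
    (h4 : G.fingers.card ≤ 4) : ∃ k : Fin 4 → ℕ, (∀ j, k j < 3 * P.numT) ∧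
      Padded G.fingers.card k ∧
      Candidate (fun f => P.normal (σ f)) G.fingers.card G.palm fun j => P.pairAt (k j) := by
  obtain ⟨F, hF, hpad, -⟩ := h.exists_candidate (normalField hσ) h4
  have := fun j => P.exists_pairAt (hF.finger j).tip
  choose k hk hk' using this
  have e : ∀ j : Fin 4, P.pairAt (if G.fingers.card ≤ j then k 0 else k j) = F j := by
    intro j
    split_ifs with hj
    · rw [hk', hpad j hj]
    · exact hk' j
  refine ⟨fun j => if G.fingers.card ≤ j then k 0 else k j, fun j => ?_, fun j hj => ?_, ?_⟩
  · dsimp only; split_ifs <;> exact hk _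
  · simp [hj]
  · simpa only [e] using hF

def searchOne : Prog :=
  .loop true 20 numTExp (.loop true 21 numHExp (testProg 1 20 ![21, 21, 21, 21]))

def searchTwo : Prog :=
  .loop true 20 numTExp (.loop true 21 numHExp (.loop true 22 numHExp
    (testProg 2 20 ![21, 22, 21, 21])))

theorem searchOne_runs (hσ : ∀ f, P.facetOf (σ f) = f) (hN : 3 * P.numT ≤ N)
    (hs : Searching P σ P.pairAt 1 s) :
    searchOne.Runs N C s fun s' => Searching P σ P.pairAt 2 s' := by
  refine (search_register (D := fun a => ∀ k < 3 * P.numT, ∀ f, σ f = a →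
      ¬ Candidate (fun f => P.normal (σ f)) 1 f fun _ => P.pairAt k)
    (fun _ h => h.numT) (by omega) (by decide) rfl (by decide) hs ?_).mono ?_
  · intro a ha s1 _ h20 hs1
    refine search_register (fun _ h => h.numH) hN (by decide) rfl (by decide) hs1 ?_
    intro k hk s2 hF h21 hs2
    rw [← hF.nat 20 rfl] at h20
    refine (testProg_runs (a := ⟨a, ha⟩) hσ hs2 (by decide) (by decide) (by norm_num) (by norm_num)
      h20 ?_ (by decide)).mono fun _ _ h => h.mono fun h f hf => ?_
    · simpa [Fin.forall_fin_succ, h21] using hk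
    · have := h f (Fin.ext hf)
      have e : ∀ j : Fin 4, s2.nat (![21, 21, 21, 21] j) 0 = k := by
        simpa [Fin.forall_fin_succ] using h21
      simpa only [e] using this
  · intro s' _ h
    refine Searching.succ (h.mono fun h G hG h1 => ?_)
    obtain ⟨k, hk, hpad, hc⟩ := hG.exists_numbers hσ (by omega)
    rw [h1] at hpad hc
    refine h _ (σ G.palm).2 (k 0) (hk 0) _ rfl ?_
    convert hc using 3 with j
    fin_cases j
    · rfl
    · exact (hpad 1 (by decide)).symm
    · exact (hpad 2 (by decide)).symm
    · exact (hpad 3 (by decide)).symm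

theorem searchTwo_runs (hσ : ∀ f, P.facetOf (σ f) = f) (hN : 3 * P.numT ≤ N)
    (hs : Searching P σ P.pairAt 2 s) :
    searchTwo.Runs N C s fun s' => Searching P σ P.pairAt 3 s' := by
  refine (search_register (D := fun a => ∀ k < 3 * P.numT, ∀ l < 3 * P.numT, ∀ f, σ f = a →
      ¬ Candidate (fun f => P.normal (σ f)) 2 f fun j => P.pairAt (![k, l, k, k] j))
    (fun _ h => h.numT) (by omega) (by decide) rfl (by decide) hs ?_).mono ?_
  · intro a ha s1 _ h20 hs1
    refine search_register (fun _ h => h.numH) hN (by decide) rfl (by decide) hs1 ?_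
    intro k hk s2 hF h21 hs2
    refine search_register (fun _ h => h.numH) hN (by decide) rfl (by decide) hs2 ?_
    intro l hl s3 hF' h22 hs3
    rw [← hF.nat 20 rfl, ← hF'.nat 20 rfl] at h20
    rw [← hF'.nat 21 rfl] at h21
    refine (testProg_runs (a := ⟨a, ha⟩) hσ hs3 (by decide) (by decide) (by norm_num) (by norm_num)
      h20 ?_ (by decide)).mono fun _ _ h => h.mono fun h f hf => ?_
    · simpa [Fin.forall_fin_succ, h21, h22] using ⟨hk, hl, hk⟩
    · have := h f (Fin.ext hf)
      have e : ∀ j : Fin 4, s3.nat (![21, 22, 21, 21] j) 0 = ![k, l, k, k] j := by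
        simpa [Fin.forall_fin_succ] using ⟨h21, h22, h21⟩
      simpa only [e] using this
  · intro s' _ h
    refine Searching.succ (h.mono fun h G hG h1 => ?_)
    obtain ⟨k, hk, hpad, hc⟩ := hG.exists_numbers hσ (by omega)
    rw [h1] at hpad hc
    refine h _ (σ G.palm).2 (k 0) (hk 0) (k 1) (hk 1) _ rfl ?_
    convert hc using 3 with j
    fin_cases j
    · rfl
    · rfl
    · exact (hpad 2 (by decide)).symm
    · exact (hpad 3 (by decide)).symm

/-! ### Scanning the fingers for an extremal one -/

/-- Find, among the fingers that satisfy a condition, one with the largest key. -/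
def scanProg (A : ℕ) (cond : NExp → BExp) (key : NExp → RExp) : Prog :=
  .seq (.nset A (.lit 0) (.lit 0)) (.loop true 25 numHExp
    (.ite (.and (cond (var 25)) (.or (.not (cond (var A))) (.rlt (key (var A)) (key (var 25)))))
      (.nset A (.lit 0) (var 25)) .skip))

theorem scanProg_writes {A B : ℕ} {cond : NExp → BExp} {key : NExp → RExp} (h : B ≠ A)
    (h' : B ≠ 25) : (scanProg A cond key).writes B = false := by
  simp [scanProg, Prog.writes, h, h']

/-- The current choice starts at number 0 whether or not it satisfies the condition; a choice that
does not is replaced by the first number that does. The result is thus always a legal number, but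
meaningful only if some number qualifies. -/
theorem scanProg_runs (h : P.HasInput s) (hN : 3 * P.numT ≤ N) {A : ℕ} (hA : 25 < A)
    {cond : NExp → BExp} {key : NExp → RExp} {c : ℕ → Prop} {κ : ℕ → ℝ}
    (hc : ∀ s' B, (∀ D, D ≠ A → D ≠ 25 → s'.nat D = s.nat D) → s'.real = s.real →
      s'.nat B 0 < 3 * P.numT → ((cond (var B)).Holds s' ↔ c (s'.nat B 0)))
    (hκ : ∀ s' B, (∀ D, D ≠ A → D ≠ 25 → s'.nat D = s.nat D) → s'.real = s.real →
      s'.nat B 0 < 3 * P.numT → (key (var B)).eval s' = κ (s'.nat B 0)) :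
    (scanProg A cond key).Runs N C s fun s' => s'.nat A 0 < 3 * P.numT ∧
      ((∃ k < 3 * P.numT, c k) → c (s'.nat A 0) ∧ ∀ k < 3 * P.numT, c k → κ k ≤ κ (s'.nat A 0)) := by
  have hT := P.numT_pos
  refine Prog.Runs.seq (.nset ?_)
  set s0 := s.setNat A _ _ with hs0
  have h0 : P.HasInput s0 := h.setNat (by omega) _ _
  have hw : ∀ B, B ≠ A → B ≠ 25 → (Prog.loop true 25 numHExp
      (.ite (.and (cond (var 25)) (.or (.not (cond (var A))) (.rlt (key (var A)) (key (var 25)))))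
        (.nset A (.lit 0) (var 25)) .skip)).writes B = false := by
    intro B hB hB'
    simp [Prog.writes, hB, hB']
  refine Prog.Runs.loop (n := 3 * P.numT) (fun k s' => s'.nat A 0 < 3 * P.numT ∧
    ((∃ k' < k, c k') → c (s'.nat A 0) ∧ ∀ k' < k, c k' → κ k' ≤ κ (s'.nat A 0))) hN ?_ ?_ ?_ ?_ ?_
    (fun _ _ h => h)
  · simp [Prog.writes]; omega
  · exact fun s' hF => (h0.frame hF fun B hB => hw B (by omega) (by omega)).numH
  · intro k s' x hI
    rwa [Mem.setNat_nat_of_ne _ _ _ (by omega)]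
  · simp [hs0, NExp.eval, hT]
  · rintro k hk s1 hF h25 ⟨h1, h2⟩
    have hn : ∀ D, D ≠ A → D ≠ 25 → s1.nat D = s.nat D := fun D hD hD' => by
      rw [hF.nat D (hw D hD hD'), hs0, Mem.setNat_nat_of_ne _ _ _ hD]
    have hr : s1.real = s.real := hF.real
    have c25 := hc s1 25 hn hr (h25.trans_lt hk)
    have cA := hc s1 A hn hr h1
    have k25 := hκ s1 25 hn hr (h25.trans_lt hk)
    have kA := hκ s1 A hn hr h1
    rw [h25] at c25 k25
    refine Prog.Runs.ite (fun hb => .nset ?_) (fun hb => .skip ?_)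
    · simp only [BExp.holds_and, BExp.holds_or, BExp.holds_not, BExp.holds_rlt, c25, cA, k25, kA] at hb
      have e : (s1.setNat A ((NExp.lit 0).eval s1) ((var 25).eval s1)).nat A 0 = k := by
        simp [NExp.eval, h25]
      rw [e]
      refine ⟨hk, fun _ => ⟨hb.1, fun k' hk' hck' => ?_⟩⟩
      rcases Nat.lt_succ_iff_lt_or_eq.1 hk' with h | rfl
      · obtain ⟨h3, h4⟩ := h2 ⟨k', h, hck'⟩
        rcases hb.2 with h5 | h5
        · exact absurd h3 h5
        · exact (h4 k' h hck').trans h5.le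
      · exact le_rfl
    · simp only [BExp.holds_and, BExp.holds_or, BExp.holds_not, BExp.holds_rlt, c25, cA, k25, kA,
        not_and, not_or, not_not, not_lt] at hb
      refine ⟨h1, ?_⟩
      rintro ⟨k', hk', hck'⟩
      by_cases hck : c k
      · obtain ⟨h3, h4⟩ := hb hck
        refine ⟨h3, fun k'' hk'' hck'' => ?_⟩
        rcases Nat.lt_succ_iff_lt_or_eq.1 hk'' with h | rfl
        · exact (h2 ⟨k'', h, hck''⟩).2 k'' h hck''
        · exact h4
      · have hlt : ∀ l < k + 1, c l → l < k := fun l hl hcl =>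
          lt_of_le_of_ne (Nat.lt_succ_iff.1 hl) fun e => hck (e ▸ hcl)
        obtain ⟨h3, h4⟩ := h2 ⟨k', hlt k' hk' hck', hck'⟩
        exact ⟨h3, fun l hl hcl => h4 l (hlt l hl hcl) hcl⟩

end Snapping

/-! ### Finding the replaceable fingers on either side of a plane. -/

namespace Snapping

open Matrix

variable {P : Polyhedron} {σ : P.Facet → Fin P.numT} {φ : ℕ → P.Facet × P.Facet} {K N C : ℕ}
  {s s' : Mem}

/-- The variables `20` and `23` hold the palm and a finger. -/
structure WithFinger (P : Polyhedron) (σ : P.Facet → Fin P.numT) (φ : ℕ → P.Facet × P.Facet)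
    (a : Fin P.numT) (k₃ : ℕ) (s : Mem) : Prop where
  ready : Ready P σ φ s
  palm : s.nat 20 0 = a
  third : s.nat 23 0 = k₃
  lt : k₃ < 3 * P.numT

/-- The normal of the palm. -/
def palmNormal : VExp := normalExp (var 20)

/-- The normal of the body of the finger in the variable `23`. -/
def thirdNormal : VExp := normalExp (bodyExp (var 23))

def scanDirectionExp : Fin 4 → VExp :=
  ![(palmNormal.cross thirdNormal).cross palmNormal, palmNormal.cross (palmNormal.cross thirdNormal),
    (palmNormal.cross thirdNormal).cross thirdNormal, thirdNormal.cross (palmNormal.cross thirdNormal)]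

/-- The body is on the positive side of `u`. -/
def slopeCond (u : VExp) (k : NExp) : BExp :=
  .and (fingerExp (var 20) k) (.rlt (.lit 0) (u.dot (normalExp (bodyExp k))))

def slopeKey (u z : VExp) (k : NExp) : RExp :=
  .div (.sub (.lit 0) (z.dot (normalExp (bodyExp k)))) (u.dot (normalExp (bodyExp k)))

/-- The finger has a body parallel to `u`, a tip on the positive side, and a body different from those
of the third finger and of the fingers in the given variables. -/
def repCond (u : VExp) (L : List ℕ) (k : NExp) : BExp :=
  .and (fingerExp (var 20) k) (.and (.not (.neq (bodyExp k) (bodyExp (var 23))))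
    (.and (.req (u.dot (normalExp (bodyExp k))) (.lit 0))
    (.and (.rlt (.lit 0) (u.dot (normalExp (tipExp k))))
    (.all (L.map fun r => .not (.neq (bodyExp (var r)) (bodyExp k)))))))

theorem WithFinger.congr {a : Fin P.numT} {k₃ : ℕ} (h : WithFinger P σ φ a k₃ s)
    (hn : ∀ D, D ≤ 24 → s'.nat D = s.nat D) (hr : s'.real = s.real) : WithFinger P σ φ a k₃ s' :=
  ⟨h.ready.congr (fun D hD _ => hn D (by unfold Protected at hD; omega)) hr,
    by rw [hn 20 (by norm_num), h.palm], by rw [hn 23 (by norm_num), h.third], h.lt⟩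

theorem scan_slope {a : Fin P.numT} {k₃ : ℕ} (hσ : ∀ f, P.facetOf (σ f) = f) (hN : 3 * P.numT ≤ N)
    (h : WithFinger P σ P.pairAt a k₃ s) {u z : VExp} {U Z : Fin 3 → ℝ}
    (hu : ∀ s', WithFinger P σ P.pairAt a k₃ s' → u.eval s' = U)
    (hz : ∀ s', WithFinger P σ P.pairAt a k₃ s' → z.eval s' = Z) {A : ℕ} (hA : 25 < A) :
    (scanProg A (slopeCond u) (slopeKey u z)).Runs N C s fun s' => s'.nat A 0 < 3 * P.numT ∧
      ∀ f, σ f = a → ∀ F, P.Finger f F → 0 < U ⬝ᵥ P.normal (σ F.1) →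
        P.Finger f (P.pairAt (s'.nat A 0)) ∧ 0 < U ⬝ᵥ P.normal (σ (P.pairAt (s'.nat A 0)).1) ∧
        -(Z ⬝ᵥ P.normal (σ F.1)) / (U ⬝ᵥ P.normal (σ F.1)) ≤
          -(Z ⬝ᵥ P.normal (σ (P.pairAt (s'.nat A 0)).1)) /
            (U ⬝ᵥ P.normal (σ (P.pairAt (s'.nat A 0)).1)) := by
  have hinj := injective_of_section hσ
  refine (scanProg_runs (c := fun k => (∃ f, σ f = a ∧ P.Finger f (P.pairAt k)) ∧
    0 < U ⬝ᵥ P.normal (σ (P.pairAt k).1)) (κ := fun k => -(Z ⬝ᵥ P.normal (σ (P.pairAt k).1)) /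
      (U ⬝ᵥ P.normal (σ (P.pairAt k).1))) h.ready.toHasInput hN hA ?_ ?_).mono ?_
  · intro s1 B hn hr hB
    have h1 : WithFinger P σ P.pairAt a k₃ s1 :=
      h.congr (fun D hD => hn D (by omega) (by omega)) hr
    simp only [slopeCond, BExp.holds_and, h1.ready.holds_fingerExp hσ (p := var 20) h1.palm
      (k := var B) hB, BExp.holds_rlt, RExp.eval, Int.cast_zero, VExp.eval_dot, hu s1 h1,
      h1.ready.normalExp (h1.ready.evalBody (k := var B) hB)]
    rfl
  · intro s1 B hn hr hB
    have h1 : WithFinger P σ P.pairAt a k₃ s1 :=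
      h.congr (fun D hD => hn D (by omega) (by omega)) hr
    simp only [slopeKey, RExp.eval, Int.cast_zero, VExp.eval_dot, hu s1 h1, hz s1 h1, zero_sub,
      h1.ready.normalExp (h1.ready.evalBody (k := var B) hB)]
    rfl
  · rintro s1 - ⟨h1, h2⟩
    refine ⟨h1, fun f hf F hF hpos => ?_⟩
    obtain ⟨k, hk, rfl⟩ := P.exists_pairAt hF.tip
    obtain ⟨⟨⟨f', hf', h3⟩, h4⟩, h5⟩ := h2 ⟨k, hk, ⟨f, hf, hF⟩, hpos⟩
    rw [hinj (hf'.trans hf.symm)] at h3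
    exact ⟨h3, h4, h5 k hk ⟨⟨f, hf, hF⟩, hpos⟩⟩

/-- A constant key turns the search for a maximum into one for any finger satisfying the condition.
The list `L` holds the variables of earlier representatives, whose bodies are to be avoided. -/
theorem scan_rep {a : Fin P.numT} {k₃ : ℕ} (hσ : ∀ f, P.facetOf (σ f) = f) (hN : 3 * P.numT ≤ N)
    (h : WithFinger P σ P.pairAt a k₃ s) {u : VExp} {U : Fin 3 → ℝ}
    (hu : ∀ s', WithFinger P σ P.pairAt a k₃ s' → u.eval s' = U) {A : ℕ} (hA : 25 < A) {L : List ℕ}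
    (hL : ∀ r ∈ L, r ≠ A ∧ r ≠ 25 ∧ s.nat r 0 < 3 * P.numT) :
    (scanProg A (repCond u L) fun _ => .lit 0).Runs N C s fun s' => s'.nat A 0 < 3 * P.numT ∧
      ∀ f, σ f = a → ∀ F, TipSide (fun f => P.normal (σ f)) f (P.pairAt k₃) U F →
        (∀ r ∈ L, (P.pairAt (s.nat r 0)).1 ≠ F.1) →
        TipSide (fun f => P.normal (σ f)) f (P.pairAt k₃) U (P.pairAt (s'.nat A 0)) ∧
        ∀ r ∈ L, (P.pairAt (s.nat r 0)).1 ≠ (P.pairAt (s'.nat A 0)).1 := by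
  have hinj := injective_of_section hσ
  refine (scanProg_runs (c := fun k => (∃ f, σ f = a ∧ P.Finger f (P.pairAt k)) ∧
    (P.pairAt k).1 ≠ (P.pairAt k₃).1 ∧ U ⬝ᵥ P.normal (σ (P.pairAt k).1) = 0 ∧
    0 < U ⬝ᵥ P.normal (σ (P.pairAt k).2) ∧ ∀ r ∈ L, (P.pairAt (s.nat r 0)).1 ≠ (P.pairAt k).1)
    (κ := fun _ => 0) h.ready.toHasInput hN hA ?_ ?_).mono ?_
  · intro s1 B hn hr hB
    have h1 : WithFinger P σ P.pairAt a k₃ s1 :=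
      h.congr (fun D hD => hn D (by omega) (by omega)) hr
    have e3 : (bodyExp (var 23)).eval s1 = σ (P.pairAt k₃).1 := by
      have := h1.ready.evalBody (k := var 23) (by simpa [NExp.eval, h1.third] using h1.lt)
      simpa only [NExp.eval, h1.third] using this
    have eB : (bodyExp (var B)).eval s1 = σ (P.pairAt (s1.nat B 0)).1 := h1.ready.evalBody hB
    have hne : ∀ g g' : P.Facet, (σ g : ℕ) = σ g' ↔ g = g' := fun g g' =>
      ⟨fun e => hinj (Fin.ext e), fun e => by rw [e]⟩
    have hr : ∀ r ∈ L, (BExp.not (.neq (bodyExp (var r)) (bodyExp (var B)))).Holds s1 ↔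
        (P.pairAt (s.nat r 0)).1 ≠ (P.pairAt (s1.nat B 0)).1 := by
      intro r hr
      obtain ⟨h2, h3, h4⟩ := hL r hr
      have e : s1.nat r = s.nat r := hn r h2 h3
      have er : (bodyExp (var r)).eval s1 = σ (P.pairAt (s.nat r 0)).1 := by
        have := h1.ready.evalBody (k := var r) (by simpa [NExp.eval, e] using h4)
        simpa only [NExp.eval, e] using this
      rw [BExp.holds_not, BExp.holds_neq, er, eB, hne]
    have hall : (∀ b ∈ L.map fun r => BExp.not (.neq (bodyExp (var r)) (bodyExp (var B))),
        b.Holds s1) ↔ ∀ r ∈ L, (P.pairAt (s.nat r 0)).1 ≠ (P.pairAt (s1.nat B 0)).1 := by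
      simp only [List.mem_map, forall_exists_index, and_imp, forall_apply_eq_imp_iff₂]
      exact forall₂_congr hr
    simp only [repCond, BExp.holds_and, h1.ready.holds_fingerExp hσ (p := var 20) h1.palm
      (k := var B) hB, BExp.holds_rlt, BExp.holds_req, BExp.holds_all, RExp.eval, Int.cast_zero,
      VExp.eval_dot, hu s1 h1, h1.ready.normalExp (h1.ready.evalBody (k := var B) hB),
      h1.ready.normalExp (h1.ready.evalTip (k := var B) hB), hall, BExp.holds_not, BExp.holds_neq,
      e3, eB, hne]
    rfl
  · intro s1 B _ _ _
    simp [RExp.eval]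
  · rintro s1 - ⟨h1, h2⟩
    refine ⟨h1, fun f hf F hF hr => ?_⟩
    obtain ⟨k, hk, rfl⟩ := P.exists_pairAt hF.finger.tip
    obtain ⟨⟨⟨f', hf', h3⟩, h4, h5, h6, h7⟩, -⟩ :=
      h2 ⟨k, hk, ⟨f, hf, hF.finger⟩, hF.ne, hF.body, hF.tip, hr⟩
    rw [hinj (hf'.trans hf.symm)] at h3
    exact ⟨⟨h3, h4, h5, h6⟩, h7⟩

/-- Search the fingers on the positive side of `u`, and store them in the seven variables from `B` on. -/
def halfScanProg (u : VExp) (B : ℕ) : Prog :=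
  .seqs [scanProg B (slopeCond u) (slopeKey u (scanDirectionExp 0)),
    scanProg (B + 1) (slopeCond u) (slopeKey u (scanDirectionExp 1)),
    scanProg (B + 2) (slopeCond u) (slopeKey u (scanDirectionExp 2)),
    scanProg (B + 3) (slopeCond u) (slopeKey u (scanDirectionExp 3)),
    scanProg (B + 4) (repCond u []) (fun _ => .lit 0),
    scanProg (B + 5) (repCond u [B + 4]) (fun _ => .lit 0),
    scanProg (B + 6) (repCond u [B + 4, B + 5]) (fun _ => .lit 0)]

theorem halfScanProg_writes {u : VExp} {B A : ℕ} (h : A < B ∨ B + 6 < A) (h' : A ≠ 25) :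
    (halfScanProg u B).writes A = false := by
  simp only [halfScanProg, Prog.seqs, Prog.writes, Bool.or_false, Bool.or_eq_false_iff]
  refine ⟨?_, ?_, ?_, ?_, ?_, ?_, ?_⟩ <;> exact scanProg_writes (by omega) h'

theorem halfScanProg_runs {a : Fin P.numT} {k₃ : ℕ} (hσ : ∀ f, P.facetOf (σ f) = f)
    (hN : 3 * P.numT ≤ N) (h : WithFinger P σ P.pairAt a k₃ s) {u : VExp} {U : Fin 3 → ℝ}
    {Z : Fin 4 → Fin 3 → ℝ} (hu : ∀ s', WithFinger P σ P.pairAt a k₃ s' → u.eval s' = U)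
    (hz : ∀ i s', WithFinger P σ P.pairAt a k₃ s' → (scanDirectionExp i).eval s' = Z i) {B : ℕ}
    (hB : 25 < B) :
    (halfScanProg u B).Runs N C s fun s' => (∀ i : Fin 7, s'.nat (B + i) 0 < 3 * P.numT) ∧
      ∀ f, σ f = a → HalfScan (fun f => P.normal (σ f)) f (P.pairAt k₃) U Z
        (fun i => P.pairAt (s'.nat (B + i) 0)) (fun i => P.pairAt (s'.nat (B + 4 + i) 0)) := by
  have keep : ∀ {A : ℕ} {cond : NExp → BExp} {key : NExp → RExp} {s s' : Mem},
      (scanProg A cond key).Frame s s' → ∀ D, D ≠ A → D ≠ 25 → s'.nat D = s.nat D :=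
    fun hF D hD hD' => hF.nat D (scanProg_writes hD hD')
  have next : ∀ {A : ℕ} {cond : NExp → BExp} {key : NExp → RExp} {s s' : Mem}, B ≤ A →
      (scanProg A cond key).Frame s s' → WithFinger P σ P.pairAt a k₃ s →
      WithFinger P σ P.pairAt a k₃ s' :=
    fun hA hF h => h.congr (fun D hD => keep hF D (by omega) (by omega)) hF.real
  refine Prog.Runs.seqs_cons ((scan_slope hσ hN h hu (hz 0) hB).mono fun s1 hF1 r1 => ?_)
  have h1 := next (by omega) hF1 h
  refine Prog.Runs.seqs_cons ((scan_slope hσ hN h1 hu (hz 1) (by omega)).mono fun s2 hF2 r2 => ?_)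
  have h2 := next (by omega) hF2 h1
  refine Prog.Runs.seqs_cons ((scan_slope hσ hN h2 hu (hz 2) (by omega)).mono fun s3 hF3 r3 => ?_)
  have h3 := next (by omega) hF3 h2
  refine Prog.Runs.seqs_cons ((scan_slope hσ hN h3 hu (hz 3) (by omega)).mono fun s4 hF4 r4 => ?_)
  have h4 := next (by omega) hF4 h3
  refine Prog.Runs.seqs_cons ((scan_rep hσ hN h4 hu (by omega) (L := []) (by simp)).mono
    fun s5 hF5 r5 => ?_)
  have h5 := next (by omega) hF5 h4
  refine Prog.Runs.seqs_cons ((scan_rep hσ hN h5 hu (by omega) (L := [B + 4]) (by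
    simp only [List.mem_singleton, forall_eq]
    exact ⟨by omega, by omega, r5.1⟩)).mono fun s6 hF6 r6 => ?_)
  have h6 := next (by omega) hF6 h5
  have e64 : s6.nat (B + 4) = s5.nat (B + 4) := keep hF6 _ (by omega) (by omega)
  refine Prog.Runs.seqs_cons ((scan_rep hσ hN h6 hu (by omega) (L := [B + 4, B + 5]) (by
    simp only [List.mem_cons, List.not_mem_nil, or_false, forall_eq_or_imp, forall_eq]
    exact ⟨⟨by omega, by omega, e64 ▸ r5.1⟩, by omega, by omega, r6.1⟩)).mono fun s7 hF7 r7 => ?_)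
  refine Prog.Runs.seqs_nil ?_
  have e0 : s7.nat B = s1.nat B := by
    rw [keep hF7, keep hF6, keep hF5, keep hF4, keep hF3, keep hF2] <;> omega
  have e1 : s7.nat (B + 1) = s2.nat (B + 1) := by
    rw [keep hF7, keep hF6, keep hF5, keep hF4, keep hF3] <;> omega
  have e2 : s7.nat (B + 2) = s3.nat (B + 2) := by
    rw [keep hF7, keep hF6, keep hF5, keep hF4] <;> omega
  have e3 : s7.nat (B + 3) = s4.nat (B + 3) := by
    rw [keep hF7, keep hF6, keep hF5] <;> omega
  have e4 : s7.nat (B + 4) = s5.nat (B + 4) := by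
    rw [keep hF7, keep hF6] <;> omega
  have e5 : s7.nat (B + 5) = s6.nat (B + 5) := by
    rw [keep hF7] <;> omega
  rw [← e0] at r1
  rw [← e1] at r2
  rw [← e2] at r3
  rw [← e3] at r4
  rw [← e4] at r5
  simp only [List.mem_cons, List.not_mem_nil, or_false, forall_eq_or_imp, forall_eq] at r6 r7
  rw [← e5] at r6
  rw [← e4] at r6
  rw [← e5, e64, ← e4] at r7
  refine ⟨fun i => ?_, fun f hf => ⟨fun i F hF hpos => ?_, fun i F hF hne => ?_⟩⟩
  · fin_cases i
    exacts [r1.1, r2.1, r3.1, r4.1, r5.1, r6.1, r7.1]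
  · fin_cases i
    exacts [r1.2 f hf F hF hpos, r2.2 f hf F hF hpos, r3.2 f hf F hF hpos, r4.2 f hf F hF hpos]
  · fin_cases i
    · exact ⟨(r5.2 f hf F hF (by simp)).1, fun j hj => absurd hj (Fin.not_lt_zero j)⟩
    · obtain ⟨h7, h8⟩ := r6.2 f hf F hF (by
        simpa using hne 0 (by decide))
      refine ⟨h7, fun j hj => ?_⟩
      obtain rfl : j = 0 := by revert hj; revert j; decide
      exact h8
    · obtain ⟨h7, h8⟩ := r7.2 f hf F hF (by
        simpa using ⟨hne 0 (by decide), hne 1 (by decide)⟩)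
      refine ⟨h7, fun j hj => ?_⟩
      obtain rfl | rfl : j = 0 ∨ j = 1 := by revert hj; revert j; decide
      exacts [h8.1, h8.2]

/-- Test all pairs of fingers on the two sides, together with the fingers in the variables `23` and
`24`. -/
def pairsProg : Prog :=
  .seqs ((List.finRange 7 ×ˢ List.finRange 7).map fun ij : Fin 7 × Fin 7 =>
    testProg 4 20 ![30 + ij.1, 40 + ij.2, 23, 24])

def searchFour : Prog :=
  .loop true 20 numTExp (.loop true 23 numHExp (.seq (halfScanProg (palmNormal.cross thirdNormal) 30)
    (.seq (halfScanProg (thirdNormal.cross palmNormal) 40) (.loop true 24 numHExp pairsProg))))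

theorem seqs_map_writes {α : Type*} {f : α → Prog} {A : ℕ} (h : ∀ a, (f a).writes A = false)
    (L : List α) : (Prog.seqs (L.map f)).writes A = false := by
  induction L with
  | nil => rfl
  | cons a L ih => simp [Prog.seqs, Prog.writes, h a, ih]

theorem pairsProg_writes {A : ℕ} (h : A ≠ 4 ∧ A ≠ 5 ∧ A ≠ 6) : pairsProg.writes A = false :=
  seqs_map_writes (fun _ => testProg_writes h) _

theorem pairsLoop_writes {A : ℕ} (h : A ≠ 4 ∧ A ≠ 5 ∧ A ≠ 6) (h' : A ≠ 24) :
    (Prog.loop true 24 numHExp pairsProg).writes A = false := by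
  simp [Prog.writes, pairsProg_writes h, h']

theorem pairsProg_runs (hσ : ∀ f, P.facetOf (σ f) = f) (hs : Searching P σ P.pairAt 4 s)
    {a : Fin P.numT} {k₃ k₄ : ℕ} (h20 : s.nat 20 0 = a) (h23 : s.nat 23 0 = k₃)
    (h24 : s.nat 24 0 = k₄) (hk₃ : k₃ < 3 * P.numT) (hk₄ : k₄ < 3 * P.numT) {x y : Fin 7 → ℕ}
    (hx : ∀ i : Fin 7, s.nat (30 + i) 0 = x i) (hy : ∀ i : Fin 7, s.nat (40 + i) 0 = y i)
    (hx' : ∀ i, x i < 3 * P.numT) (hy' : ∀ i, y i < 3 * P.numT) :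
    pairsProg.Runs N C s (Prog.Searched (Searching P σ P.pairAt 4) (∀ i j, ∀ f, σ f = a →
      ¬ Candidate (fun f => P.normal (σ f)) 4 f
        ![P.pairAt (x i), P.pairAt (y j), P.pairAt k₃, P.pairAt k₄]) s) := by
  refine (Prog.Runs.search_seqs (D := fun ij : Fin 7 × Fin 7 => ∀ f, σ f = a →
    ¬ Candidate (fun f => P.normal (σ f)) 4 f
      ![P.pairAt (x ij.1), P.pairAt (y ij.2), P.pairAt k₃, P.pairAt k₄]) _ hs ?_).mono
    fun _ _ h => h.mono fun h i j => h (i, j) (by simp)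
  rintro ⟨i, j⟩ - s1 hF hs1
  have keep : ∀ A, A ≠ 4 ∧ A ≠ 5 ∧ A ≠ 6 → s1.nat A = s.nat A := fun A hA =>
    hF.nat A (pairsProg_writes hA)
  have e : ∀ l : Fin 4, s1.nat (![30 + (i : ℕ), 40 + j, 23, 24] l) 0 = ![x i, y j, k₃, k₄] l := by
    intro l
    fin_cases l
    · exact (congrFun (keep _ (by simp; omega)) 0).trans (hx i)
    · exact (congrFun (keep _ (by simp; omega)) 0).trans (hy j)
    · exact (congrFun (keep 23 (by decide)) 0).trans h23
    · exact (congrFun (keep 24 (by decide)) 0).trans h24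
  refine (testProg_runs (a := a) hσ hs1 (by decide) ?_ (by norm_num) (by norm_num) ?_ ?_
    ?_).mono fun _ _ h => h.mono fun h f hf hc => h f hf ?_
  · intro l
    fin_cases l <;> simp <;> omega
  · rw [keep 20 (by decide), h20]
  · intro l
    rw [e]
    fin_cases l
    exacts [hx' i, hy' j, hk₃, hk₄]
  · intro l hl
    omega
  · simp only [e]
    convert hc using 1
    funext l
    fin_cases l <;> rfl

/-- The loop property speaks of scan results existentially, since their variables are overwritten in
later rounds. The scans and the loop over the fourth finger run side by side inside the two outer
loops, so the depth stays three. -/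
theorem searchFour_runs (hσ : ∀ f, P.facetOf (σ f) = f) (hN : 3 * P.numT ≤ N)
    (hs : Searching P σ P.pairAt 4 s) :
    searchFour.Runs N C s fun s' => Searching P σ P.pairAt 5 s' := by
  have hw1 : ∀ A, (A < 30 ∨ 46 < A) → A ≠ 4 → A ≠ 5 → A ≠ 6 → A ≠ 24 → A ≠ 25 →
      (Prog.seq (halfScanProg (palmNormal.cross thirdNormal) 30)
        (.seq (halfScanProg (thirdNormal.cross palmNormal) 40)
          (.loop true 24 numHExp pairsProg))).writes A = false := by
    intro A h h4 h5 h6 h24 h25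
    simp only [Prog.writes, halfScanProg_writes (A := A) (B := 30) (by omega) h25,
      halfScanProg_writes (A := A) (B := 40) (by omega) h25, pairsProg_writes ⟨h4, h5, h6⟩,
      Bool.false_or, Bool.or_false, beq_eq_false_iff_ne]
    exact h24
  refine (search_register (D := fun a => ∀ k₃ < 3 * P.numT, ∀ f, (σ f : ℕ) = a → ∃ c r c' r',
      HalfScan (fun f => P.normal (σ f)) f (P.pairAt k₃)
        (P.normal (σ f) ⨯₃ P.normal (σ (P.pairAt k₃).1))
        (scanDirections (P.normal (σ f) ⨯₃ P.normal (σ (P.pairAt k₃).1)) (P.normal (σ f))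
          (P.normal (σ (P.pairAt k₃).1))) c r ∧
      HalfScan (fun f => P.normal (σ f)) f (P.pairAt k₃)
        (-(P.normal (σ f) ⨯₃ P.normal (σ (P.pairAt k₃).1)))
        (scanDirections (P.normal (σ f) ⨯₃ P.normal (σ (P.pairAt k₃).1)) (P.normal (σ f))
          (P.normal (σ (P.pairAt k₃).1))) c' r' ∧
      ∀ k₄ < 3 * P.numT, ∀ F₁ F₂, ((∃ i, F₁ = c i) ∨ ∃ i, F₁ = r i) →
        ((∃ i, F₂ = c' i) ∨ ∃ i, F₂ = r' i) →
        ¬ Candidate (fun f => P.normal (σ f)) 4 f ![F₁, F₂, P.pairAt k₃, P.pairAt k₄])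
    (fun _ h => h.numT) (by omega) (by decide) ?_ ?_ hs ?_).mono ?_
  · exact Bool.or_eq_false_iff.2 ⟨rfl, hw1 20 (by norm_num) (by norm_num) (by norm_num) (by norm_num)
      (by norm_num) (by norm_num)⟩
  · intro A hA
    have := hw1 A (by omega) (by omega) (by omega) (by omega) (by omega) (by omega)
    simp only [Prog.writes, Bool.or_eq_false_iff, beq_eq_false_iff_ne] at this ⊢
    exact ⟨by omega, by omega, this⟩
  · intro a ha s1 _ h20 hs1
    refine search_register (fun _ h => h.numH) hN (by decide) ?_ ?_ hs1 ?_
    · exact hw1 23 (by norm_num) (by norm_num) (by norm_num) (by norm_num) (by norm_num) (by norm_num)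
    · intro A hA
      have := hw1 A (by omega) (by omega) (by omega) (by omega) (by omega) (by omega)
      simp only [Prog.writes, Bool.or_eq_false_iff, beq_eq_false_iff_ne] at this ⊢
      exact ⟨by omega, this⟩
    · intro k₃ hk₃ s2 hF2 h23 hs2
      have h20' : s2.nat 20 0 = (⟨a, ha⟩ : Fin P.numT) := by
        rw [hF2.nat 20, h20]
        have := hw1 20 (by norm_num) (by norm_num) (by norm_num) (by norm_num) (by norm_num)
          (by norm_num)
        simp only [Prog.writes, Bool.or_eq_false_iff, beq_eq_false_iff_ne] at this ⊢
        exact ⟨by norm_num, this⟩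
      have hwf : WithFinger P σ P.pairAt ⟨a, ha⟩ k₃ s2 := ⟨hs2.ready, h20', h23, hk₃⟩
      set p := P.normal ⟨a, ha⟩
      set b := P.normal (σ (P.pairAt k₃).1)
      have ep : ∀ s', WithFinger P σ P.pairAt ⟨a, ha⟩ k₃ s' → palmNormal.eval s' = p :=
        fun s' h => h.ready.normalExp (t := var 20) h.palm
      have eb : ∀ s', WithFinger P σ P.pairAt ⟨a, ha⟩ k₃ s' → thirdNormal.eval s' = b := by
        intro s' h
        refine h.ready.normalExp (t := bodyExp (var 23)) ?_
        have := h.ready.evalBody (k := var 23) (by simpa [NExp.eval, h.third] using hk₃)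
        simpa only [NExp.eval, h.third] using this
      have ez : ∀ i s', WithFinger P σ P.pairAt ⟨a, ha⟩ k₃ s' →
          (scanDirectionExp i).eval s' = scanDirections (p ⨯₃ b) p b i := by
        intro i s' h
        fin_cases i <;> simp [scanDirectionExp, scanDirections, ep s' h, eb s' h]
      refine Prog.Runs.seq ((halfScanProg_runs hσ hN hwf (u := palmNormal.cross thirdNormal)
        (U := p ⨯₃ b) (fun s' h => by rw [VExp.eval_cross, ep s' h, eb s' h]) ez
        (B := 30) (by norm_num)).mono fun s3 hF3 r3 => ?_)
      have keep3 : ∀ D, D < 30 → D ≠ 25 → s3.nat D = s2.nat D := fun D hD hD' =>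
        hF3.nat D (halfScanProg_writes (by omega) hD')
      have hwf3 : WithFinger P σ P.pairAt ⟨a, ha⟩ k₃ s3 :=
        hwf.congr (fun D hD => keep3 D (by omega) (by omega)) hF3.real
      refine Prog.Runs.seq ((halfScanProg_runs hσ hN hwf3 (u := thirdNormal.cross palmNormal)
        (U := -(p ⨯₃ b)) (fun s' h => by
          rw [VExp.eval_cross, ep s' h, eb s' h, ← cross_anticomm]) ez
        (B := 40) (by norm_num)).mono fun s4 hF4 r4 => ?_)
      have keep4 : ∀ D, D < 40 → D ≠ 25 → s4.nat D = s3.nat D := fun D hD hD' =>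
        hF4.nat D (halfScanProg_writes (by omega) hD')
      have hwf4 : WithFinger P σ P.pairAt ⟨a, ha⟩ k₃ s4 :=
        hwf3.congr (fun D hD => keep4 D (by omega) (by omega)) hF4.real
      have hs4 : Searching P σ P.pairAt 4 s4 := by
        refine hs2.congr (fun A hA => ?_) (hF4.real.trans hF3.real)
        unfold Protected at hA
        rw [keep4 A (by omega) (by omega), keep3 A (by omega) (by omega)]
      have e30 : ∀ n, n < 7 → s3.nat (30 + n) = s4.nat (30 + n) := fun n hn =>
        (keep4 _ (by omega) (by omega)).symm
      refine (search_register (s := s4) (D := fun k₄ => ∀ i j : Fin 7, ∀ f, σ f = ⟨a, ha⟩ →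
        ¬ Candidate (fun f => P.normal (σ f)) 4 f ![P.pairAt (s4.nat (30 + i) 0),
          P.pairAt (s4.nat (40 + j) 0), P.pairAt k₃, P.pairAt k₄])
        (fun _ h => h.numH) hN (by decide) (pairsProg_writes (by decide))
        (fun A hA => pairsLoop_writes (by omega) (by omega)) hs4 ?_).mono ?_
      · intro k₄ hk₄ s5 hF5 h24 hs5
        have keep5 : ∀ D, 6 < D → D ≠ 24 → s5.nat D = s4.nat D := fun D hD hD' =>
          hF5.nat D (pairsLoop_writes (by omega) hD')
        exact pairsProg_runs hσ hs5 (by rw [keep5 20 (by norm_num) (by norm_num), hwf4.palm])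
          (by rw [keep5 23 (by norm_num) (by norm_num), hwf4.third]) h24 hk₃ hk₄
          (fun i => by rw [keep5 _ (by omega) (by omega)])
          (fun i => by rw [keep5 _ (by omega) (by omega)])
          (fun i => by rw [← e30 i i.2]; exact r3.1 i) r4.1
      · rintro s5 hF5 ⟨h5, h6, h7⟩
        refine ⟨h5, fun h => h6 ?_, h7.imp_right fun h7 f hf => ?_⟩
        · rw [Mem.outCount, keep4 4 (by norm_num) (by norm_num), keep3 4 (by norm_num) (by norm_num)]
          exact h
        · have hfa : σ f = ⟨a, ha⟩ := Fin.ext hf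
          have r3' := r3.2 f hfa
          have r4' := r4.2 f hfa
          have hp : p = P.normal (σ f) := by rw [hfa]
          rw [hp] at r3' r4'
          refine ⟨_, _, _, _, r3', r4', fun k₄ hk₄ F₁ F₂ hF₁ hF₂ => ?_⟩
          have hF₁' : ∃ i : Fin 7, F₁ = P.pairAt (s4.nat (30 + i) 0) := by
            rcases hF₁ with ⟨i, rfl⟩ | ⟨i, rfl⟩
            · exact ⟨i.castLE (by norm_num), by rw [e30 i (by omega)]; rfl⟩
            · exact ⟨⟨4 + i, by omega⟩, by rw [add_assoc, e30 (4 + i) (by omega)]⟩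
          have hF₂' : ∃ i : Fin 7, F₂ = P.pairAt (s4.nat (40 + i) 0) := by
            rcases hF₂ with ⟨i, rfl⟩ | ⟨i, rfl⟩
            · exact ⟨i.castLE (by norm_num), rfl⟩
            · exact ⟨⟨4 + i, by omega⟩, by rw [add_assoc]⟩
          obtain ⟨i, rfl⟩ := hF₁'
          obtain ⟨j, rfl⟩ := hF₂'
          exact h7 k₄ hk₄ i j f hfa
  · rintro s' - h
    refine Searching.succ (⟨h.1, h.2.1, ?_⟩ : Prog.Searched _ _ s s')
    rcases h.1.none with h0 | hmin
    · exact .inl h0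
    refine h.2.2.imp_right fun h7 G hG h4 => ?_
    -- The structure theorem needs a minimal fixture; one with four fingers is minimal here because
    -- smaller ones have been excluded.
    obtain ⟨A₃, A₄, hA₃, hA₄, hex⟩ := hG.exists_two_fingers (normalField hσ)
      (fun G' hG' => by rw [h4]; exact hmin G' hG') h4
    obtain ⟨k₃, hk₃, rfl⟩ := P.exists_pairAt hA₃.tip
    obtain ⟨k₄, hk₄, rfl⟩ := P.exists_pairAt hA₄.tip
    obtain ⟨c, r, c', r', h1, h2, h3⟩ := h7 _ (σ G.palm).2 k₃ hk₃ G.palm rfl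
    obtain ⟨F₁, F₂, hF₁, hF₂, hc⟩ := hex _ rfl c c' r r' h1 h2
    exact h3 k₄ hk₄ F₁ F₂ hF₁ hF₂ hc

end Snapping

/-! ### Lists of common neighbours of triples of facets. -/

namespace Snapping

open Matrix

/-! ## The search for fixtures with three fingers -/

theorem mul_add_injective {T a b x y : ℕ} (hx : x < T) (hy : y < T) (h : a * T + x = b * T + y) :
    a = b ∧ x = y := by
  have h1 : ∀ a x, x < T → (a * T + x) / T = a := fun a x hx => by
    rw [add_comm, Nat.add_mul_div_right _ _ (by omega), Nat.div_eq_of_lt hx, zero_add]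
  have e : a = b := by rw [← h1 a x hx, h, h1 b y hy]
  subst e
  exact ⟨rfl, by omega⟩

/-- Lists of numbers, one for every `e < T`. The list number `e` has `cn e` entries, which are stored
in `ls`, and `mk` marks which numbers occur in it. All entries are related to `e` by `R`. -/
structure Buckets (T : ℕ) (R : ℕ → ℕ → Prop) (mk cn ls : ℕ → ℕ) : Prop where
  sound : ∀ e < T, ∀ x, mk (x * T + e) ≠ 0 → R e x
  listed : ∀ e < T, ∀ j < cn e, mk (ls (j * T + e) * T + e) ≠ 0
  inj : ∀ e < T, ∀ i < cn e, ∀ j < cn e, ls (i * T + e) = ls (j * T + e) → i = j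
  complete : ∀ e < T, ∀ x, mk (x * T + e) ≠ 0 → ∃ j < cn e, ls (j * T + e) = x

/-- All positions have the form `x * T + e` with `e < T`, so distinct lists never interfere. The
mark tells in constant time whether `x` is already listed, which keeps entries distinct. -/
theorem Buckets.insert {T : ℕ} {R : ℕ → ℕ → Prop} {mk cn ls : ℕ → ℕ} (h : Buckets T R mk cn ls)
    {e x : ℕ} (he : e < T) (hx : mk (x * T + e) = 0) (hR : R e x) :
    Buckets T R (Function.update mk (x * T + e) 1) (Function.update cn e (cn e + 1))
      (Function.update ls (cn e * T + e) x) := by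
  have hmk : ∀ n, mk n ≠ 0 → Function.update mk (x * T + e) 1 n ≠ 0 := fun n hn => by
    rw [Function.update_apply]; split_ifs; exacts [one_ne_zero, hn]
  have hmk' : ∀ e' < T, ∀ x', Function.update mk (x * T + e) 1 (x' * T + e') ≠ 0 →
      (x' = x ∧ e' = e) ∨ mk (x' * T + e') ≠ 0 := by
    intro e' he' x' hm
    rw [Function.update_apply] at hm
    split_ifs at hm with h'
    · exact .inl (mul_add_injective he' he h')
    · exact .inr hm
  have hls : ∀ e' < T, ∀ j, (j ≠ cn e ∨ e' ≠ e) →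
      Function.update ls (cn e * T + e) x (j * T + e') = ls (j * T + e') := by
    intro e' he' j hne
    refine Function.update_of_ne (fun h' => ?_) _ _
    obtain ⟨h1, h2⟩ := mul_add_injective he' he h'
    exact hne.elim (fun h => h h1) fun h => h h2
  have hcn : ∀ e' < T, ∀ j < Function.update cn e (cn e + 1) e',
      (j < cn e' ∧ Function.update ls (cn e * T + e) x (j * T + e') = ls (j * T + e')) ∨
      (e' = e ∧ j = cn e ∧ Function.update ls (cn e * T + e) x (j * T + e') = x) := by
    intro e' he' j hj
    by_cases h' : e' = e
    · subst h'
      rw [Function.update_self] at hj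
      rcases Nat.lt_succ_iff_lt_or_eq.1 hj with hj | rfl
      · exact .inl ⟨hj, hls e' he' j (.inl hj.ne)⟩
      · exact .inr ⟨rfl, rfl, Function.update_self _ _ _⟩
    · rw [Function.update_of_ne h'] at hj
      exact .inl ⟨hj, hls e' he' j (.inr h')⟩
  have hfresh : ∀ j < cn e, ls (j * T + e) ≠ x := fun j hj h' => h.listed e he j hj (by rw [h', hx])
  refine ⟨fun e' he' x' hm => ?_, fun e' he' j hj => ?_, fun e' he' i hi j hj hij => ?_,
    fun e' he' x' hm => ?_⟩
  · rcases hmk' e' he' x' hm with ⟨rfl, rfl⟩ | hm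
    exacts [hR, h.sound e' he' x' hm]
  · rcases hcn e' he' j hj with ⟨hj, h1⟩ | ⟨rfl, rfl, h1⟩
    · rw [h1]; exact hmk _ (h.listed e' he' j hj)
    · rw [h1, Function.update_self]; exact one_ne_zero
  · rcases hcn e' he' i hi with ⟨hi', h1⟩ | ⟨rfl, rfl, h1⟩ <;>
      rcases hcn e' he' j hj with ⟨hj', h2⟩ | ⟨h3, rfl, h2⟩
    · rw [h1, h2] at hij; exact h.inj e' he' i hi' j hj' hij
    · subst h3; rw [h1, h2] at hij; exact absurd hij (hfresh i hi')
    · rw [h1, h2] at hij; exact absurd hij.symm (hfresh j hj')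
    · rfl
  · rcases hmk' e' he' x' hm with ⟨rfl, rfl⟩ | hm
    · exact ⟨cn e', by rw [Function.update_self]; omega, Function.update_self _ _ _⟩
    · obtain ⟨j, hj, h1⟩ := h.complete e' he' x' hm
      refine ⟨j, ?_, ?_⟩
      · rw [Function.update_apply]; split_ifs with h'
        · subst h'; omega
        · exact hj
      · rw [hls e' he' j, h1]
        by_cases h' : e' = e
        · subst h'; exact .inl hj.ne
        · exact .inr h'

def cubeExp : NExp := .mul numTExp (.mul numTExp numTExp)

/-- The number of a triple of facets. -/
def tripleExp (x y z : NExp) : NExp := .add (.mul (.add (.mul x numTExp) y) numTExp) z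

def slotExp (x : NExp) : NExp := .add (.mul x cubeExp) (var 44)

/-- Enter the body of the finger `21` into the list number `44`. -/
def insertProg : Prog :=
  .seq (.nset 14 (slotExp (bodyExp (var 21))) (.lit 1))
    (.seq (.nset 16 (slotExp (.get 15 (var 44))) (bodyExp (var 21)))
      (.nset 15 (var 44) (.add (.get 15 (var 44)) (.lit 1))))

/-- Test whether the pairs `21`, `22`, `23` have the same first facet, and consist of neighbours. -/
def commonExp : BExp :=
  .and (.and (.neq (bodyExp (var 21)) (bodyExp (var 22))) (.neq (bodyExp (var 21)) (bodyExp (var 23))))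
    (.and (neighborExp (bodyExp (var 21)) (tipExp (var 21)))
      (.and (neighborExp (bodyExp (var 22)) (tipExp (var 22)))
        (neighborExp (bodyExp (var 23)) (tipExp (var 23)))))

/-- For every triple of facets, list the common neighbours. -/
def bucketProg : Prog :=
  .loop true 21 numHExp (.loop true 22 numHExp (.loop true 23 numHExp
    (.seq (.nset 44 (.lit 0) (tripleExp (tipExp (var 21)) (tipExp (var 22)) (tipExp (var 23))))
      (.ite (.and commonExp (.neq (.get 14 (slotExp (bodyExp (var 21)))) (.lit 0))) insertProg .skip))))

def distinctBodiesExp : BExp :=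
  .and (.not (.neq (bodyExp (var 21)) (bodyExp (var 22))))
    (.and (.not (.neq (bodyExp (var 21)) (bodyExp (var 23))))
      (.not (.neq (bodyExp (var 22)) (bodyExp (var 23)))))

/-- Test all common neighbours of the bodies as palms. -/
def palmsProg : Prog :=
  .seq (.nset 44 (.lit 0) (tripleExp (bodyExp (var 21)) (bodyExp (var 22)) (bodyExp (var 23))))
    (.loop false 26 (.get 15 (var 44)) (.seq (.nset 20 (.lit 0) (.get 16 (slotExp (var 26))))
      (testProg 3 20 ![21, 22, 23, 21])))

def searchThree : Prog :=
  .seq bucketProg (.loop true 21 numHExp (.loop true 22 numHExp (.loop true 23 numHExp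
    (.ite distinctBodiesExp palmsProg .skip))))

variable {P : Polyhedron} {σ : P.Facet → Fin P.numT} {φ : ℕ → P.Facet × P.Facet} {K N C : ℕ}
  {s s' : Mem}

/-- The number of a triple of facets. -/
def triple (σ : P.Facet → Fin P.numT) (f : Fin 3 → P.Facet) : ℕ :=
  ((σ (f 0) : ℕ) * P.numT + σ (f 1)) * P.numT + σ (f 2)

theorem triple_lt (f : Fin 3 → P.Facet) : triple σ f < P.numT * (P.numT * P.numT) := by
  have h0 := (σ (f 0)).2
  have h1 := (σ (f 1)).2
  have h2 := (σ (f 2)).2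
  have h3 : (σ (f 0) : ℕ) * P.numT + σ (f 1) + 1 ≤ P.numT * P.numT := by nlinarith
  have h4 := Nat.mul_le_mul_right P.numT h3
  unfold triple
  nlinarith

theorem triple_injective (hσ : Function.Injective σ) {f f' : Fin 3 → P.Facet}
    (h : triple σ f = triple σ f') : f = f' := by
  obtain ⟨h1, h2⟩ := mul_add_injective (σ (f 2)).2 (σ (f' 2)).2 h
  obtain ⟨h3, h4⟩ := pair_injective h1
  funext j
  fin_cases j
  exacts [hσ h3, hσ h4, hσ (Fin.ext h2)]

/-- The facet `x` is a common neighbour of the triple `e`. -/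
def CommonNeighbor (P : Polyhedron) (σ : P.Facet → Fin P.numT) (e x : ℕ) : Prop :=
  ∃ a f, (σ a : ℕ) = x ∧ triple σ f = e ∧ ∀ j, P.Neighbor a (f j)

/-- The lists of common neighbours in the memory. -/
def HasBuckets (P : Polyhedron) (σ : P.Facet → Fin P.numT) (s : Mem) : Prop :=
  Buckets (P.numT * (P.numT * P.numT)) (CommonNeighbor P σ) (s.nat 14) (s.nat 15) (s.nat 16)

theorem HasBuckets.congr (h : HasBuckets P σ s) (h14 : s'.nat 14 = s.nat 14)
    (h15 : s'.nat 15 = s.nat 15) (h16 : s'.nat 16 = s.nat 16) : HasBuckets P σ s' := by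
  unfold HasBuckets
  rw [h14, h15, h16]
  exact h

/-- The common neighbour `(φ (k 0)).1` of the facets `(φ (k j)).2` has been entered. -/
def Entered (σ : P.Facet → Fin P.numT) (k : Fin 3 → ℕ) (s : Mem) : Prop :=
  (∀ j, (P.pairAt (k j)).1 = (P.pairAt (k 0)).1) →
    (∀ j, P.Neighbor (P.pairAt (k j)).1 (P.pairAt (k j)).2) →
    s.nat 14 (σ (P.pairAt (k 0)).1 * (P.numT * (P.numT * P.numT)) +
      triple σ fun j => (P.pairAt (k j)).2) ≠ 0

/-- Marks persist. -/
def MarksKept (s s' : Mem) : Prop := ∀ n, s.nat 14 n ≠ 0 → s'.nat 14 n ≠ 0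

theorem Polyhedron.HasInput.cube (h : P.HasInput s) : cubeExp.eval s = P.numT * (P.numT * P.numT) := by
  simp only [cubeExp, NExp.eval, h.numT]

theorem bucketStep_runs (hσ : ∀ f, P.facetOf (σ f) = f) (hr : Ready P σ P.pairAt s)
    (hb : HasBuckets P σ s) {k : Fin 3 → ℕ} (h21 : s.nat 21 0 = k 0) (h22 : s.nat 22 0 = k 1)
    (h23 : s.nat 23 0 = k 2) (hk : ∀ j, k j < 3 * P.numT) :
    (Prog.seq (.nset 44 (.lit 0) (tripleExp (tipExp (var 21)) (tipExp (var 22)) (tipExp (var 23))))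
      (.ite (.and commonExp (.neq (.get 14 (slotExp (bodyExp (var 21)))) (.lit 0)))
        insertProg .skip)).Runs N C s
      fun s' => HasBuckets P σ s' ∧ MarksKept s s' ∧ Entered σ k s' := by
  have hinj := injective_of_section hσ
  have e1 : (tripleExp (tipExp (var 21)) (tipExp (var 22)) (tipExp (var 23))).eval s =
      triple σ fun j => (P.pairAt (k j)).2 := by
    simp only [tripleExp, NExp.eval, tipExp, h21, h22, h23, hr.tip _ (hk _), hr.numT, triple]
  refine Prog.Runs.seq (.nset ?_)
  rw [e1]
  set s1 := s.setNat 44 _ _ with hs1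
  have keep : ∀ A, A ≠ 44 → s1.nat A = s.nat A := fun A hA => s.setNat_nat_of_ne _ _ hA
  have h44 : s1.nat 44 0 = triple σ fun j => (P.pairAt (k j)).2 := by simp [hs1, NExp.eval]
  have hr1 : Ready P σ P.pairAt s1 :=
    hr.congr (fun A hA _ => keep A (by unfold Protected at hA; omega)) rfl
  have hb1 : HasBuckets P σ s1 :=
    hb.congr (keep 14 (by norm_num)) (keep 15 (by norm_num)) (keep 16 (by norm_num))
  rw [← keep 21 (by norm_num)] at h21
  rw [← keep 22 (by norm_num)] at h22
  rw [← keep 23 (by norm_num)] at h23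
  have b21 : (bodyExp (var 21)).eval s1 = σ (P.pairAt (k 0)).1 := by
    simp only [bodyExp, NExp.eval, h21, hr1.body _ (hk _)]
  have b22 : (bodyExp (var 22)).eval s1 = σ (P.pairAt (k 1)).1 := by
    simp only [bodyExp, NExp.eval, h22, hr1.body _ (hk _)]
  have b23 : (bodyExp (var 23)).eval s1 = σ (P.pairAt (k 2)).1 := by
    simp only [bodyExp, NExp.eval, h23, hr1.body _ (hk _)]
  have t21 : (tipExp (var 21)).eval s1 = σ (P.pairAt (k 0)).2 := by
    simp only [tipExp, NExp.eval, h21, hr1.tip _ (hk _)]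
  have t22 : (tipExp (var 22)).eval s1 = σ (P.pairAt (k 1)).2 := by
    simp only [tipExp, NExp.eval, h22, hr1.tip _ (hk _)]
  have t23 : (tipExp (var 23)).eval s1 = σ (P.pairAt (k 2)).2 := by
    simp only [tipExp, NExp.eval, h23, hr1.tip _ (hk _)]
  have hne : ∀ g g' : P.Facet, (σ g : ℕ) = σ g' ↔ g = g' := fun g g' =>
    ⟨fun e => hinj (Fin.ext e), fun e => by rw [e]⟩
  have hnb : ∀ g g' : P.Facet, (∃ f f', σ f = σ g ∧ σ f' = σ g' ∧ P.Neighbor f f') ↔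
      P.Neighbor g g' := fun g g' =>
    ⟨fun ⟨f, f', h1, h2, h3⟩ => by rwa [← hinj h1, ← hinj h2], fun h => ⟨g, g', rfl, rfl, h⟩⟩
  have hcommon : commonExp.Holds s1 ↔ (∀ j, (P.pairAt (k j)).1 = (P.pairAt (k 0)).1) ∧
      ∀ j, P.Neighbor (P.pairAt (k j)).1 (P.pairAt (k j)).2 := by
    simp only [commonExp, BExp.holds_and, BExp.holds_neq, b21, b22, b23, hne,
      hr1.holds_neighborExp b21 t21, hr1.holds_neighborExp b22 t22, hr1.holds_neighborExp b23 t23,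
      hnb, Fin.forall_fin_succ, Fin.isEmpty.forall_iff, and_true, true_and]
    constructor <;> exact fun ⟨⟨h1, h2⟩, h3⟩ => ⟨⟨h1.symm, h2.symm⟩, h3⟩
  have hslot : ∀ x : NExp, (slotExp x).eval s1 = x.eval s1 * (P.numT * (P.numT * P.numT)) +
      triple σ fun j => (P.pairAt (k j)).2 := by
    intro x
    simp only [slotExp, NExp.eval, hr1.toHasInput.cube, h44]
  refine .ite (fun hc => ?_) (fun hc => .skip ?_)
  · simp only [BExp.holds_and, hcommon, BExp.holds_neq, NExp.eval, hslot, b21] at hc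
    obtain ⟨⟨hc1, hc2⟩, hc3⟩ := hc
    refine .seq (.nset (.seq (.nset (.nset ?_))))
    rw [hslot, b21]
    set s2 := s1.setNat 14 _ _ with hs2
    have h16 : (slotExp (.get 15 (var 44))).eval s2 =
        s1.nat 15 (s1.nat 44 0) * (P.numT * (P.numT * P.numT)) +
        triple σ fun j => (P.pairAt (k j)).2 := by
      have hi2 : P.HasInput s2 := hr1.toHasInput.setNat (by norm_num) _ _
      have n15 : s2.nat 15 = s1.nat 15 := s1.setNat_nat_of_ne _ _ (by norm_num)
      have n44 : s2.nat 44 = s1.nat 44 := s1.setNat_nat_of_ne _ _ (by norm_num)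
      simp only [slotExp, NExp.eval, hi2.cube, n15, n44, h44]
    have hb21 : (bodyExp (var 21)).eval s2 = σ (P.pairAt (k 0)).1 := by
      rw [← b21]
      simp [bodyExp, NExp.eval, hs2, Mem.setNat]
    rw [h16, hb21]
    set s3 := s2.setNat 16 _ _ with hs3
    set s4 := s3.setNat 15 _ _ with hs4
    have n14 : s4.nat 14 = Function.update (s1.nat 14)
        (σ (P.pairAt (k 0)).1 * (P.numT * (P.numT * P.numT)) +
          triple σ fun j => (P.pairAt (k j)).2) 1 := by
      simp [hs4, hs3, hs2, Mem.setNat, NExp.eval]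
    have n15 : s4.nat 15 = Function.update (s1.nat 15) (triple σ fun j => (P.pairAt (k j)).2)
        (s1.nat 15 (triple σ fun j => (P.pairAt (k j)).2) + 1) := by
      have h1 : s3.nat 15 = s1.nat 15 := by simp [hs3, hs2, Mem.setNat]
      have h2 : s3.nat 44 = s1.nat 44 := by simp [hs3, hs2, Mem.setNat]
      rw [hs4, Mem.setNat_nat_same]
      simp only [NExp.eval, h1, h2, h44]
    have n16 : s4.nat 16 = Function.update (s1.nat 16)
        (s1.nat 15 (triple σ fun j => (P.pairAt (k j)).2) * (P.numT * (P.numT * P.numT)) +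
          triple σ fun j => (P.pairAt (k j)).2) (σ (P.pairAt (k 0)).1) := by
      rw [← h44, hs4, Mem.setNat_nat_of_ne _ _ _ (by norm_num), hs3, Mem.setNat_nat_same]
      congr 1
    refine ⟨?_, fun n hn => ?_, fun _ _ => ?_⟩
    · unfold HasBuckets
      rw [n14, n15, n16]
      exact Buckets.insert hb1 (triple_lt _) hc3
        ⟨_, _, rfl, rfl, fun j => by rw [← hc1 j]; exact hc2 j⟩
    · rw [n14, Function.update_apply, keep 14 (by norm_num)]
      split_ifs
      exacts [one_ne_zero, hn]
    · rw [n14, Function.update_self]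
      exact one_ne_zero
  · simp only [BExp.holds_and, hcommon, BExp.holds_neq, NExp.eval, hslot, b21] at hc
    refine ⟨hb1, fun n hn => by rwa [keep 14 (by norm_num)], fun h1 h2 => ?_⟩
    exact fun h3 => hc ⟨⟨h1, h2⟩, h3⟩

/-- A common neighbour of three facets appears as the first member of three numbered pairs whose
second members are these facets. Running over triples of pairs therefore reaches every list entry in
cubic time. -/
theorem bucketProg_runs (hσ : ∀ f, P.facetOf (σ f) = f) (hN : 3 * P.numT ≤ N)
    (hr : Ready P σ P.pairAt s) (hb : HasBuckets P σ s) :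
    bucketProg.Runs N C s fun s' => HasBuckets P σ s' ∧
      ∀ k : Fin 3 → ℕ, (∀ j, k j < 3 * P.numT) → Entered σ k s' := by
  have set1 : ∀ A, A ∉ [14, 15, 16] → ∀ s x, HasBuckets P σ s → HasBuckets P σ (s.setNat A 0 x) := by
    intro A hA s x h
    simp only [List.mem_cons, List.not_mem_nil, or_false, not_or] at hA
    exact h.congr (s.setNat_nat_of_ne _ _ (by omega)) (s.setNat_nat_of_ne _ _ (by omega))
      (s.setNat_nat_of_ne _ _ (by omega))
  have set2 : ∀ A, A ∉ [14, 15, 16] → ∀ s x, MarksKept s (s.setNat A 0 x) := by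
    intro A hA s x n hn
    simp only [List.mem_cons, List.not_mem_nil, or_false, not_or] at hA
    rwa [s.setNat_nat_of_ne _ _ (by omega)]
  have kept : ∀ k s s', MarksKept s s' → Entered σ k s → Entered σ k s' :=
    fun k s s' h h' h1 h2 => h _ (h' h1 h2)
  have frame : ∀ {p : Prog} {s s' : Mem}, p.Frame s s' →
      (∀ A, Protected A → p.writes A = false) → Ready P σ P.pairAt s → Ready P σ P.pairAt s' :=
    fun hF hw h => h.congr (fun A hA _ => hF.nat A (hw A hA)) hF.real
  have hw : ∀ A, Protected A → bucketProg.writes A = false := by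
    rintro A (h | rfl | rfl | rfl)
    · interval_cases A <;> rfl
    all_goals rfl
  refine (Prog.Runs.loop_rel (N := N) (C := C) (l := true) (n := 3 * P.numT) (J := HasBuckets P σ)
    (M := MarksKept) (D := fun k₀ s' => ∀ k₁ < 3 * P.numT, ∀ k₂ < 3 * P.numT,
      k₀ < 3 * P.numT → Entered σ ![k₀, k₁, k₂] s')
    hN rfl (fun s' hF => (frame hF hw hr).numH) (set1 21 (by decide)) hb (set2 21 (by decide))
    (fun _ => id) (fun h h' n hn => h' n (h n hn))
    (fun k₀ s s' h h' k₁ h1 k₂ h2 h0 => kept _ _ _ h (h' k₁ h1 k₂ h2 h0)) ?_).mono ?_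
  · intro k₀ hk₀ s1 hF1 h21 hb1
    have hr1 := frame hF1 hw hr
    have hw1 : ∀ A, Protected A → (Prog.loop true 22 numHExp (.loop true 23 numHExp
      (.seq (.nset 44 (.lit 0) (tripleExp (tipExp (var 21)) (tipExp (var 22)) (tipExp (var 23))))
        (.ite (.and commonExp (.neq (.get 14 (slotExp (bodyExp (var 21)))) (.lit 0)))
          insertProg .skip)))).writes A = false := by
      rintro A (h | rfl | rfl | rfl)
      · interval_cases A <;> rfl
      all_goals rfl
    refine (Prog.Runs.loop_rel (N := N) (C := C) (l := true) (n := 3 * P.numT) (J := HasBuckets P σ)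
      (M := MarksKept) (D := fun k₁ s' => k₁ < 3 * P.numT → ∀ k₂ < 3 * P.numT,
        Entered σ ![k₀, k₁, k₂] s')
      hN rfl (fun s' hF => (frame hF hw1 hr1).numH) (set1 22 (by decide)) hb1 (set2 22 (by decide))
      (fun _ => id) (fun h h' n hn => h' n (h n hn))
      (fun k₁ s s' h h' h1 k₂ h2 => kept _ _ _ h (h' h1 k₂ h2)) ?_).mono ?_
    · intro k₁ hk₁ s2 hF2 h22 hb2
      have hr2 := frame hF2 hw1 hr1
      have hw2 : ∀ A, Protected A → (Prog.loop true 23 numHExp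
        (.seq (.nset 44 (.lit 0) (tripleExp (tipExp (var 21)) (tipExp (var 22)) (tipExp (var 23))))
          (.ite (.and commonExp (.neq (.get 14 (slotExp (bodyExp (var 21)))) (.lit 0)))
            insertProg .skip))).writes A = false := by
        rintro A (h | rfl | rfl | rfl)
        · interval_cases A <;> rfl
        all_goals rfl
      refine (Prog.Runs.loop_rel (N := N) (C := C) (l := true) (n := 3 * P.numT)
        (J := HasBuckets P σ) (M := MarksKept)
        (D := fun k₂ s' => k₂ < 3 * P.numT → Entered σ ![k₀, k₁, k₂] s')
        hN rfl (fun s' hF => (frame hF hw2 hr2).numH) (set1 23 (by decide)) hb2 (set2 23 (by decide))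
        (fun _ => id) (fun h h' n hn => h' n (h n hn))
        (fun k₂ s s' h h' h2 => kept _ _ _ h (h' h2)) ?_).mono ?_
      · intro k₂ hk₂ s3 hF3 h23 hb3
        rw [← hF2.nat 21 rfl, ← hF3.nat 21 rfl] at h21
        rw [← hF3.nat 22 rfl] at h22
        refine (bucketStep_runs (k := ![k₀, k₁, k₂]) hσ (frame hF3 hw2 hr2) hb3 h21 h22 h23
          ?_).mono fun _ _ ⟨h1, h2, h3⟩ => ⟨h1, h2, fun _ => h3⟩
        simpa [Fin.forall_fin_succ] using ⟨hk₀, hk₁, hk₂⟩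
      · rintro s3 - ⟨h1, h2, h3⟩
        exact ⟨h1, h2, fun _ k₂ hk₂ => h3 k₂ hk₂ hk₂⟩
    · rintro s2 - ⟨h1, h2, h3⟩
      exact ⟨h1, h2, fun k₁ hk₁ k₂ hk₂ _ => h3 k₁ hk₁ hk₁ k₂ hk₂⟩
  · rintro s1 - ⟨h1, -, h3⟩
    refine ⟨h1, fun k hk => ?_⟩
    have := h3 (k 0) (hk 0) (k 1) (hk 1) (k 2) (hk 2) (hk 0)
    convert this using 1
    funext j
    fin_cases j <;> rfl

end Snapping

/-! ### Search with three fingers, and the complete algorithm. -/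

namespace Snapping

open Matrix

variable {P : Polyhedron} {σ : P.Facet → Fin P.numT} {φ : ℕ → P.Facet × P.Facet} {K N C : ℕ}
  {s s' : Mem}

/-- A triple of different facets has few common neighbours. -/
theorem bucket_length (hσ : ∀ f, P.facetOf (σ f) = f) (hb : HasBuckets P σ s)
    (hC : ∀ f : Fin 3 → P.Facet, Function.Injective f → ∀ S : Finset P.Facet,
      (∀ a ∈ S, ∀ j, P.Neighbor a (f j)) → S.card ≤ C)
    {f : Fin 3 → P.Facet} (hf : Function.Injective f) : s.nat 15 (triple σ f) ≤ C := by
  classical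
  have h1 : ∀ j : Fin (s.nat 15 (triple σ f)), ∃ a,
      (σ a : ℕ) = s.nat 16 (j * (P.numT * (P.numT * P.numT)) + triple σ f) ∧
        ∀ i, P.Neighbor a (f i) := by
    intro j
    obtain ⟨a, f', h1, h2, h3⟩ := hb.sound _ (triple_lt f) _ (hb.listed _ (triple_lt f) j j.2)
    obtain rfl := triple_injective (injective_of_section hσ) h2
    exact ⟨a, h1, h3⟩
  choose a ha ha' using h1
  have hinj : Function.Injective a := fun i j hij => Fin.ext (hb.inj _ (triple_lt f) i i.2 j j.2 (by
    rw [← ha, ← ha, hij]))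
  have := hC f hf (Finset.univ.image a) (by simpa using ha')
  rwa [Finset.card_image_of_injective _ hinj, Finset.card_univ, Fintype.card_fin] at this

/-- Distinctness of the bodies is what bounds the list and so makes the loop a short one. Every palm
marked for this triple occurs in the list, so testing its entries excludes them all. -/
theorem palmsProg_runs (hσ : ∀ f, P.facetOf (σ f) = f) (hb : HasBuckets P σ s)
    (hC : ∀ f : Fin 3 → P.Facet, Function.Injective f → ∀ S : Finset P.Facet,
      (∀ a ∈ S, ∀ j, P.Neighbor a (f j)) → S.card ≤ C)
    (hs : Searching P σ P.pairAt 3 s) {k : Fin 3 → ℕ} (h21 : s.nat 21 0 = k 0)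
    (h22 : s.nat 22 0 = k 1) (h23 : s.nat 23 0 = k 2) (hk : ∀ j, k j < 3 * P.numT)
    (hf : Function.Injective fun j => (P.pairAt (k j)).1) :
    palmsProg.Runs N C s (Prog.Searched (Searching P σ P.pairAt 3)
      (∀ f, s.nat 14 (σ f * (P.numT * (P.numT * P.numT)) + triple σ fun j => (P.pairAt (k j)).1) ≠ 0 →
        ¬ Candidate (fun f => P.normal (σ f)) 3 f
          fun j => P.pairAt (![k 0, k 1, k 2, k 0] j)) s) := by
  have e1 : (tripleExp (bodyExp (var 21)) (bodyExp (var 22)) (bodyExp (var 23))).eval s =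
      triple σ fun j => (P.pairAt (k j)).1 := by
    simp only [tripleExp, NExp.eval, bodyExp, h21, h22, h23, hs.ready.body _ (hk _), hs.ready.numT,
      triple]
  refine Prog.Runs.seq (.nset ?_)
  rw [e1]
  set s1 := s.setNat 44 _ _ with hs1
  have keep : ∀ A, A ≠ 44 → s1.nat A = s.nat A := fun A hA => s.setNat_nat_of_ne _ _ hA
  have h44 : s1.nat 44 0 = triple σ fun j => (P.pairAt (k j)).1 := by simp [hs1, NExp.eval]
  have hs1' : Searching P σ P.pairAt 3 s1 := hs.setNat (by decide) _ _
  set n := s.nat 15 (triple σ fun j => (P.pairAt (k j)).1) with hn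
  have keep' : ∀ s' A, (Prog.loop false 26 (.get 15 (var 44))
      (.seq (.nset 20 (.lit 0) (.get 16 (slotExp (var 26))))
        (testProg 3 20 ![21, 22, 23, 21]))).Frame s1 s' → A ∉ [4, 5, 6, 20, 26] →
      s'.nat A = s1.nat A := by
    intro s' A hF hA
    simp only [List.mem_cons, List.not_mem_nil, or_false, not_or] at hA
    refine hF.nat A ?_
    simp only [Prog.writes, testProg_writes (K := 3) (p := 20) (R := ![21, 22, 23, 21])
      (show A ≠ 4 ∧ A ≠ 5 ∧ A ≠ 6 by omega), Bool.or_false, Bool.or_eq_false_iff,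
      beq_eq_false_iff_ne]
    omega
  refine (Prog.Runs.search_loop (N := N) (C := C) (l := false) (n := n)
    (J := Searching P σ P.pairAt 3) (D := fun j => ∀ f,
    (σ f : ℕ) = s.nat 16 (j * (P.numT * (P.numT * P.numT)) + triple σ fun j => (P.pairAt (k j)).1) →
      ¬ Candidate (fun f => P.normal (σ f)) 3 f fun j => P.pairAt (![k 0, k 1, k 2, k 0] j))
    (bucket_length hσ hb hC hf) rfl ?_ (by norm_num) (fun _ _ h => h.setNat (by decide) _ _) hs1'
    ?_).mono ?_
  · intro s' hF
    simp only [NExp.eval, keep' s' 15 hF (by decide), keep' s' 44 hF (by decide), h44,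
      keep 15 (by norm_num)]
    rfl
  · intro j hj s2 hF h26 hs2
    have e16 : (NExp.get 16 (slotExp (var 26))).eval s2 =
        s.nat 16 (j * (P.numT * (P.numT * P.numT)) + triple σ fun j => (P.pairAt (k j)).1) := by
      simp only [slotExp, NExp.eval, keep' s2 16 hF (by decide), keep' s2 44 hF (by decide), h44,
        keep 16 (by norm_num), h26, hs2.ready.cube]
    obtain ⟨a, -, h1, -, -⟩ := hb.sound _ (triple_lt _) _ (hb.listed _ (triple_lt _) j hj)
    refine .seq (.nset ?_)
    rw [e16, ← h1]
    set s3 := s2.setNat 20 _ _ with hs3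
    have keep3 : ∀ A, A ∉ [4, 5, 6, 20, 26, 44] → s3.nat A = s.nat A := by
      intro A hA
      simp only [List.mem_cons, List.not_mem_nil, or_false, not_or] at hA
      rw [hs3, s2.setNat_nat_of_ne _ _ (by omega), keep' s2 A hF (by simp; omega), keep A (by omega)]
    have e : ∀ j : Fin 4, s3.nat (![21, 22, 23, 21] j) 0 = ![k 0, k 1, k 2, k 0] j := by
      simpa [Fin.forall_fin_succ, keep3] using ⟨h21, h22, h23, h21⟩
    refine ((testProg_runs (s := s3) (a := σ a) hσ (hs2.setNat (by decide) _ _) (by decide) (by decide)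
      (by norm_num) (by norm_num) (by simp [hs3, NExp.eval]) ?_ (by decide)).mono
      fun _ _ h => ⟨h.1, fun h' => h.2.1 ?_, h.2.2.imp_right fun h f hf => ?_⟩)
    · intro j
      rw [e]
      fin_cases j
      exacts [hk 0, hk 1, hk 2, hk 0]
    · rw [Mem.outCount, hs3, s2.setNat_nat_of_ne _ _ (by norm_num)]
      exact h'
    · simpa only [e] using h f (Fin.ext hf)
  · rintro s' - ⟨h1, h2, h3⟩
    refine ⟨h1, fun h => h2 ?_, h3.imp_right fun h f hf => ?_⟩
    · rw [Mem.outCount, keep 4 (by norm_num)]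
      exact h
    · obtain ⟨j, hj, h4⟩ := hb.complete _ (triple_lt _) _ hf
      exact h j hj f h4.symm

theorem searchThree_runs (hσ : ∀ f, P.facetOf (σ f) = f) (hN : 3 * P.numT ≤ N)
    (hC : ∀ f : Fin 3 → P.Facet, Function.Injective f → ∀ S : Finset P.Facet,
      (∀ a ∈ S, ∀ j, P.Neighbor a (f j)) → S.card ≤ C)
    (hs : Searching P σ P.pairAt 3 s) (h14 : ∀ n, s.nat 14 n = 0) (h15 : ∀ n, s.nat 15 n = 0) :
    searchThree.Runs N C s fun s' => Searching P σ P.pairAt 4 s' := by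
  have hinj := injective_of_section hσ
  have hb0 : HasBuckets P σ s := by
    refine ⟨fun e _ x h => absurd (h14 _) h, fun e _ j hj => ?_, fun e _ j hj => ?_,
      fun e _ x h => absurd (h14 _) h⟩ <;>
    · rw [h15] at hj
      exact absurd hj (Nat.not_lt_zero j)
  have hw : ∀ A, Protected A → bucketProg.writes A = false := by
    rintro A (h | rfl | rfl | rfl)
    · interval_cases A <;> rfl
    all_goals rfl
  refine Prog.Runs.seq ((bucketProg_runs hσ hN hs.ready hb0).mono ?_)
  rintro s1 hF0 ⟨hb1, hent⟩
  have hs1 : Searching P σ P.pairAt 3 s1 := hs.frame hF0 hw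
  have hout : s1.outCount = s.outCount := by rw [Mem.outCount, hF0.nat 4 rfl]; rfl
  refine (search_register (D := fun k₀ => ∀ k₁ < 3 * P.numT, ∀ k₂ < 3 * P.numT,
      (Function.Injective fun j => (P.pairAt (![k₀, k₁, k₂] j)).1) → ∀ f,
      s1.nat 14 (σ f * (P.numT * (P.numT * P.numT)) +
        triple σ fun j => (P.pairAt (![k₀, k₁, k₂] j)).1) ≠ 0 →
      ¬ Candidate (fun f => P.normal (σ f)) 3 f fun j => P.pairAt (![k₀, k₁, k₂, k₀] j))
    (fun _ h => h.numH) hN (by decide) rfl (by decide) hs1 ?_).mono ?_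
  · intro k₀ hk₀ s2 hF1 h21 hs2
    refine search_register (fun _ h => h.numH) hN (by decide) rfl (by decide) hs2 ?_
    intro k₁ hk₁ s3 hF2 h22 hs3
    refine search_register (fun _ h => h.numH) hN (by decide) rfl (by decide) hs3 ?_
    intro k₂ hk₂ s4 hF3 h23 hs4
    rw [← hF2.nat 21 rfl, ← hF3.nat 21 rfl] at h21
    rw [← hF3.nat 22 rfl] at h22
    have h14' : s4.nat 14 = s1.nat 14 := by rw [hF3.nat 14 rfl, hF2.nat 14 rfl, hF1.nat 14 rfl]
    have h15' : s4.nat 15 = s1.nat 15 := by rw [hF3.nat 15 rfl, hF2.nat 15 rfl, hF1.nat 15 rfl]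
    have h16' : s4.nat 16 = s1.nat 16 := by rw [hF3.nat 16 rfl, hF2.nat 16 rfl, hF1.nat 16 rfl]
    have hb4 : HasBuckets P σ s4 := hb1.congr h14' h15' h16'
    have hd : distinctBodiesExp.Holds s4 ↔
        Function.Injective fun j => (P.pairAt (![k₀, k₁, k₂] j)).1 := by
      have b21 : (bodyExp (var 21)).eval s4 = σ (P.pairAt k₀).1 := by
        simp only [bodyExp, NExp.eval, h21, hs4.ready.body _ hk₀]
      have b22 : (bodyExp (var 22)).eval s4 = σ (P.pairAt k₁).1 := by
        simp only [bodyExp, NExp.eval, h22, hs4.ready.body _ hk₁]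
      have b23 : (bodyExp (var 23)).eval s4 = σ (P.pairAt k₂).1 := by
        simp only [bodyExp, NExp.eval, h23, hs4.ready.body _ hk₂]
      have hne : ∀ g g' : P.Facet, (σ g : ℕ) = σ g' ↔ g = g' := fun g g' =>
        ⟨fun e => hinj (Fin.ext e), fun e => by rw [e]⟩
      simp only [distinctBodiesExp, BExp.holds_and, BExp.holds_not, BExp.holds_neq, b21, b22, b23, hne]
      constructor
      · rintro ⟨h1, h2, h3⟩ i j hij
        have := Ne.symm h1
        have := Ne.symm h2
        have := Ne.symm h3
        fin_cases i <;> fin_cases j <;> first | rfl | exact absurd hij ‹_›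
      · intro h
        exact ⟨fun e => absurd (h (a₁ := 0) (a₂ := 1) e) (by decide),
          fun e => absurd (h (a₁ := 0) (a₂ := 2) e) (by decide),
          fun e => absurd (h (a₁ := 1) (a₂ := 2) e) (by decide)⟩
    refine .ite (fun h => ?_) (fun h => .skip ⟨hs4, id, .inr fun h' => absurd (hd.2 h') h⟩)
    refine (palmsProg_runs (k := ![k₀, k₁, k₂]) hσ hb4 hC hs4 h21 h22 h23 ?_ (hd.1 h)).mono
      fun _ _ h' => h'.mono fun h' _ f hf => h' f (by rw [h14']; exact hf)
    simpa [Fin.forall_fin_succ] using ⟨hk₀, hk₁, hk₂⟩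
  · rintro s' - h
    refine Searching.succ (h.mono fun h G hG h3 => ?_)
    obtain ⟨k, hk, hpad, hc⟩ := hG.exists_numbers hσ (by omega)
    rw [h3] at hpad hc
    have ek : ∀ j : Fin 4, k j = ![k 0, k 1, k 2, k 0] j := by
      intro j
      fin_cases j
      · rfl
      · rfl
      · rfl
      · exact hpad 3 (by decide)
    have ek3 : ∀ j : Fin 3, k j.castSucc = ![k 0, k 1, k 2] j := by
      intro j; fin_cases j <;> rfl
    have hinj' : Function.Injective fun j => (P.pairAt (![k 0, k 1, k 2] j)).1 := by
      intro i j hij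
      have := hc.inj i.castSucc j.castSucc i.2 j.2 (by rw [ek3, ek3]; exact hij)
      simpa using this
    have hfin : ∀ j : Fin 3, P.Neighbor G.palm (P.pairAt (![k 0, k 1, k 2] j)).1 := by
      intro j
      rw [← ek3]
      exact (hc.finger j.castSucc).body
    rw [show (fun j => P.pairAt (k j)) = fun j => P.pairAt (![k 0, k 1, k 2, k 0] j) from
      funext fun j => congrArg P.pairAt (ek j)] at hc
    refine h (k 0) (hk 0) (k 1) (hk 1) (k 2) (hk 2) hinj' G.palm ?_ hc
    -- The pairs of the palm with each of the three bodies have numbers, so the palm was entered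
    -- into the list of these bodies.
    choose l hl hl' using fun j => P.exists_pairAt (F := (G.palm, (P.pairAt (![k 0, k 1, k 2] j)).1))
      (hfin j)
    have := hent l hl (fun j => by rw [hl', hl']) (fun j => by rw [hl']; exact hfin j)
    simpa only [hl'] using this

/-! ## The algorithm -/

/-- The algorithm for minimal snapping fixtures. -/
def minimalFixtureProg : Prog :=
  .seqs [labelProg, tableProg, searchOne, searchTwo, searchThree, searchFour]

theorem minimalFixtureProg_depth : minimalFixtureProg.depth = 3 := by
  set_option maxRecDepth 20000 in decide

/-- If nothing was reported, a valid fixture would yield a minimal one with at least five fingers,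
against `card_le_four`. -/
theorem Searching.answered_of_five (hσ : ∀ f, P.facetOf (σ f) = f) (h : Searching P σ φ 5 s) :
    P.Answered s := by
  by_cases h0 : s.outCount = 0
  · refine .inl ⟨h0, fun G hG => ?_⟩
    have hnone := h.none.resolve_left (not_not.2 h0)
    obtain ⟨G', hG', hmin⟩ : ∃ G' : Fixture P, G'.Valid ∧
        ∀ G'' : Fixture P, G''.Valid → G'.fingers.card ≤ G''.fingers.card := by
      obtain ⟨G', hG', hmin⟩ := WellFounded.has_min
        (InvImage.wf (fun G : Fixture P => G.fingers.card) Nat.lt_wfRel.wf) {G | G.Valid} ⟨G, hG⟩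
      exact ⟨G', hG', fun G'' h => not_lt.1 (hmin G'' h)⟩
    exact absurd (hG'.card_le_four (normalField hσ) hmin) (by have := hnone G' hG'; omega)
  · exact h.answered h0

theorem minimalFixtureProg_runs (P : Polyhedron) {N C : ℕ} (hN : 3 * P.numT ≤ N)
    (hC : ∀ f : Fin 3 → P.Facet, Function.Injective f → ∀ S : Finset P.Facet,
      (∀ a ∈ S, ∀ j, P.Neighbor a (f j)) → S.card ≤ C) :
    minimalFixtureProg.Runs N C P.input P.Answered := by
  have hi : P.HasInput P.input := ⟨rfl, fun _ _ => rfl⟩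
  have hz : ∀ A n, 3 < A → P.input.nat A n = 0 := by
    rintro (_ | _ | _ | _ | A) n hA
    all_goals first | omega | rfl
  refine Prog.Runs.seqs_cons ((labelProg_runs hi (by omega)).mono ?_)
  rintro s1 hF1 ⟨σ, hσ, hl⟩
  have hi1 : P.HasInput s1 := hi.frame hF1 (by decide)
  refine Prog.Runs.seqs_cons ((tableProg_runs hσ hi1 hl
    (fun n => by rw [hF1.nat 13 rfl, hz 13 n (by norm_num)]) (by omega)).mono fun s2 hF2 hr => ?_)
  have hs2 : Searching P σ P.pairAt 1 s2 := by
    refine ⟨hr, fun h => absurd ?_ h, .inr fun G hG => hG.card_pos⟩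
    rw [Mem.outCount, hF2.nat 4 rfl, hF1.nat 4 rfl, hz 4 0 (by norm_num)]
  refine Prog.Runs.seqs_cons ((searchOne_runs hσ hN hs2).mono fun s3 hF3 hs3 => ?_)
  refine Prog.Runs.seqs_cons ((searchTwo_runs hσ hN hs3).mono fun s4 hF4 hs4 => ?_)
  refine Prog.Runs.seqs_cons ((searchThree_runs hσ hN hC hs4
    (fun n => by rw [hF4.nat 14 rfl, hF3.nat 14 rfl, hF2.nat 14 rfl, hF1.nat 14 rfl,
      hz 14 n (by norm_num)])
    (fun n => by rw [hF4.nat 15 rfl, hF3.nat 15 rfl, hF2.nat 15 rfl, hF1.nat 15 rfl,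
      hz 15 n (by norm_num)])).mono fun s5 _ hs5 => ?_)
  refine Prog.Runs.seqs_cons ((searchFour_runs hσ hN hs5).mono fun s6 _ hs6 => ?_)
  exact Prog.Runs.seqs_nil (hs6.answered_of_five hσ)

end Snapping

theorem theorem2 :
    ∃ minimalSnappingFixture : Snapping.Cmd,
      ∀ g : ℕ, ∃ C : ℕ, ∀ P : Snapping.Polyhedron, P.genus ≤ (g : ℤ) →
        ∃ (s : Snapping.Mem) (T : ℕ),
          Snapping.Exec minimalSnappingFixture P.input s T ∧
          T ≤ C * P.numV ^ 3 ∧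
          P.Answered s := by
  refine ⟨Snapping.minimalFixtureProg.toCmd, fun g =>
    -- Short loops have at most `4 * g + 8` rounds, long ones at most `3 * numT ≤ 3 * (2 + 4 * g) *
    -- numV`; the latter bound enters with exponent three, the depth of the program.
    ⟨Snapping.minimalFixtureProg.cost 1 (4 * g + 8) * (3 * (2 + 4 * g)) ^ 3, fun P hg => ?_⟩⟩
  obtain ⟨s, t, h1, h2, -, h3⟩ := Snapping.minimalFixtureProg_runs P (N := 3 * P.numT)
    (C := 4 * g + 8) le_rfl fun f hf S hS => P.card_common_neighbors_le hg hf S hS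
  refine ⟨s, t, h1, h2.trans ((Snapping.Prog.cost_le _ _ ?_ _).trans ?_), h3⟩
  · have := P.numT_pos
    omega
  · rw [Snapping.minimalFixtureProg_depth, mul_assoc, ← mul_pow]
    refine Nat.mul_le_mul_left _ (Nat.pow_le_pow_left ?_ 3)
    rw [mul_assoc]
    exact Nat.mul_le_mul_left 3 (P.numT_le hg)
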